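/- Fix a dimension $d$. A flow is a family of maps $S_t=(X(t,\cdot),V(t,\cdot)):\mathbb{R}^d\times\mathbb{R}^d\to\mathbb{R}^d\times\mathbb{R}^d$, $t\in\mathbb{R}$. It solves Newton's equations with force $F:\mathbb{R}^d\to\mathbb{R}^d$ if, for almost every $(x,v)$ and all $t\in\mathbb{R}$, $$\partial_tX(t,x,v)=V(t,x,v),\qquad V(t,x,v)=V(0,x,v)+\int_0^tF(X(s,x,v))\,ds .$$ It has Property 1 if every $S_t$ is a bijection of $\mathbb{R}^{2d}$ that preserves Lebesgue measure, and $S_{t+s}=S_s\circ S_0^{-1}\circ S_t$ for all $s,t\in\mathbb{R}$ (that is, $S_{t+s}=S_s\circ S_t$ when $S_0=\mathrm{id}$). Let $T>0$, $A>0$, and let $\Omega\subset\mathbb{R}^{2d}$ be compact. Let $\Omega'\subset\mathbb{R}^{2d}$ be a compact set such that, for every measurable $G$ with $|G|\le A$, every trajectory of Newton's equations with force $G$ that starts at distance smaller than $1$ from $\Omega$ stays in $\Omega'$ for $t\in[0,T]$. Let $\Omega''\subset\mathbb{R}^{2d}$ be a compact set such that, for every such $G$, every trajectory that starts at distance smaller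 than $1$ from $\Omega'$ stays in $\Omega''$ for $t\in[-T,0]$. Let $\Omega''_1$ be the projection of $\Omega''$ to the position space $\mathbb{R}^d$, and let $$\|F\|_{H^s(\Omega''_1)}=\inf\{\|G\|_{H^s(\mathbb{R}^d)}: G=F\text{ a.e. on }\Omega''_1\}\le\|F\|_{H^s(\mathbb{R}^d)} .$$ There is a constant $C>0$, depending only on $d$, $\operatorname{diam}(\Omega')$, $|\Omega''|$, $T$ and $A$ (and bounded when upper bounds of $\operatorname{diam}(\Omega')$ and $|\Omega''|$ are given), such that the following holds for all $a\in(0,1/4)$, all $F\in H^{3/4+a}(\mathbb{R}^d)$ with $\|F\|_{L^\infty}\le A$, all $0<|\delta|<1/e$, and all flows $(X,V)$ and $(X^\delta,V^\delta)$ that solve Newton's equations with force $F$, have Property 1, and satisfy $X(0,x,v)=x$, $V(0,x,v)=v$, $|X(0,x,v)-X^\delta(0,x,v)|\le|\delta|$ and $|V(0,x,v)-V^\delta(0,x,v)|\le|\delta|$ for all $(x,v)$. The quantity $$Q_\delta(T)=\iint_\Omega\log\Bigl(1+\frac1{|\delta|^2}\Bigl(\sup_{0\le t\le T}|X-X^\delta|^2+\int_0^T|V-V^\delta|^2\,dt\Bigr)\Bigr)\,dx\,dv$$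 is well defined (the integrand is integrable on $\Omega$), and $$Q_\delta(T)\le C\Bigl(1+\bigl(\log\tfrac1{|\delta|}\bigr)^{\max\{1-2a,\,1/2\}}\Bigr)\bigl(1+\|F\|_{H^{3/4+a}(\Omega''_1)}\bigr).$$ -/

import Mathlib

open Set MeasureTheory
open scoped ENNReal FourierTransform

/-- Euclidean space `ℝ^d` of positions, or of velocities. -/
abbrev Pos (d : ℕ) : Type := EuclideanSpace ℝ (Fin d)

/-- The phase space `ℝ^d × ℝ^d`, with Lebesgue measure as its volume. -/
abbrev Phase (d : ℕ) : Type := Pos d × Pos d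

/-- The Euclidean distance of `ℝ^{2d}` (the product type carries the maximum distance). -/
noncomputable def phaseDist {d : ℕ} (p q : Phase d) : ℝ :=
  Real.sqrt (‖p.1 - q.1‖ ^ 2 + ‖p.2 - q.2‖ ^ 2)

/-! ### Newton's equations -/

/-- `t ↦ (x t, v t)` solves `x' = v`, `v' = F(x)` on the whole line, in the sense of
Carathéodory: the second equation is understood in integrated form. -/
structure IsNewtonTrajectory {d : ℕ} (F : Pos d → Pos d) (x v : ℝ → Pos d) : Prop where
  position : ∀ t, HasDerivAt x (v t) t
  force_integrable : ∀ t, IntervalIntegrable (fun s => F (x s)) volume 0 t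
  velocity : ∀ t, v t = v 0 + ∫ s in (0 : ℝ)..t, F (x s)

/-- Each time-`t` map `S t = (X(t, ·), V(t, ·))` is a volume-preserving bijection of phase space,
and `S` has the semigroup property: the trajectory that starts (at time `0`) at the point `S t ξ`
is at time `s` at the point `S (t + s) ξ`.  When `S 0` is the identity, the last clause reads
`S (t + s) ξ = S s (S t ξ)`; in general it says `S (t + s) = S s ∘ (S 0)⁻¹ ∘ S t`, so that it also
applies to a flow with perturbed initial data, such as `(t, ξ) ↦ S t (ξ + δ)`. -/
structure IsHamiltonianFlow {d : ℕ} (S : ℝ → Phase d → Phase d) : Prop where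
  bijective : ∀ t, Function.Bijective (S t)
  volume_preserving : ∀ t, MeasurePreserving (S t) volume volume
  semigroup : ∀ s t ξ η, S 0 η = S t ξ → S (t + s) ξ = S s η

/-- `S` is a solution of Newton's equations with force `F` for almost every label `ξ`.  For a flow
made of volume-preserving maps this does not change when `F` is modified on a null set. -/
def SolvesNewton {d : ℕ} (F : Pos d → Pos d) (S : ℝ → Phase d → Phase d) : Prop :=
  ∀ᵐ ξ : Phase d, IsNewtonTrajectory F (fun t => (S t ξ).1) (fun t => (S t ξ).2)

/-- `K'` contains the position at each time `t ∈ I` of each trajectory, for each force field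
bounded by `A`, whose initial point is at distance smaller than `1` from `K`. -/
def ContainsTrajectories {d : ℕ} (A : ℝ) (I : Set ℝ) (K K' : Set (Phase d)) : Prop :=
  ∀ F : Pos d → Pos d, Measurable F → (∀ y, ‖F y‖ ≤ A) →
    ∀ x v : ℝ → Pos d, IsNewtonTrajectory F x v →
      (∃ p ∈ K, phaseDist (x 0, v 0) p < 1) → ∀ t ∈ I, (x t, v t) ∈ K'

/-! ### Sobolev norms of fractional order -/

/-- A real vector field, seen as a complex one. -/
noncomputable def complexify {d : ℕ} (F : Pos d → Pos d) (x : Pos d) : EuclideanSpace ℂ (Fin d) :=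
  WithLp.toLp 2 (fun i => ((F x i : ℝ) : ℂ))

/-- The norm of `H^s(ℝ^d)`, `s ≥ 0`: the square root of `∫ (1 + |2πk|²)^s |F̂(k)|² dk`, with `F̂` the
`L²` Fourier transform for the kernel `exp(-2πi k·x)`; it is `∞` when `F` is not in `L²`. -/
noncomputable def sobolevENorm {d : ℕ} (s : ℝ) (F : Pos d → Pos d) : ℝ≥0∞ :=
  ⨅ h : MemLp (complexify F) 2 volume,
    (∫⁻ k : Pos d, ENNReal.ofReal ((1 + (2 * Real.pi * ‖k‖) ^ 2) ^ s) *
      ‖(𝓕 (h.toLp (complexify F)) : Lp (EuclideanSpace ℂ (Fin d)) 2 (volume : Measure (Pos d))) k‖ₑ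
        ^ 2) ^ (1 / 2 : ℝ)

/-- `F ∈ H^s(ℝ^d)`. -/
def MemH {d : ℕ} (s : ℝ) (F : Pos d → Pos d) : Prop :=
  sobolevENorm s F < ∞

/-- The norm of `H^s(K)`, as the space of restrictions to `K ⊆ ℝ^d` of fields of `H^s(ℝ^d)`: the
infimum of the norms of the extensions.  It is meant for fields `F` with such an extension. -/
noncomputable def sobolevNormOn {d : ℕ} (s : ℝ) (K : Set (Pos d)) (F : Pos d → Pos d) : ℝ :=
  (⨅ (G : Pos d → Pos d) (_ : G =ᵐ[volume.restrict K] F), sobolevENorm s G).toReal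

/-! ### The functional -/

/-- `log (1 + δ⁻² (sup_{0 ≤ t ≤ T} |X - X^δ|² + ∫_0^T |V - V^δ|² dt))` at the label `ξ`. -/
noncomputable def logSeparation {d : ℕ} (T δ : ℝ) (S S' : ℝ → Phase d → Phase d)
    (ξ : Phase d) : ℝ :=
  Real.log (1 + 1 / δ ^ 2 *
    (sSup ((fun t => ‖(S t ξ).1 - (S' t ξ).1‖ ^ 2) '' Icc 0 T) +
      ∫ t in (0 : ℝ)..T, ‖(S t ξ).2 - (S' t ξ).2‖ ^ 2))

/-- The functional `Q_δ(T)`, as an integral over `Ω`. -/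
noncomputable def Qfun {d : ℕ} (Ω : Set (Phase d)) (T δ : ℝ) (S S' : ℝ → Phase d → Phase d) : ℝ :=
  ∫ ξ in Ω, logSeparation T δ S S' ξ

/-! ### The Fourier transform of functions that are integrable and square integrable -/

section Plancherel

open scoped SchwartzMap RealInnerProductSpace ContDiff

variable {V E : Type*} [NormedAddCommGroup V] [InnerProductSpace ℝ V] [FiniteDimensional ℝ V]
  [MeasurableSpace V] [BorelSpace V]
  [NormedAddCommGroup E] [InnerProductSpace ℂ E]

/-! With only 3/4 + a derivatives on the force, a Gronwall argument based on ∇F is not available.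
What replaces it is the motion itself: along a trajectory a high-frequency part of the force is
averaged over a segment, and averaging over velocities makes these segment averages small.

Take a dyadic block g of frequency R = 2^j of a Sobolev extension G of the force, and put h =
R^(-1/2). The function H(x,v) = -h ∫₀¹ (1-s) g(x+hsv) ds satisfies v·∇ₓH = g - r, where r is the
mean of g over the segment from x to x+hv. With a common majorant B, the function H is of size hB,
∇ₓH of size hRB, ∇ᵥH of size h²RB = B, and r of size B; the choice Rh² = 1 balances the error F·∇ᵥH
against r (`exists_isCorrector`). Plancherel in x and a Gaussian average in v bound the L² norm of B
over bounded velocities by a multiple of R^(-1/4) ‖g‖ (`eLpNorm_blockMajorant_le`). Since g is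
band-limited, B may be a local average at scale 1/R, and it then controls increments in x pointwise,
but only between points with the same velocity.

From V - V' one subtracts, for each block, H(X,V) - χ H(X',V) - (1-χ) H(X',V'), with a cutoff χ in
R|X-X'|. This is O(hR|X-X'|(B+B')) although no increment of H in velocity is ever estimated
(`norm_threePoint_le`), and its time derivative cancels g(X) - g(X') up to acceptable errors
(`IsCorrector.exists_hasDerivAt`). If w is the corrected difference, log(δ² + |X-X'|² + |w|²) grows
at a rate bounded by a multiple of 1 + L² + M + ε/δ, evaluated along both trajectories, where L sums
hRB, M sums RB, and ε is the part of the force outside the chosen blocks (`energy_le`).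

Integrating over labels, measure preservation turns everything into integrals over Ω'. The terms of
L decay like R^(-1/2-a) and those of M like R^(-a), so that 3/4 is the critical exponent and M costs
1/a. Letting the number of blocks tend to infinity at fixed δ removes ε, and Q ≤ C(1 + n² + n/a)
with n the norm of G, uniformly in δ (`exists_lintegral_logSeparation_le`). The speed bound gives Q
≤ C log(1/δ) (`log_separation_le_log`). Interpolating between the two
(`le_mul_of_le_linear_of_le_quadratic`) gives an estimate that is affine in n, and the infimum over
extensions can then be taken. -/

theorem continuous_fourierInv {μ : V → E} (h1 : Integrable μ) : Continuous (𝓕⁻ μ) :=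
  VectorFourier.fourierIntegral_continuous Real.continuous_fourierChar
    (by simp only [LinearMap.neg_apply, innerₗ_apply_apply]; fun_prop) h1

theorem norm_fourierInv_le (μ : V → E) (x : V) : ‖𝓕⁻ μ x‖ ≤ ∫ k, ‖μ k‖ :=
  VectorFourier.norm_fourierIntegral_le_integral_norm _ _ _ _ _

variable [CompleteSpace E]

theorem integral_fourierInv_smul_eq {f : V → ℂ} {g : V → E} (hf : Integrable f)
    (hg : Integrable g) : ∫ x, 𝓕⁻ f x • g x = ∫ x, f x • 𝓕⁻ g x := by
  have hL : Continuous fun p : V × V ↦ (-innerₗ V) p.1 p.2 := by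
    simp only [LinearMap.neg_apply, innerₗ_apply_apply]; fun_prop
  have h := VectorFourier.integral_fourierIntegral_smul_eq_flip (L := -innerₗ V)
    (μ := volume) (ν := volume) Real.continuous_fourierChar hL hf hg
  have hflip : (-innerₗ V).flip = -innerₗ V := by
    ext x y
    simp [real_inner_comm]
  rw [hflip] at h
  exact h

/-- Bridges the abstract L² transform and the pointwise integral formula: against a smooth compactly
supported test function both transforms move onto the test function, which is Schwartz, where the
two definitions coincide. -/
theorem fourierInv_toLp_ae_eq {μ : V → E} (h1 : Integrable μ) (h2 : MemLp μ 2) :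
    (𝓕⁻ (h2.toLp μ) : Lp E 2 (volume : Measure V)) =ᵐ[volume] 𝓕⁻ μ := by
  refine ae_eq_of_integral_contDiff_smul_eq ((Lp.memLp _).locallyIntegrable one_le_two)
    (continuous_fourierInv h1).locallyIntegrable fun g hg hc => ?_
  have hg₁ : HasCompactSupport (Complex.ofRealCLM ∘ g) := hc.comp_left rfl
  have hg₂ : ContDiff ℝ ∞ (Complex.ofRealCLM ∘ g) := Complex.ofRealCLM.contDiff.comp hg
  set G : 𝓢(V, ℂ) := hg₁.toSchwartzMap hg₂ with hG
  have hGg : ∀ x, G x = (g x : ℂ) := fun x => rfl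
  calc ∫ x, g x • (𝓕⁻ (h2.toLp μ) : Lp E 2 (volume : Measure V)) x
      = Lp.toTemperedDistribution (𝓕⁻ (h2.toLp μ)) G := by
        simp [hGg]
    _ = ∫ x, (𝓕⁻ G) x • (h2.toLp μ) x := by
        rw [← Lp.fourierInv_toTemperedDistribution_eq, TemperedDistribution.fourierInv_apply,
          Lp.toTemperedDistribution_apply]
    _ = ∫ x, 𝓕⁻ (G : V → ℂ) x • μ x := by
        refine integral_congr_ae ?_
        filter_upwards [h2.coeFn_toLp] with x hx
        rw [hx, SchwartzMap.fourierInv_coe]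
    _ = ∫ x, G x • 𝓕⁻ μ x := integral_fourierInv_smul_eq G.integrable h1
    _ = ∫ x, g x • 𝓕⁻ μ x := by simp [hGg]

theorem lintegral_enorm_sq_fourierInv {μ : V → E} (h1 : Integrable μ) (h2 : MemLp μ 2) :
    ∫⁻ x, ‖𝓕⁻ μ x‖ₑ ^ 2 = ∫⁻ k, ‖μ k‖ₑ ^ 2 := by
  have key : eLpNorm (𝓕⁻ μ) 2 volume = eLpNorm μ 2 volume := by
    rw [← eLpNorm_congr_ae (fourierInv_toLp_ae_eq h1 h2), ← eLpNorm_congr_ae h2.coeFn_toLp,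
      ← Lp.enorm_def, ← Lp.enorm_def]
    have : ‖(𝓕⁻ (h2.toLp μ) : Lp E 2 (volume : Measure V))‖ = ‖h2.toLp μ‖ :=
      (Lp.fourierTransformₗᵢ V E).symm.norm_map _
    rw [← ofReal_norm, ← ofReal_norm, this]
  have h := congrArg (fun t : ℝ≥0∞ => t ^ (2 : ℝ)) key
  simp only [eLpNorm_eq_lintegral_rpow_enorm_toReal two_ne_zero ENNReal.ofNat_ne_top,
    ENNReal.toReal_ofNat, ← ENNReal.rpow_mul] at h
  norm_num at h
  exact h

end Plancherel

/-! ### Averages along straight lines -/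

section Averages

open scoped RealInnerProductSpace

/-- The uniform probability measure on the unit interval. -/
noncomputable abbrev unitMeasure : Measure ℝ := volume.restrict (Ioc (0 : ℝ) 1)

variable {V E : Type*} [NormedAddCommGroup V] [InnerProductSpace ℝ V]

/-- The average of `f` over the segment from `x` to `x + h v`, with weight `w`. -/
noncomputable def lineAvg [NormedAddCommGroup E] [NormedSpace ℝ E]
    (w : ℝ → ℝ) (h : ℝ) (f : V → E) (x v : V) : E :=
  ∫ s, w s • f (x + (h * s) • v) ∂unitMeasure

/-- The Fourier multiplier of a weighted average over a segment. -/
noncomputable def lineSymbol (w : ℝ → ℝ) (θ : ℝ) : ℂ :=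
  ∫ s, w s • (Real.fourierChar (s * θ) : ℂ) ∂unitMeasure

/-- A weight on the unit interval: a continuous function that is at most `1` there. -/
structure IsUnitWeight (w : ℝ → ℝ) : Prop where
  continuous : Continuous w
  abs_le : ∀ s ∈ Ioc (0 : ℝ) 1, |w s| ≤ 1

theorem IsUnitWeight.ae_abs_le {w : ℝ → ℝ} (hw : IsUnitWeight w) :
    ∀ᵐ s ∂unitMeasure, |w s| ≤ 1 :=
  ae_restrict_of_forall_mem measurableSet_Ioc hw.abs_le

instance : IsProbabilityMeasure unitMeasure := ⟨by simp [unitMeasure]⟩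

theorem norm_lineSymbol_le {w : ℝ → ℝ} (hw : IsUnitWeight w) (θ : ℝ) : ‖lineSymbol w θ‖ ≤ 1 := by
  have h := norm_integral_le_of_norm_le_const (μ := unitMeasure)
    (f := fun s => w s • (Real.fourierChar (s * θ) : ℂ)) (C := 1) (by
      filter_upwards [hw.ae_abs_le] with s hs
      rw [norm_smul, Circle.norm_coe, mul_one]; exact hs)
  simpa [lineSymbol] using h

theorem continuous_lineSymbol {w : ℝ → ℝ} (hw : IsUnitWeight w) : Continuous (lineSymbol w) := by
  have hc := hw.continuous
  refine continuous_of_dominated (bound := fun _ => 1) (fun θ => ?_) (fun θ => ?_)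
    (integrable_const _) (ae_of_all _ fun s => ?_)
  · exact Continuous.aestronglyMeasurable (by fun_prop)
  · filter_upwards [hw.ae_abs_le] with s hs
    rw [norm_smul, Circle.norm_coe, mul_one]; exact hs
  · fun_prop

/-- The Gaussian weight centred at `v₀`. -/
noncomputable def gaussWeight (v₀ v : V) : ℝ := Real.exp (-Real.pi * ‖v - v₀‖ ^ 2)

omit [InnerProductSpace ℝ V] in
theorem continuous_gaussWeight (v₀ : V) : Continuous (gaussWeight v₀) := by
  unfold gaussWeight; fun_prop

variable [FiniteDimensional ℝ V] [MeasurableSpace V] [BorelSpace V]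
  [NormedAddCommGroup E] [InnerProductSpace ℂ E] [CompleteSpace E]

/-- For fixed v, averaging along v is a Fourier multiplier in x: the plane wave of frequency k is an
eigenfunction, with eigenvalue `lineSymbol w (h * ⟪k, v⟫)`. -/
theorem lineAvg_fourierInv {w : ℝ → ℝ} (hw : IsUnitWeight w) (h : ℝ) {μ : V → E}
    (hμ : Integrable μ) (x v : V) :
    lineAvg w h (𝓕⁻ μ) x v = 𝓕⁻ (fun k => lineSymbol w (h * ⟪k, v⟫) • μ k) x := by
  have hc := hw.continuous
  have h1 : ∀ s : ℝ, w s • 𝓕⁻ μ (x + (h * s) • v)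
      = ∫ k, ((w s • (Real.fourierChar (s * (h * ⟪k, v⟫)) : ℂ)) *
          (Real.fourierChar ⟪k, x⟫ : ℂ)) • μ k := by
    intro s
    rw [Real.fourierInv_eq, ← integral_smul]
    refine integral_congr_ae (ae_of_all _ fun k => ?_)
    simp only [Circle.smul_def]
    rw [inner_add_right, inner_smul_right, AddChar.map_add_eq_mul, Circle.coe_mul,
      ← smul_assoc]
    have : h * s * ⟪k, v⟫ = s * (h * ⟪k, v⟫) := by ring
    rw [this, smul_mul_assoc, mul_comm (Real.fourierChar (s * (h * ⟪k, v⟫)) : ℂ)]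
  have h2 : ∀ k : V, Real.fourierChar ⟪k, x⟫ • (lineSymbol w (h * ⟪k, v⟫) • μ k)
      = ∫ s, ((w s • (Real.fourierChar (s * (h * ⟪k, v⟫)) : ℂ)) *
          (Real.fourierChar ⟪k, x⟫ : ℂ)) • μ k ∂unitMeasure := by
    intro k
    rw [integral_smul_const, integral_mul_const, Circle.smul_def, smul_smul, mul_comm]
    rfl
  rw [lineAvg, Real.fourierInv_eq]
  simp_rw [h1, h2]
  refine integral_integral_swap ?_
  have hb : Integrable (fun p : ℝ × V => (1 : ℝ) * ‖μ p.2‖) (unitMeasure.prod volume) :=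
    (integrable_const (1 : ℝ)).mul_prod hμ.norm
  refine hb.mono' ?_ ?_
  · refine AEStronglyMeasurable.smul (Continuous.aestronglyMeasurable ?_) hμ.1.comp_snd
    fun_prop
  · have : ∀ᵐ p : ℝ × V ∂(unitMeasure.prod volume), |w p.1| ≤ 1 :=
      Measure.quasiMeasurePreserving_fst.ae hw.ae_abs_le
    filter_upwards [this] with p hp
    simp only [Function.uncurry_def]
    rw [norm_smul, norm_mul, norm_smul, Circle.norm_coe, Circle.norm_coe, mul_one, mul_one]
    exact mul_le_mul_of_nonneg_right hp (norm_nonneg _)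

theorem integrable_gaussWeight (v₀ : V) : Integrable (gaussWeight v₀) := by
  have h := GaussianFourier.integrable_cexp_neg_mul_sq_norm_add
    (b := (Real.pi : ℂ)) (by simp [Real.pi_pos]) 0 (0 : V)
  have h2 := (h.norm).comp_sub_right v₀
  refine h2.congr (ae_of_all _ fun v => ?_)
  simp only [gaussWeight, Complex.norm_exp]
  congr 1
  simp [← Complex.ofReal_pow]

/-- The Gaussian is its own Fourier transform; moving its centre only multiplies by a phase, so the
modulus does not depend on `v₀`. -/
theorem norm_integral_gaussWeight_mul_char (v₀ y : V) :
    ‖∫ v, (gaussWeight v₀ v : ℂ) * (Real.fourierChar ⟪y, v⟫ : ℂ)‖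
      = Real.exp (-Real.pi * ‖y‖ ^ 2) := by
  have h1 : ∫ v, (gaussWeight v₀ v : ℂ) * (Real.fourierChar ⟪y, v⟫ : ℂ)
      = (Real.fourierChar ⟪y, v₀⟫ : ℂ) *
        ∫ v, Complex.exp (-(Real.pi : ℂ) * ‖v‖ ^ 2 + (2 * Real.pi * Complex.I) * ⟪y, v⟫) := by
    rw [← integral_sub_right_eq_self (fun v : V =>
      Complex.exp (-(Real.pi : ℂ) * ‖v‖ ^ 2 + (2 * Real.pi * Complex.I) * ⟪y, v⟫)) v₀,
      ← integral_const_mul]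
    refine integral_congr_ae (ae_of_all _ fun v => ?_)
    simp only [gaussWeight, Real.fourierChar_apply, inner_sub_right]
    push_cast
    rw [← Complex.exp_add, ← Complex.exp_add]
    congr 1
    ring
  rw [h1, norm_mul, Circle.norm_coe, one_mul, GaussianFourier.integral_cexp_neg_mul_sq_norm_add
    (by simp [Real.pi_pos]), div_self (by simp), Complex.one_cpow,
    one_mul, Complex.norm_exp]
  congr 1
  have : (2 * (Real.pi : ℂ) * Complex.I) ^ 2 * (‖y‖ : ℂ) ^ 2 / (4 * Real.pi)
      = ((-Real.pi * ‖y‖ ^ 2 : ℝ) : ℂ) := by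
    have hpi : (Real.pi : ℂ) ≠ 0 := by simp [Real.pi_ne_zero]
    push_cast
    rw [mul_pow, Complex.I_sq]
    field_simp
    ring
  rw [this, Complex.ofReal_re]

theorem exp_neg_pi_mul_sq_le_one (c : ℝ) : Real.exp (-Real.pi * c ^ 2) ≤ 1 := by
  rw [Real.exp_le_one_iff, neg_mul, neg_nonpos]
  positivity

/-- The integral is at most 1, because the measure is a probability, and at most 1/|c|, the Gaussian
integral over the whole line. -/
theorem integral_unit_gauss_le {c B : ℝ} (h : 1 ≤ B ∨ 1 ≤ B * |c|) (s : ℝ) :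
    ∫ t, Real.exp (-Real.pi * (c * (s - t)) ^ 2) ∂unitMeasure ≤ B := by
  have hle1 : ∀ t, Real.exp (-Real.pi * (c * (s - t)) ^ 2) ≤ 1 := fun t =>
    exp_neg_pi_mul_sq_le_one _
  rcases h with h | h
  · refine le_trans ?_ h
    have := norm_integral_le_of_norm_le_const (μ := unitMeasure)
      (f := fun t => Real.exp (-Real.pi * (c * (s - t)) ^ 2)) (C := 1)
      (ae_of_all _ fun t => by simpa using hle1 t)
    simpa using (le_abs_self _).trans this
  · have hc : c ≠ 0 := by
      rintro rfl; simp at h; linarith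
    have hc' : 0 < |c| := abs_pos.2 hc
    have hb : 0 < Real.pi * c ^ 2 := by have := Real.pi_pos; positivity
    have hi : Integrable (fun t : ℝ => Real.exp (-(Real.pi * c ^ 2) * t ^ 2)) :=
      integrable_exp_neg_mul_sq hb
    have heq : ∀ t, Real.exp (-Real.pi * (c * (s - t)) ^ 2)
        = Real.exp (-(Real.pi * c ^ 2) * (s - t) ^ 2) := fun t => by congr 1; ring
    simp_rw [heq]
    calc ∫ t, Real.exp (-(Real.pi * c ^ 2) * (s - t) ^ 2) ∂unitMeasure
        ≤ ∫ t, Real.exp (-(Real.pi * c ^ 2) * (s - t) ^ 2) :=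
          setIntegral_le_integral (hi.comp_sub_left s) (ae_of_all _ fun t => (Real.exp_pos _).le)
      _ = ∫ t : ℝ, Real.exp (-(Real.pi * c ^ 2) * t ^ 2) :=
          integral_sub_left_eq_self (fun t : ℝ => Real.exp (-(Real.pi * c ^ 2) * t ^ 2)) volume s
      _ = 1 / |c| := by
          rw [integral_gaussian, div_mul_eq_div_div, div_self Real.pi_ne_zero,
            Real.sqrt_div zero_le_one, Real.sqrt_sq_eq_abs, Real.sqrt_one]
      _ ≤ B := by rw [div_le_iff₀ hc']; exact h

/-- A velocity average of the multiplier gains half a derivative. -/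
theorem lintegral_gaussWeight_lineSymbol_le {w : ℝ → ℝ} (hw : IsUnitWeight w) {h B : ℝ}
    (v₀ k : V) (hk : 1 ≤ B ∨ 1 ≤ B * |h * ‖k‖|) :
    ∫⁻ v, ENNReal.ofReal (gaussWeight v₀ v) * ‖lineSymbol w (h * ⟪k, v⟫)‖ₑ ^ 2
      ≤ ENNReal.ofReal B := by
  have hc := hw.continuous
  set ρ := unitMeasure.prod unitMeasure with hρ
  have hg0 : ∀ v, 0 ≤ gaussWeight v₀ v := fun v => (Real.exp_pos _).le
  -- The squared modulus of the symbol is a double integral over two parameters s, t of the segment.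
  -- Integrating in v first turns the character into a Gaussian in h|k|(s-t), whose integral in t is
  -- at most `B`.
  set K : ℝ × ℝ → V → ℂ := fun p v => ((w p.1 * w p.2 : ℝ) : ℂ) *
    ((gaussWeight v₀ v : ℂ) * (Real.fourierChar ⟪((p.1 - p.2) * h) • k, v⟫ : ℂ)) with hK
  have hsq : ∀ v, ((gaussWeight v₀ v * ‖lineSymbol w (h * ⟪k, v⟫)‖ ^ 2 : ℝ) : ℂ)
      = ∫ p, K p v ∂ρ := by
    intro v
    set θ := h * ⟪k, v⟫
    have h1 : ((‖lineSymbol w θ‖ ^ 2 : ℝ) : ℂ)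
        = lineSymbol w θ * (starRingEnd ℂ) (lineSymbol w θ) := by
      rw [Complex.mul_conj, Complex.normSq_eq_norm_sq]
    have h2 : (starRingEnd ℂ) (lineSymbol w θ)
        = ∫ s, w s • (Real.fourierChar (-(s * θ)) : ℂ) ∂unitMeasure := by
      rw [lineSymbol, ← integral_conj]
      refine integral_congr_ae (ae_of_all _ fun s => ?_)
      simp only [Complex.real_smul, map_mul, Complex.conj_ofReal]
      rw [AddChar.map_neg_eq_inv, Circle.coe_inv_eq_conj]
    rw [Complex.ofReal_mul, h1, h2, lineSymbol, ← integral_prod_mul, ← integral_const_mul]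
    refine integral_congr_ae (ae_of_all _ fun p => ?_)
    simp only [hK, Complex.real_smul]
    have : ⟪((p.1 - p.2) * h) • k, v⟫ = p.1 * θ + -(p.2 * θ) := by
      rw [real_inner_smul_left]; ring
    rw [this, AddChar.map_add_eq_mul, Circle.coe_mul]
    push_cast
    ring
  have hint : Integrable (Function.uncurry K) (ρ.prod volume) := by
    have hb : Integrable (fun q : (ℝ × ℝ) × V => (1 : ℝ) * gaussWeight v₀ q.2)
        (ρ.prod volume) := (integrable_const (1 : ℝ)).mul_prod (integrable_gaussWeight v₀)
    refine hb.mono' (Continuous.aestronglyMeasurable ?_) ?_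
    · have := continuous_gaussWeight v₀
      simp only [hK, Function.uncurry_def]
      fun_prop
    · have e1 : ∀ᵐ q : (ℝ × ℝ) × V ∂(ρ.prod volume), |w q.1.1| ≤ 1 :=
        (Measure.quasiMeasurePreserving_fst.comp
          Measure.quasiMeasurePreserving_fst).ae hw.ae_abs_le
      have e2 : ∀ᵐ q : (ℝ × ℝ) × V ∂(ρ.prod volume), |w q.1.2| ≤ 1 :=
        (Measure.quasiMeasurePreserving_snd.comp
          Measure.quasiMeasurePreserving_fst).ae hw.ae_abs_le
      filter_upwards [e1, e2] with q h1 h2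
      simp only [hK, Function.uncurry_def, norm_mul, Circle.norm_coe, mul_one,
        Complex.norm_real, Real.norm_eq_abs, abs_of_nonneg (hg0 _)]
      exact mul_le_mul_of_nonneg_right (mul_le_one₀ h1 (abs_nonneg _) h2) (hg0 _)
  have hI : ∫ v, gaussWeight v₀ v * ‖lineSymbol w (h * ⟪k, v⟫)‖ ^ 2 ≤ B := by
    have e : ((∫ v, gaussWeight v₀ v * ‖lineSymbol w (h * ⟪k, v⟫)‖ ^ 2 : ℝ) : ℂ)
        = ∫ p, (∫ v, K p v) ∂ρ := by
      rw [← integral_complex_ofReal]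
      simp_rw [hsq]
      exact (integral_integral_swap hint).symm
    have hpi : Integrable (fun p : ℝ × ℝ =>
        Real.exp (-Real.pi * (h * ‖k‖ * (p.1 - p.2)) ^ 2)) ρ := by
      refine (integrable_const (1 : ℝ)).mono' (Continuous.aestronglyMeasurable (by fun_prop))
        (ae_of_all _ fun p => ?_)
      rw [Real.norm_eq_abs, abs_of_pos (Real.exp_pos _)]
      exact exp_neg_pi_mul_sq_le_one _
    calc ∫ v, gaussWeight v₀ v * ‖lineSymbol w (h * ⟪k, v⟫)‖ ^ 2
        ≤ ‖∫ p, (∫ v, K p v) ∂ρ‖ := by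
          rw [← e, Complex.norm_real]; exact le_abs_self _
      _ ≤ ∫ p, Real.exp (-Real.pi * (h * ‖k‖ * (p.1 - p.2)) ^ 2) ∂ρ := by
          refine norm_integral_le_of_norm_le hpi ?_
          have e1 : ∀ᵐ q : ℝ × ℝ ∂ρ, |w q.1| ≤ 1 :=
            Measure.quasiMeasurePreserving_fst.ae hw.ae_abs_le
          have e2 : ∀ᵐ q : ℝ × ℝ ∂ρ, |w q.2| ≤ 1 :=
            Measure.quasiMeasurePreserving_snd.ae hw.ae_abs_le
          filter_upwards [e1, e2] with p h1 h2
          simp only [hK]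
          rw [integral_const_mul, norm_mul, norm_integral_gaussWeight_mul_char,
            Complex.norm_real, norm_mul, Real.norm_eq_abs, Real.norm_eq_abs]
          have : ‖((p.1 - p.2) * h) • k‖ ^ 2 = (h * ‖k‖ * (p.1 - p.2)) ^ 2 := by
            rw [norm_smul, mul_pow, Real.norm_eq_abs, sq_abs]; ring
          rw [this]
          exact mul_le_of_le_one_left (Real.exp_pos _).le (mul_le_one₀ h1 (abs_nonneg _) h2)
      _ = ∫ s, ∫ t, Real.exp (-Real.pi * (h * ‖k‖ * (s - t)) ^ 2) ∂unitMeasure ∂unitMeasure :=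
          integral_prod _ hpi
      _ ≤ ∫ _, B ∂unitMeasure :=
          integral_mono hpi.integral_prod_left (integrable_const _)
            fun s => integral_unit_gauss_le hk s
      _ = B := by simp
  have hint2 : Integrable (fun v => gaussWeight v₀ v * ‖lineSymbol w (h * ⟪k, v⟫)‖ ^ 2) := by
    have := continuous_lineSymbol hw
    have := continuous_gaussWeight v₀
    refine (integrable_gaussWeight v₀).mono' (Continuous.aestronglyMeasurable (by fun_prop))
      (ae_of_all _ fun v => ?_)
    rw [Real.norm_eq_abs, abs_of_nonneg (mul_nonneg (hg0 v) (sq_nonneg _))]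
    exact mul_le_of_le_one_right (hg0 v) (pow_le_one₀ (norm_nonneg _) (norm_lineSymbol_le hw _))
  have := ENNReal.ofReal_le_ofReal hI
  rw [ofReal_integral_eq_lintegral_ofReal hint2
    (ae_of_all _ fun v => mul_nonneg (hg0 v) (sq_nonneg _))] at this
  refine le_trans (le_of_eq ?_) this
  refine lintegral_congr fun v => ?_
  rw [ENNReal.ofReal_mul (hg0 v), ENNReal.ofReal_pow (norm_nonneg _), ofReal_norm]

end Averages

/-! ### Calculus and averaging estimate for line averages -/

section LineAvg

open scoped RealInnerProductSpace

variable {V E : Type*} [NormedAddCommGroup V] [InnerProductSpace ℝ V]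
  [NormedAddCommGroup E] [NormedSpace ℝ E]

theorem continuous_lineAvg {w : ℝ → ℝ} (hw : IsUnitWeight w) (h : ℝ) {f : V → E}
    (hf : Continuous f) {b : ℝ} (hb : ∀ x, ‖f x‖ ≤ b) :
    Continuous fun p : V × V => lineAvg w h f p.1 p.2 := by
  have hc := hw.continuous
  refine continuous_of_dominated (bound := fun _ => b) (fun p => ?_) (fun p => ?_)
    (integrable_const _) (ae_of_all _ fun s => ?_)
  · exact Continuous.aestronglyMeasurable (by fun_prop)
  · filter_upwards [hw.ae_abs_le] with s hs
    rw [norm_smul]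
    exact (mul_le_of_le_one_left (norm_nonneg _) hs).trans (hb _)
  · fun_prop

theorem norm_lineAvg_le {w : ℝ → ℝ} (hw : IsUnitWeight w) (h : ℝ) {f : V → E}
    {b : ℝ} (hb : ∀ x, ‖f x‖ ≤ b) (x v : V) : ‖lineAvg w h f x v‖ ≤ b := by
  have := norm_integral_le_of_norm_le_const (μ := unitMeasure)
    (f := fun s => w s • f (x + (h * s) • v)) (C := b) (by
      filter_upwards [hw.ae_abs_le] with s hs
      rw [norm_smul]
      exact (mul_le_of_le_one_left (norm_nonneg _) hs).trans (hb _))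
  simpa [lineAvg] using this

/-- Differentiation of a line average in position and velocity. -/
theorem hasFDerivAt_lineAvg [CompleteSpace E] {w : ℝ → ℝ} (hw : IsUnitWeight w) (h : ℝ) {f : V → E}
    {f' : V → V →L[ℝ] E} (hf : ∀ x, HasFDerivAt f (f' x) x) (hf' : Continuous f') {b : ℝ}
    (hb : ∀ x, ‖f' x‖ ≤ b) {b₀ : ℝ} (hb₀ : ∀ x, ‖f x‖ ≤ b₀) (p : V × V) :
    HasFDerivAt (fun p : V × V => lineAvg w h f p.1 p.2)
      ((lineAvg w h f' p.1 p.2).comp (ContinuousLinearMap.fst ℝ V V) +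
        (h • lineAvg (fun s => s * w s) h f' p.1 p.2).comp (ContinuousLinearMap.snd ℝ V V)) p := by
  have hc := hw.continuous
  have hfc : Continuous f := continuous_iff_continuousAt.2 fun x => (hf x).continuousAt
  -- Differentiating `f (x + (h * s) • v)` in v brings down `h * s`; the factor s is absorbed into
  -- the weight.
  have hw' : IsUnitWeight fun s => s * w s := ⟨by fun_prop, fun s hs => by
    rw [abs_mul, abs_of_pos hs.1]
    exact mul_le_one₀ hs.2 (abs_nonneg _) (hw.abs_le s hs)⟩
  set L : ℝ → V × V →L[ℝ] V := fun s =>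
    ContinuousLinearMap.fst ℝ V V + (h * s) • ContinuousLinearMap.snd ℝ V V with hL
  have hLc : Continuous L := by simp only [hL]; fun_prop
  have hLp : ∀ s (p : V × V), L s p = p.1 + (h * s) • p.2 := fun s p => by simp [hL]
  have hLn : ∀ s ∈ Ioc (0 : ℝ) 1, ‖L s‖ ≤ 1 + |h| := by
    intro s hs
    refine ContinuousLinearMap.opNorm_le_bound _ (by positivity) fun q => ?_
    rw [hLp]
    refine (norm_add_le _ _).trans ?_
    rw [norm_smul, Real.norm_eq_abs, abs_mul, abs_of_pos hs.1, add_mul, one_mul]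
    have h1 := norm_fst_le q
    have h2 := norm_snd_le q
    have h3 : |h| * s ≤ |h| := mul_le_of_le_one_right (abs_nonneg h) hs.2
    gcongr
  have hb0 : 0 ≤ b := (norm_nonneg _).trans (hb 0)
  have key := hasFDerivAt_integral_of_dominated_of_fderiv_le (μ := unitMeasure) (𝕜 := ℝ)
    (F := fun (p : V × V) s => w s • f (p.1 + (h * s) • p.2))
    (F' := fun (p : V × V) s => w s • (f' (p.1 + (h * s) • p.2)).comp (L s))
    (x₀ := p) (s := Set.univ) (bound := fun _ => b * (1 + |h|)) Filter.univ_mem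
    (Filter.Eventually.of_forall fun p => Continuous.aestronglyMeasurable (by fun_prop))
    (by
      refine (integrable_const b₀).mono' (Continuous.aestronglyMeasurable (by fun_prop)) ?_
      filter_upwards [hw.ae_abs_le] with s hs
      rw [norm_smul]
      exact (mul_le_of_le_one_left (norm_nonneg _) hs).trans (hb₀ _))
    (Continuous.aestronglyMeasurable (by fun_prop))
    (by
      refine ae_restrict_of_forall_mem measurableSet_Ioc fun s hs q _ => ?_
      rw [norm_smul]
      refine (mul_le_of_le_one_left (norm_nonneg _) (hw.abs_le s hs)).trans ?_
      refine (ContinuousLinearMap.opNorm_comp_le _ _).trans ?_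
      exact mul_le_mul (hb _) (hLn s hs) (norm_nonneg _) hb0)
    (integrable_const _)
    (ae_of_all _ fun s q _ => by
      have h1 : HasFDerivAt (fun p : V × V => p.1 + (h * s) • p.2) (L s) q := by
        have := (L s).hasFDerivAt (x := q)
        refine this.congr_of_eventuallyEq (Filter.Eventually.of_forall fun p => (hLp s p).symm)
      exact ((hf _).comp q h1).const_smul (w s))
  refine key.congr_fderiv ?_
  have hi : ∀ {u : ℝ → ℝ}, IsUnitWeight u →
      Integrable (fun s => u s • f' (p.1 + (h * s) • p.2)) unitMeasure := by
    intro u hu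
    have := hu.continuous
    refine (integrable_const b).mono' (Continuous.aestronglyMeasurable (by fun_prop)) ?_
    filter_upwards [hu.ae_abs_le] with s hs
    rw [norm_smul]
    exact (mul_le_of_le_one_left (norm_nonneg _) hs).trans (hb _)
  have e : ∀ s, w s • (f' (p.1 + (h * s) • p.2)).comp (L s)
      = ((ContinuousLinearMap.compL ℝ (V × V) V E).flip (ContinuousLinearMap.fst ℝ V V))
          (w s • f' (p.1 + (h * s) • p.2))
        + ((ContinuousLinearMap.compL ℝ (V × V) V E).flip (ContinuousLinearMap.snd ℝ V V))
          (h • ((s * w s) • f' (p.1 + (h * s) • p.2))) := by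
    intro s
    ext q
    · simp [hL, smul_smul]
    · simp only [hL]
      simp [smul_smul, mul_comm, mul_left_comm]
  have hsm : Integrable (fun s => h • ((s * w s) • f' (p.1 + (h * s) • p.2))) unitMeasure :=
    (hi hw').smul h
  simp_rw [e]
  rw [integral_add (ContinuousLinearMap.integrable_comp _ (hi hw))
    (ContinuousLinearMap.integrable_comp _ hsm),
    ContinuousLinearMap.integral_comp_comm _ (hi hw),
    ContinuousLinearMap.integral_comp_comm _ hsm, integral_smul]
  rfl

/-- Differentiating a line average along its own line. -/
theorem lineAvg_one_sub_fderiv_apply (h : ℝ) {f : V → E} [CompleteSpace E]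
    {f' : V → V →L[ℝ] E} (hf : ∀ x, HasFDerivAt f (f' x) x) (hf' : Continuous f') (x v : V) :
    h • lineAvg (fun s => 1 - s) h f' x v v = lineAvg (fun _ => 1) h f x v - f x := by
  have hfc : Continuous f := continuous_iff_continuousAt.2 fun x => (hf x).continuousAt
  set u : ℝ → E := fun s => f (x + (h * s) • v) with hu
  set u' : ℝ → E := fun s => h • f' (x + (h * s) • v) v with hu'
  have hd : ∀ s, HasDerivAt u (u' s) s := by
    intro s
    have h1 : HasDerivAt (fun s : ℝ => x + (h * s) • v) (h • v) s := by
      have := (((hasDerivAt_id s).const_mul h).smul_const v).const_add x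
      simpa using this
    have := (hf (x + (h * s) • v)).comp_hasDerivAt s h1
    simpa [hu, hu', Function.comp_def] using this
  -- Integration by parts: the weight vanishes at s = 1, so the only boundary term is `-f x`, from s
  -- = 0.
  have hprod : ∀ s, HasDerivAt (fun s => (1 - s) • u s) ((1 - s) • u' s + (-1 : ℝ) • u s) s :=
    fun s => ((hasDerivAt_id s).const_sub 1).smul (hd s)
  have huc : Continuous u := by simp only [hu]; fun_prop
  have huc' : Continuous u' := by simp only [hu']; fun_prop
  have ftc := intervalIntegral.integral_eq_sub_of_hasDerivAt (a := 0) (b := 1)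
    (fun s _ => hprod s) (Continuous.intervalIntegrable (by fun_prop) _ _)
  rw [intervalIntegral.integral_add (Continuous.intervalIntegrable (by fun_prop) _ _)
    (Continuous.intervalIntegrable (by fun_prop) _ _)] at ftc
  have e1 : h • lineAvg (fun s => 1 - s) h f' x v v = ∫ s in (0 : ℝ)..1, (1 - s) • u' s := by
    have hi : Integrable (fun s => (1 - s) • f' (x + (h * s) • v)) unitMeasure :=
      ((show Continuous fun s : ℝ => (1 - s) • f' (x + (h * s) • v) by
        fun_prop).integrableOn_Icc).mono_set Ioc_subset_Icc_self
    rw [intervalIntegral.integral_of_le zero_le_one, lineAvg,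
      ContinuousLinearMap.integral_apply hi, ← integral_smul]
    refine integral_congr_ae (ae_of_all _ fun s => ?_)
    simp [hu', smul_smul, mul_comm]
  have e2 : lineAvg (fun _ => 1) h f x v = ∫ s in (0 : ℝ)..1, u s := by
    rw [intervalIntegral.integral_of_le zero_le_one, lineAvg]
    simp [hu]
  rw [e1, e2]
  simp only [neg_smul, one_smul, intervalIntegral.integral_neg, hu] at ftc ⊢
  simp only [sub_self, zero_smul, mul_zero, add_zero, sub_zero, one_smul, zero_sub] at ftc
  rw [← sub_eq_add_neg, sub_eq_iff_eq_add] at ftc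
  rw [ftc]
  abel

variable {E : Type*} [FiniteDimensional ℝ V] [MeasurableSpace V] [BorelSpace V]
  [NormedAddCommGroup E] [InnerProductSpace ℂ E] [CompleteSpace E]

omit [CompleteSpace E] in
theorem integrable_lineSymbol_smul {w : ℝ → ℝ} (hw : IsUnitWeight w) (h : ℝ) {μ : V → E}
    (h1 : Integrable μ) (v : V) : Integrable fun k => lineSymbol w (h * ⟪k, v⟫) • μ k := by
  have hc := continuous_lineSymbol hw
  refine h1.norm.mono' (AEStronglyMeasurable.smul
    (Continuous.aestronglyMeasurable (by fun_prop)) h1.1) (ae_of_all _ fun k => ?_)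
  rw [norm_smul]
  exact mul_le_of_le_one_left (norm_nonneg _) (norm_lineSymbol_le hw _)

/-- Plancherel in x at each fixed v, then Tonelli, leaves for each frequency the Gaussian average of
the squared symbol. The bound `B`, in essence 1/(h|k|), is required only where μ does not vanish. -/
theorem lintegral_lineAvg_le {w : ℝ → ℝ} (hw : IsUnitWeight w) (h : ℝ) {μ : V → E}
    (h1 : Integrable μ) (h2 : MemLp μ 2) {B : ℝ}
    (hB : ∀ k, μ k ≠ 0 → 1 ≤ B ∨ 1 ≤ B * |h * ‖k‖|) (v₀ : V) :
    ∫⁻ v, ENNReal.ofReal (gaussWeight v₀ v) * ∫⁻ x, ‖lineAvg w h (𝓕⁻ μ) x v‖ₑ ^ 2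
      ≤ ENNReal.ofReal B * ∫⁻ k, ‖μ k‖ₑ ^ 2 := by
  have hc := continuous_lineSymbol hw
  have hg := continuous_gaussWeight v₀
  have hin : ∀ v, ∫⁻ x, ‖lineAvg w h (𝓕⁻ μ) x v‖ₑ ^ 2
      = ∫⁻ k, ‖lineSymbol w (h * ⟪k, v⟫)‖ₑ ^ 2 * ‖μ k‖ₑ ^ 2 := by
    intro v
    have hi := integrable_lineSymbol_smul hw h h1 v
    have hi2 : MemLp (fun k => lineSymbol w (h * ⟪k, v⟫) • μ k) 2 :=
      h2.norm.of_le hi.1 (ae_of_all _ fun k => by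
        rw [norm_smul, norm_norm]
        exact mul_le_of_le_one_left (norm_nonneg _) (norm_lineSymbol_le hw _))
    simp_rw [lineAvg_fourierInv hw h h1]
    rw [lintegral_enorm_sq_fourierInv hi hi2]
    simp_rw [enorm_smul, mul_pow]
  simp_rw [hin]
  have hm : AEMeasurable (fun k => ‖μ k‖ₑ ^ 2) volume := h1.1.enorm.pow_const 2
  have hm2 : ∀ v, AEMeasurable (fun k => ‖lineSymbol w (h * ⟪k, v⟫)‖ₑ ^ 2 * ‖μ k‖ₑ ^ 2)
      volume := fun v => AEMeasurable.mul
      (((show Continuous fun k : V => lineSymbol w (h * ⟪k, v⟫) by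
        fun_prop).measurable.enorm).pow_const 2).aemeasurable hm
  have hcm : ∀ k, Measurable fun v : V => ‖lineSymbol w (h * ⟪k, v⟫)‖ₑ ^ 2 := fun k =>
    ((show Continuous fun v : V => lineSymbol w (h * ⟪k, v⟫) by
      fun_prop).measurable.enorm).pow_const 2
  calc ∫⁻ v, ENNReal.ofReal (gaussWeight v₀ v) *
        ∫⁻ k, ‖lineSymbol w (h * ⟪k, v⟫)‖ₑ ^ 2 * ‖μ k‖ₑ ^ 2
      = ∫⁻ v, ∫⁻ k, ENNReal.ofReal (gaussWeight v₀ v) *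
          (‖lineSymbol w (h * ⟪k, v⟫)‖ₑ ^ 2 * ‖μ k‖ₑ ^ 2) := by
        refine lintegral_congr fun v => ?_
        rw [lintegral_const_mul'' _ (hm2 v)]
    _ = ∫⁻ k, ∫⁻ v, ENNReal.ofReal (gaussWeight v₀ v) *
          (‖lineSymbol w (h * ⟪k, v⟫)‖ₑ ^ 2 * ‖μ k‖ₑ ^ 2) := by
        refine lintegral_lintegral_swap ?_
        refine AEMeasurable.mul
          (hg.measurable.ennreal_ofReal.comp measurable_fst).aemeasurable ?_
        refine AEMeasurable.mul (((show Continuous fun p : V × V =>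
          lineSymbol w (h * ⟪p.2, p.1⟫) by
            fun_prop).measurable.enorm).pow_const 2).aemeasurable ?_
        exact hm.comp_quasiMeasurePreserving Measure.quasiMeasurePreserving_snd
    _ ≤ ∫⁻ k, ENNReal.ofReal B * ‖μ k‖ₑ ^ 2 := by
        refine lintegral_mono fun k => ?_
        by_cases hk : μ k = 0
        · simp [hk]
        simp_rw [← mul_assoc]
        have hgm : Measurable fun v => ENNReal.ofReal (gaussWeight v₀ v) *
            ‖lineSymbol w (h * ⟪k, v⟫)‖ₑ ^ 2 := hg.measurable.ennreal_ofReal.mul (hcm k)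
        rw [lintegral_mul_const _ hgm]
        gcongr
        exact lintegral_gaussWeight_lineSymbol_le hw v₀ k (hB k hk)
    _ = _ := lintegral_const_mul'' _ hm

end LineAvg

/-! ### Band-limited functions -/

section BandLimited

open scoped RealInnerProductSpace SchwartzMap ContDiff

theorem lintegral_mul_sq_le {α : Type*} [MeasurableSpace α] {m : Measure α} {f g : α → ℝ≥0∞}
    (hf : AEMeasurable f m) (hg : AEMeasurable g m) :
    (∫⁻ a, f a * g a ∂m) ^ 2 ≤ (∫⁻ a, f a ^ 2 ∂m) * ∫⁻ a, g a ^ 2 ∂m := by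
  have h := ENNReal.lintegral_mul_le_Lp_mul_Lq m Real.HolderConjugate.two_two hf hg
  have h2 := pow_le_pow_left' h 2
  rw [mul_pow, ← ENNReal.rpow_natCast, ← ENNReal.rpow_natCast, ← ENNReal.rpow_natCast,
    ← ENNReal.rpow_mul, ← ENNReal.rpow_mul] at h2
  simpa using h2

theorem lintegral_weight_mul_sq_le {α : Type*} [MeasurableSpace α] {m : Measure α}
    {ρ g : α → ℝ≥0∞} (hρ : Measurable ρ) (hg : AEMeasurable g m) :
    (∫⁻ a, ρ a * g a ∂m) ^ 2 ≤ (∫⁻ a, ρ a ∂m) * ∫⁻ a, ρ a * g a ^ 2 ∂m := by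
  have hr : Measurable fun a => ρ a ^ (1 / 2 : ℝ) := hρ.pow_const _
  have e : ∀ a, (ρ a ^ (1 / 2 : ℝ)) ^ 2 = ρ a := fun a => by
    rw [← ENNReal.rpow_natCast, ← ENNReal.rpow_mul]; norm_num
  have h := lintegral_mul_sq_le (m := m) hr.aemeasurable (hr.aemeasurable.mul hg)
  simp only [Pi.mul_apply, mul_pow, e, ← mul_assoc, ← sq] at h
  exact h

variable {V E : Type*} [NormedAddCommGroup V] [InnerProductSpace ℝ V] [FiniteDimensional ℝ V]
  [MeasurableSpace V] [BorelSpace V]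
  [NormedAddCommGroup E] [InnerProductSpace ℂ E]

variable (V) in
/-- The exponent of the polynomial weight: the smallest integer that makes it integrable. -/
noncomputable def decayExp : ℕ := Module.finrank ℝ V + 1

variable (V) in
/-- A Schwartz function whose Fourier transform is `1` on the unit ball. -/
theorem exists_schwartz_fourier_eq_one :
    ∃ Φ : 𝓢(V, ℂ), ∀ k : V, ‖k‖ ≤ 1 → 𝓕 (Φ : V → ℂ) k = 1 := by
  let b : ContDiffBump (0 : V) := ⟨1, 2, one_pos, one_lt_two⟩
  have hg₁ : HasCompactSupport (Complex.ofRealCLM ∘ b) := b.hasCompactSupport.comp_left rfl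
  have hg₂ : ContDiff ℝ ∞ (Complex.ofRealCLM ∘ b) := Complex.ofRealCLM.contDiff.comp b.contDiff
  refine ⟨𝓕⁻ (hg₁.toSchwartzMap hg₂), fun k hk => ?_⟩
  rw [← SchwartzMap.fourier_coe, FourierTransform.fourier_fourierInv_eq]
  have : b k = 1 := b.one_of_mem_closedBall (by simpa [b] using hk)
  simp [this]

-- Peetre's inequality: a translation by y changes the polynomial weight by at most a power of 1 +
-- |y|.
omit [InnerProductSpace ℝ V] [FiniteDimensional ℝ V] [MeasurableSpace V] [BorelSpace V] in
theorem one_add_norm_le_mul (z y : V) : 1 + ‖z‖ ≤ (1 + ‖z + y‖) * (1 + ‖y‖) := by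
  have h : ‖z‖ ≤ ‖z + y‖ + ‖y‖ := by simpa using norm_sub_le (z + y) y
  nlinarith [norm_nonneg (z + y), norm_nonneg y, mul_nonneg (norm_nonneg (z + y)) (norm_nonneg y)]

-- Rapid decay of Φ and of its derivative, moved from z + y back to z by `one_add_norm_le_mul`; the
-- increment follows from the mean value inequality on the segment.
omit [FiniteDimensional ℝ V] [MeasurableSpace V] [BorelSpace V] in
theorem exists_schwartz_bounds (Φ : 𝓢(V, ℂ)) (q : ℕ) :
    ∃ K : ℝ, 0 < K ∧ (∀ z y : V, ‖Φ (z + y)‖ ≤ K * (1 + ‖y‖) ^ q * ((1 + ‖z‖) ^ q)⁻¹) ∧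
      ∀ z y : V, ‖Φ (z + y) - Φ z‖ ≤ K * ‖y‖ * (1 + ‖y‖) ^ q * ((1 + ‖z‖) ^ q)⁻¹ := by
  obtain ⟨K, hK, h0, h1⟩ : ∃ K : ℝ, 0 < K ∧ (∀ z : V, (1 + ‖z‖) ^ q * ‖Φ z‖ ≤ K) ∧
      ∀ z : V, (1 + ‖z‖) ^ q * ‖fderiv ℝ Φ z‖ ≤ K := by
    obtain ⟨K, hK⟩ : ∃ K : ℝ, ∀ n ≤ 1, ∀ z : V,
        (1 + ‖z‖) ^ q * ‖iteratedFDeriv ℝ n Φ z‖ ≤ K :=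
      ⟨_, fun n hn z => SchwartzMap.one_add_le_sup_seminorm_apply (𝕜 := ℝ) (m := (q, 1))
        le_rfl hn Φ z⟩
    refine ⟨max K 1, by positivity, fun z => ?_, fun z => ?_⟩
    · simpa using (hK 0 zero_le_one z).trans (le_max_left K 1)
    · have := (hK 1 le_rfl z).trans (le_max_left K 1)
      rwa [norm_iteratedFDeriv_one] at this
  have hw : ∀ z y : V, ((1 + ‖z + y‖) ^ q)⁻¹ ≤ (1 + ‖y‖) ^ q * ((1 + ‖z‖) ^ q)⁻¹ := by
    intro z y
    have hz : 0 < (1 + ‖z‖) ^ q := by positivity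
    have hzy : 0 < (1 + ‖z + y‖) ^ q := by positivity
    rw [← div_eq_mul_inv, inv_le_iff_one_le_mul₀ hzy, div_mul_eq_mul_div, le_div_iff₀ hz, one_mul,
      ← mul_pow, mul_comm]
    exact pow_le_pow_left₀ (by positivity) (one_add_norm_le_mul z y) q
  have hb : ∀ {z y : V} {A : ℝ}, (1 + ‖z + y‖) ^ q * A ≤ K →
      A ≤ K * (1 + ‖y‖) ^ q * ((1 + ‖z‖) ^ q)⁻¹ := by
    intro z y A hA
    have hzy : 0 < (1 + ‖z + y‖) ^ q := by positivity
    calc A ≤ K * ((1 + ‖z + y‖) ^ q)⁻¹ := by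
          rw [← div_eq_mul_inv, le_div_iff₀ hzy, mul_comm]; exact hA
      _ ≤ K * ((1 + ‖y‖) ^ q * ((1 + ‖z‖) ^ q)⁻¹) := by gcongr; exact hw z y
      _ = _ := by ring
  refine ⟨K, hK, fun z y => hb (h0 _), fun z y => ?_⟩
  have hmv := Convex.norm_image_sub_le_of_norm_fderiv_le (𝕜 := ℝ) (f := Φ)
    (s := segment ℝ z (z + y)) (x := z) (y := z + y)
    (C := K * (1 + ‖y‖) ^ q * ((1 + ‖z‖) ^ q)⁻¹) (fun x _ => Φ.differentiableAt)
    (fun x hx => by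
      rw [segment_eq_image'] at hx
      obtain ⟨t, ht, rfl⟩ := hx
      simp only [add_sub_cancel_left]
      refine (hb (h1 _)).trans ?_
      have : ‖t • y‖ ≤ ‖y‖ := by
        rw [norm_smul, Real.norm_eq_abs, abs_of_nonneg ht.1]
        exact mul_le_of_le_one_left (norm_nonneg _) ht.2
      gcongr)
    (convex_segment _ _) (left_mem_segment _ _ _) (right_mem_segment _ _ _)
  refine hmv.trans (le_of_eq ?_)
  rw [add_sub_cancel_left]
  ring

/-- The polynomial weight `(1 + |z|)^{-d-1}`. -/
noncomputable def decayWeight (z : V) : ℝ := ((1 + ‖z‖) ^ decayExp V)⁻¹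

omit [FiniteDimensional ℝ V] [MeasurableSpace V] [BorelSpace V] in
theorem continuous_decayWeight : Continuous (decayWeight (V := V)) := by
  unfold decayWeight
  refine Continuous.inv₀ (by fun_prop) fun z => ?_
  have : 0 < 1 + ‖z‖ := by positivity
  exact (pow_pos this _).ne'

omit [FiniteDimensional ℝ V] [MeasurableSpace V] [BorelSpace V] in
theorem decayWeight_nonneg (z : V) : 0 ≤ decayWeight z := by
  unfold decayWeight; positivity

theorem integrable_decayWeight : Integrable (decayWeight (V := V)) := by
  have h := integrable_one_add_norm (E := V) (μ := volume) (r := (decayExp V : ℝ))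
    (by simp [decayExp])
  refine h.congr (ae_of_all _ fun z => ?_)
  have : 0 ≤ 1 + ‖z‖ := by positivity
  simp only [decayWeight]
  rw [Real.rpow_neg this, Real.rpow_natCast]

/-- A weighted local average of `|u|` at length scale `1 / R`. -/
noncomputable def localAvg (R : ℝ) (u : V → E) (x : V) : ℝ :=
  ∫ z, decayWeight z * ‖u (x - R⁻¹ • z)‖

omit [InnerProductSpace ℂ E] in
theorem integrable_localAvg {u : V → E} (hu : Continuous u) {b : ℝ} (hb : ∀ x, ‖u x‖ ≤ b)
    (R : ℝ) (x : V) : Integrable fun z => decayWeight z * ‖u (x - R⁻¹ • z)‖ := by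
  have hd := continuous_decayWeight (V := V)
  refine (integrable_decayWeight.mul_const b).mono'
    (Continuous.aestronglyMeasurable (by fun_prop)) (ae_of_all _ fun z => ?_)
  rw [Real.norm_eq_abs, abs_of_nonneg (mul_nonneg (decayWeight_nonneg z) (norm_nonneg _))]
  exact mul_le_mul_of_nonneg_left (hb _) (decayWeight_nonneg z)

variable [CompleteSpace E]

/-- A reproducing formula: multiplying μ by 𝓕Φ(k/R), which is 1 on its support, changes nothing, and
in position space this is convolution with a rescaled Φ. -/
theorem fourierInv_eq_integral_schwartz {Φ : 𝓢(V, ℂ)}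
    (hΦ : ∀ k : V, ‖k‖ ≤ 1 → 𝓕 (Φ : V → ℂ) k = 1) {μ : V → E} (hμ : Integrable μ) {R : ℝ}
    (hR : 0 < R) (hs : ∀ k, μ k ≠ 0 → ‖k‖ ≤ R) (x : V) :
    𝓕⁻ μ x = ∫ z, Φ z • 𝓕⁻ μ (x - R⁻¹ • z) := by
  have h1 : ∀ z, Φ z • 𝓕⁻ μ (x - R⁻¹ • z)
      = ∫ k, (Φ z * (Real.fourierChar ⟪k, x - R⁻¹ • z⟫ : ℂ)) • μ k := by
    intro z
    rw [Real.fourierInv_eq, ← integral_smul]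
    exact integral_congr_ae (ae_of_all _ fun k => by simp only [Circle.smul_def, smul_smul])
  simp_rw [h1]
  rw [integral_integral_swap]
  · rw [Real.fourierInv_eq]
    refine integral_congr_ae (ae_of_all _ fun k => ?_)
    simp only
    rw [integral_smul_const]
    by_cases hk : μ k = 0
    · simp [hk]
    have e : ∀ z, Φ z * (Real.fourierChar ⟪k, x - R⁻¹ • z⟫ : ℂ)
        = (Real.fourierChar ⟪k, x⟫ : ℂ) * (Real.fourierChar (-⟪z, R⁻¹ • k⟫) • Φ z) := by
      intro z
      have : ⟪k, x - R⁻¹ • z⟫ = ⟪k, x⟫ + -⟪z, R⁻¹ • k⟫ := by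
        rw [inner_sub_right, inner_smul_right, inner_smul_right, real_inner_comm z k]; ring
      rw [this, AddChar.map_add_eq_mul, Circle.coe_mul, Circle.smul_def, smul_eq_mul]
      ring
    simp_rw [e]
    rw [integral_const_mul, ← Real.fourier_eq, hΦ, mul_one, Circle.smul_def]
    rw [norm_smul, norm_inv, Real.norm_eq_abs, abs_of_pos hR, inv_mul_le_one₀ hR]
    exact hs k hk
  · refine (Φ.integrable.norm.mul_prod hμ.norm).mono' ?_ (ae_of_all _ fun p => ?_)
    · have := Φ.continuous
      exact AEStronglyMeasurable.smul (Continuous.aestronglyMeasurable (by fun_prop))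
        hμ.1.comp_snd
    · simp only [Function.uncurry_def]
      rw [norm_smul, norm_mul, Circle.norm_coe, mul_one]

variable (V) in
/-- The local average of a band-limited function controls its values and increments. -/
theorem exists_bandLimited_bounds :
    ∃ K : ℝ, 0 < K ∧ ∀ (E : Type) [NormedAddCommGroup E] [InnerProductSpace ℂ E]
      [CompleteSpace E] (μ : V → E), Integrable μ → ∀ R : ℝ, 0 < R →
      (∀ k, μ k ≠ 0 → ‖k‖ ≤ R) → ∀ x x' : V,
        ‖𝓕⁻ μ x'‖ ≤ K * (1 + R * ‖x' - x‖) ^ decayExp V * localAvg R (𝓕⁻ μ) x ∧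
        ‖𝓕⁻ μ x' - 𝓕⁻ μ x‖ ≤ K * (R * ‖x' - x‖) * (1 + R * ‖x' - x‖) ^ decayExp V *
          localAvg R (𝓕⁻ μ) x := by
  obtain ⟨Φ, hΦ⟩ := exists_schwartz_fourier_eq_one V
  obtain ⟨K, hK, h0, h1⟩ := exists_schwartz_bounds Φ (decayExp V)
  refine ⟨K, hK, fun E _ _ _ μ hμ R hR hs x x' => ?_⟩
  set u := 𝓕⁻ μ with hu
  have huc : Continuous u := continuous_fourierInv hμ
  have hub : ∀ x, ‖u x‖ ≤ ∫ k, ‖μ k‖ := norm_fourierInv_le μ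
  set y := R • (x' - x) with hy
  have hyn : ‖y‖ = R * ‖x' - x‖ := by rw [hy, norm_smul, Real.norm_eq_abs, abs_of_pos hR]
  have hrep : ∀ x, u x = ∫ z, Φ z • u (x - R⁻¹ • z) :=
    fourierInv_eq_integral_schwartz hΦ hμ hR hs
  -- After a shift by y = R(x' - x), the formulas for x and x' contain the same values of u, and
  -- only the kernels Φ(z + y) and Φ(z) differ.
  have hrep' : u x' = ∫ z, Φ (z + y) • u (x - R⁻¹ • z) := by
    rw [hrep x', ← integral_add_right_eq_self _ y]
    refine integral_congr_ae (ae_of_all _ fun z => ?_)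
    have : x' - R⁻¹ • (z + y) = x - R⁻¹ • z := by
      rw [hy, smul_add, smul_smul, inv_mul_cancel₀ hR.ne', one_smul]; abel
    simp only [this]
  have hint : ∀ (ψ : V → ℂ), Integrable ψ → Continuous ψ →
      Integrable fun z => ψ z • u (x - R⁻¹ • z) := by
    intro ψ hψ hψc
    refine (hψ.norm.mul_const (∫ k, ‖μ k‖)).mono' (Continuous.aestronglyMeasurable (by fun_prop))
      (ae_of_all _ fun z => ?_)
    rw [norm_smul]
    exact mul_le_mul_of_nonneg_left (hub _) (norm_nonneg _)
  have hloc := integrable_localAvg huc hub R x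
  have hΦc := Φ.continuous
  constructor
  · rw [hrep', ← hyn, localAvg, ← integral_const_mul]
    refine norm_integral_le_of_norm_le (hloc.const_mul _) (ae_of_all _ fun z => ?_)
    rw [norm_smul, ← mul_assoc]
    exact mul_le_mul_of_nonneg_right (h0 z y) (norm_nonneg _)
  · rw [hrep', hrep x, ← integral_sub (hint _ (Φ.integrable.comp_add_right y) (by fun_prop))
      (hint _ Φ.integrable hΦc), ← hyn, localAvg, ← integral_const_mul]
    refine norm_integral_le_of_norm_le (hloc.const_mul _) (ae_of_all _ fun z => ?_)
    rw [← sub_smul, norm_smul, ← mul_assoc]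
    exact mul_le_mul_of_nonneg_right (h1 z y) (norm_nonneg _)

-- Cauchy–Schwarz against the finite measure `decayWeight`, then Tonelli and translation invariance;
-- the constant therefore does not depend on R.
omit [CompleteSpace E] [InnerProductSpace ℂ E] in
theorem lintegral_localAvg_sq_le {u : V → E} (hu : Continuous u) {b : ℝ} (hb : ∀ x, ‖u x‖ ≤ b)
    (R : ℝ) :
    ∫⁻ x, ENNReal.ofReal (localAvg R u x) ^ 2
      ≤ ENNReal.ofReal ((∫ z : V, decayWeight z) ^ 2) * ∫⁻ x, ‖u x‖ₑ ^ 2 := by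
  have hd := continuous_decayWeight (V := V)
  have hdm : Measurable fun z : V => ENNReal.ofReal (decayWeight z) :=
    hd.measurable.ennreal_ofReal
  have hc : ∫⁻ z : V, ENNReal.ofReal (decayWeight z) = ENNReal.ofReal (∫ z : V, decayWeight z) :=
    (ofReal_integral_eq_lintegral_ofReal integrable_decayWeight
      (ae_of_all _ decayWeight_nonneg)).symm
  have h1 : ∀ x, ENNReal.ofReal (localAvg R u x) ^ 2 ≤ ENNReal.ofReal (∫ z : V, decayWeight z) *
      ∫⁻ z, ENNReal.ofReal (decayWeight z) * ‖u (x - R⁻¹ • z)‖ₑ ^ 2 := by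
    intro x
    rw [localAvg, ofReal_integral_eq_lintegral_ofReal (integrable_localAvg hu hb R x)
      (ae_of_all _ fun z => mul_nonneg (decayWeight_nonneg z) (norm_nonneg _)), ← hc]
    simp_rw [ENNReal.ofReal_mul (decayWeight_nonneg _), ofReal_norm]
    exact lintegral_weight_mul_sq_le hdm
      (show Continuous fun z : V => u (x - R⁻¹ • z) by fun_prop).enorm.measurable.aemeasurable
  have hm : Measurable fun p : V × V => ENNReal.ofReal (decayWeight p.2) *
      ‖u (p.1 - R⁻¹ • p.2)‖ₑ ^ 2 :=
    (hdm.comp measurable_snd).mul ((show Continuous fun p : V × V => u (p.1 - R⁻¹ • p.2) by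
      fun_prop).enorm.measurable.pow_const 2)
  calc ∫⁻ x, ENNReal.ofReal (localAvg R u x) ^ 2
      ≤ ∫⁻ x, ENNReal.ofReal (∫ z : V, decayWeight z) *
          ∫⁻ z, ENNReal.ofReal (decayWeight z) * ‖u (x - R⁻¹ • z)‖ₑ ^ 2 := lintegral_mono h1
    _ = ENNReal.ofReal (∫ z : V, decayWeight z) *
          ∫⁻ x, ∫⁻ z, ENNReal.ofReal (decayWeight z) * ‖u (x - R⁻¹ • z)‖ₑ ^ 2 :=
        lintegral_const_mul _ hm.lintegral_prod_right'
    _ = ENNReal.ofReal (∫ z : V, decayWeight z) *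
          ∫⁻ z, ∫⁻ x, ENNReal.ofReal (decayWeight z) * ‖u (x - R⁻¹ • z)‖ₑ ^ 2 := by
        rw [lintegral_lintegral_swap hm.aemeasurable]
    _ = ENNReal.ofReal (∫ z : V, decayWeight z) *
          ∫⁻ z, ENNReal.ofReal (decayWeight z) * ∫⁻ x, ‖u x‖ₑ ^ 2 := by
        congr 1
        refine lintegral_congr fun z => ?_
        rw [lintegral_const_mul _ ((show Continuous fun x : V => u (x - R⁻¹ • z) by
          fun_prop).enorm.measurable.pow_const 2),
          lintegral_sub_right_eq_self (fun x => ‖u x‖ₑ ^ 2)]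
    _ = _ := by
        rw [lintegral_mul_const _ hdm, hc, sq, ENNReal.ofReal_mul
          (integral_nonneg decayWeight_nonneg), mul_assoc]

end BandLimited

theorem eLpNorm_two_le {α β : Type*} [MeasurableSpace α] [MeasurableSpace β] {m : Measure α}
    {n : Measure β} {F G : Type*} [NormedAddCommGroup F] [NormedAddCommGroup G] {f : α → F}
    {g : β → G} {c : ℝ≥0∞} (h : ∫⁻ a, ‖f a‖ₑ ^ 2 ∂m ≤ c ^ 2 * ∫⁻ b, ‖g b‖ₑ ^ 2 ∂n) :
    eLpNorm f 2 m ≤ c * eLpNorm g 2 n := by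
  simp only [eLpNorm_eq_lintegral_rpow_enorm_toReal two_ne_zero ENNReal.ofNat_ne_top,
    ENNReal.toReal_ofNat, ENNReal.rpow_ofNat]
  refine (ENNReal.rpow_le_rpow h (by norm_num : (0 : ℝ) ≤ 1 / 2)).trans (le_of_eq ?_)
  rw [ENNReal.mul_rpow_of_nonneg _ _ (by norm_num), ← ENNReal.rpow_natCast, ← ENNReal.rpow_mul]
  norm_num

/-! ### Pointwise majorants of line averages and their L² size -/

section LineMajorant

open scoped RealInnerProductSpace

variable {V E : Type*} [NormedAddCommGroup V] [InnerProductSpace ℝ V] [FiniteDimensional ℝ V]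
  [MeasurableSpace V] [BorelSpace V]
  [NormedAddCommGroup E] [InnerProductSpace ℂ E]

/-- The local average, in the position variable, of a line average of `𝓕⁻ μ`. -/
noncomputable def lineMajorant (R h : ℝ) (w : ℝ → ℝ) (μ : V → E) (p : V × V) : ℝ :=
  localAvg R (fun x => lineAvg w h (𝓕⁻ μ) x p.2) p.1

theorem lineMajorant_nonneg (R h : ℝ) (w : ℝ → ℝ) (μ : V → E) (p : V × V) :
    0 ≤ lineMajorant R h w μ p :=
  integral_nonneg fun z => mul_nonneg (decayWeight_nonneg z) (norm_nonneg _)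

theorem continuous_lineMajorant (R h : ℝ) {w : ℝ → ℝ} (hw : IsUnitWeight w)
    {μ : V → E} (h1 : Integrable μ) : Continuous (lineMajorant R h w μ) := by
  have hb := norm_fourierInv_le μ
  have hc := continuous_lineAvg hw h (continuous_fourierInv h1) hb
  have hd := continuous_decayWeight (V := V)
  have hc2 : Continuous fun q : (V × V) × V =>
      decayWeight q.2 * ‖lineAvg w h (𝓕⁻ μ) (q.1.1 - R⁻¹ • q.2) q.1.2‖ := by
    have : Continuous fun q : (V × V) × V => (q.1.1 - R⁻¹ • q.2, q.1.2) := by fun_prop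
    have := hc.comp this
    fun_prop
  refine continuous_of_dominated (bound := fun z : V => decayWeight z * ∫ k, ‖μ k‖)
    (fun p => ?_) (fun p => ae_of_all _ fun z => ?_) (integrable_decayWeight.mul_const _)
    (ae_of_all _ fun z => ?_)
  · exact (hc2.comp (by fun_prop : Continuous fun z : V => (p, z))).aestronglyMeasurable
  · rw [Real.norm_eq_abs, abs_of_nonneg (mul_nonneg (decayWeight_nonneg z) (norm_nonneg _))]
    exact mul_le_mul_of_nonneg_left (norm_lineAvg_le hw h hb _ _) (decayWeight_nonneg z)
  · exact hc2.comp (by fun_prop : Continuous fun p : V × V => (p, z))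

-- At fixed v the line average has the symbol `lineSymbol · μ`, still supported in the ball of
-- radius R, so the band-limited estimates apply in x. This is why both points share the velocity v.
variable (V) in
theorem exists_lineMajorant_bounds :
    ∃ K : ℝ, 0 < K ∧ ∀ (E : Type) [NormedAddCommGroup E] [InnerProductSpace ℂ E]
      [CompleteSpace E] (w : ℝ → ℝ), IsUnitWeight w → ∀ (h : ℝ) (μ : V → E),
      Integrable μ → ∀ R : ℝ, 0 < R → (∀ k, μ k ≠ 0 → ‖k‖ ≤ R) → ∀ x x' v : V,
        ‖lineAvg w h (𝓕⁻ μ) x' v‖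
          ≤ K * (1 + R * ‖x' - x‖) ^ decayExp (V) * lineMajorant R h w μ (x, v) ∧
        ‖lineAvg w h (𝓕⁻ μ) x' v - lineAvg w h (𝓕⁻ μ) x v‖
          ≤ K * (R * ‖x' - x‖) * (1 + R * ‖x' - x‖) ^ decayExp (V) *
            lineMajorant R h w μ (x, v) := by
  obtain ⟨K, hK, H⟩ := exists_bandLimited_bounds (V)
  refine ⟨K, hK, fun E _ _ _ w hw h μ h1 R hR hs x x' v => ?_⟩
  have e : (fun x => lineAvg w h (𝓕⁻ μ) x v)
      = 𝓕⁻ (fun k => lineSymbol w (h * ⟪k, v⟫) • μ k) :=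
    funext fun x => lineAvg_fourierInv hw h h1 x v
  have := H E _ (integrable_lineSymbol_smul hw h h1 v) R hR
    (fun k hk => hs k fun h0 => hk (by simp [h0])) x x'
  simp only [lineMajorant, lineAvg_fourierInv hw h h1]
  exact this

variable (V) in
/-- The constant relating the restriction to a set of bounded velocities and the Gaussian
weight. -/
noncomputable def majorantConst (D : ℝ) : ℝ :=
  Real.exp (Real.pi * D ^ 2 / 2) * ∫ z : V, decayWeight z

theorem majorantConst_nonneg (D : ℝ) : 0 ≤ majorantConst V D :=
  mul_nonneg (Real.exp_pos _).le (integral_nonneg decayWeight_nonneg)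

/-- Passing from a set of bounded velocities to a Gaussian weight. -/
theorem setLIntegral_sq_le_of_section {U : V × V → ℝ} (hU : Continuous U) {S : Set (V × V)}
    (hS : MeasurableSet S) {D : ℝ} (v₀ : V) (hD : ∀ p ∈ S, ‖p.2 - v₀‖ ≤ D) {a b : ℝ≥0∞}
    (ha : a ≠ ∞) {L : V → ℝ≥0∞} (hL : ∀ v, ∫⁻ x, ‖U (x, v)‖ₑ ^ 2 ≤ a * L v)
    (hb : ∫⁻ v, ENNReal.ofReal (gaussWeight v₀ v) * L v ≤ b) :
    ∫⁻ p in S, ‖U p‖ₑ ^ 2 ≤ ENNReal.ofReal (Real.exp (Real.pi * D ^ 2)) * (a * b) := by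
  have hm : Measurable fun p : V × V => ENNReal.ofReal (gaussWeight v₀ p.2) * ‖U p‖ₑ ^ 2 :=
    ((continuous_gaussWeight v₀).measurable.ennreal_ofReal.comp measurable_snd).mul
      (hU.measurable.enorm.pow_const 2)
  calc ∫⁻ p in S, ‖U p‖ₑ ^ 2
      ≤ ∫⁻ p in S, ENNReal.ofReal (Real.exp (Real.pi * D ^ 2)) *
          (ENNReal.ofReal (gaussWeight v₀ p.2) * ‖U p‖ₑ ^ 2) := by
        refine setLIntegral_mono' hS fun p hp => ?_
        rw [← mul_assoc, ← ENNReal.ofReal_mul (Real.exp_pos _).le]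
        -- On `S` the velocity is within `D` of `v₀`, so the Gaussian is at least exp(-πD²).
        have h1 : 1 ≤ ENNReal.ofReal (Real.exp (Real.pi * D ^ 2) * gaussWeight v₀ p.2) := ?_
        · exact (one_mul (‖U p‖ₑ ^ 2)).symm.le.trans (mul_le_mul' h1 le_rfl)
        rw [ENNReal.one_le_ofReal, gaussWeight, ← Real.exp_add, Real.one_le_exp_iff]
        have := pow_le_pow_left₀ (norm_nonneg _) (hD p hp) 2
        nlinarith [Real.pi_pos]
    _ ≤ ENNReal.ofReal (Real.exp (Real.pi * D ^ 2)) * ∫⁻ p : V × V,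
          (ENNReal.ofReal (gaussWeight v₀ p.2) * ‖U p‖ₑ ^ 2) := by
        rw [lintegral_const_mul _ hm]
        gcongr
        exact Measure.restrict_le_self
    _ = ENNReal.ofReal (Real.exp (Real.pi * D ^ 2)) * ∫⁻ v, ENNReal.ofReal (gaussWeight v₀ v) *
          ∫⁻ x, ‖U (x, v)‖ₑ ^ 2 := by
        rw [Measure.volume_eq_prod, lintegral_prod_symm' _ hm]
        congr 1
        refine lintegral_congr fun v => ?_
        exact lintegral_const_mul (ENNReal.ofReal (gaussWeight v₀ v))
          (f := fun x => ‖U (x, v)‖ₑ ^ 2)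
          ((hU.comp (by fun_prop : Continuous fun x : V => (x, v))).measurable.enorm.pow_const 2)
    _ ≤ ENNReal.ofReal (Real.exp (Real.pi * D ^ 2)) * ∫⁻ v, a *
          (ENNReal.ofReal (gaussWeight v₀ v) * L v) := by
        refine mul_le_mul' le_rfl (lintegral_mono fun v => ?_)
        show _ ≤ a * (ENNReal.ofReal (gaussWeight v₀ v) * L v)
        rw [mul_left_comm]
        exact mul_le_mul' le_rfl (hL v)
    _ ≤ _ := by
        rw [lintegral_const_mul' _ _ ha]
        exact mul_le_mul' le_rfl (mul_le_mul' le_rfl hb)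

/-- Local averaging is bounded on L² in x, and the velocity average gains the factor `B` on squares,
hence √B on norms. -/
theorem eLpNorm_lineMajorant_le [CompleteSpace E] (R h : ℝ) {w : ℝ → ℝ} (hw : IsUnitWeight w)
    {μ : V → E} (h1 : Integrable μ) (h2 : MemLp μ 2) {B : ℝ} (hB0 : 0 ≤ B)
    (hB : ∀ k, μ k ≠ 0 → 1 ≤ B ∨ 1 ≤ B * |h * ‖k‖|) {S : Set (V × V)} (hS : MeasurableSet S)
    {D : ℝ} (v₀ : V) (hD : ∀ p ∈ S, ‖p.2 - v₀‖ ≤ D) :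
    eLpNorm (lineMajorant R h w μ) 2 (volume.restrict S)
      ≤ ENNReal.ofReal (majorantConst V D * √B) * eLpNorm μ 2 volume := by
  have hUc := continuous_lineMajorant R h hw h1
  have hx : ∀ v, ∫⁻ x, ‖lineMajorant R h w μ (x, v)‖ₑ ^ 2
      ≤ ENNReal.ofReal ((∫ z : V, decayWeight z) ^ 2) *
        ∫⁻ x, ‖lineAvg w h (𝓕⁻ μ) x v‖ₑ ^ 2 := fun v => by
    have hc : Continuous fun x => lineAvg w h (𝓕⁻ μ) x v := by
      have hp : Continuous fun x : V => (x, v) := by fun_prop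
      have := (continuous_lineAvg hw h (continuous_fourierInv h1) (norm_fourierInv_le μ)).comp hp
      simpa only [Function.comp_def] using this
    have hb : ∀ x, ‖lineAvg w h (𝓕⁻ μ) x v‖ ≤ ∫ k, ‖μ k‖ := fun x =>
      norm_lineAvg_le hw h (norm_fourierInv_le μ) x v
    simp only [fun x => Real.enorm_eq_ofReal (lineMajorant_nonneg R h w μ (x, v))]
    exact lintegral_localAvg_sq_le hc hb R
  have key := setLIntegral_sq_le_of_section hUc hS v₀ hD ENNReal.ofReal_ne_top hx
    (lintegral_lineAvg_le hw h h1 h2 hB v₀)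
  refine eLpNorm_two_le (f := lineMajorant R h w μ) (g := μ)
    (c := ENNReal.ofReal (majorantConst V D * √B)) (key.trans (le_of_eq ?_))
  have e : (majorantConst V D * √B) ^ 2
      = Real.exp (Real.pi * D ^ 2) * ((∫ z : V, decayWeight z) ^ 2 * B) := by
    rw [mul_pow, Real.sq_sqrt hB0, majorantConst, mul_pow, ← Real.exp_nat_mul, mul_assoc]
    congr 2
    push_cast
    ring
  rw [← ENNReal.ofReal_pow (mul_nonneg (majorantConst_nonneg D) (Real.sqrt_nonneg _)), e,
    ENNReal.ofReal_mul (by positivity), ENNReal.ofReal_mul (by positivity), mul_assoc,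
    mul_assoc]

end LineMajorant

/-! ### The corrector of a frequency block -/

section Corrector

open scoped RealInnerProductSpace

/-- The complexification of `Pos d`. -/
abbrev CPos (d : ℕ) : Type := EuclideanSpace ℂ (Fin d)

variable {d : ℕ}

/-- The Fourier side of a partial derivative. -/
noncomputable def partialSymbol (i : Fin d) (μ : Pos d → CPos d) (k : Pos d) : CPos d :=
  (2 * Real.pi * Complex.I * (k i : ℂ)) • μ k

theorem norm_partialSymbol_le {R : ℝ} {μ : Pos d → CPos d} (hs : ∀ k, μ k ≠ 0 → ‖k‖ ≤ R)
    (i : Fin d) (k : Pos d) : ‖partialSymbol i μ k‖ ≤ 2 * Real.pi * R * ‖μ k‖ := by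
  by_cases hk : μ k = 0
  · simp [partialSymbol, hk]
  rw [partialSymbol, norm_smul]
  gcongr
  have : ‖(2 * Real.pi * Complex.I * (k i : ℂ))‖ = 2 * Real.pi * ‖k i‖ := by
    simp [abs_of_pos Real.pi_pos]
  rw [this]
  have := (PiLp.norm_apply_le k i).trans (hs k hk)
  gcongr

theorem aestronglyMeasurable_partialSymbol {μ : Pos d → CPos d}
    (h : AEStronglyMeasurable μ volume) (i : Fin d) :
    AEStronglyMeasurable (partialSymbol i μ) volume :=
  (show Continuous fun k : Pos d => (2 * Real.pi * Complex.I * (k i : ℂ)) by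
    fun_prop).aestronglyMeasurable.smul h

theorem integrable_partialSymbol {R : ℝ} {μ : Pos d → CPos d} (h1 : Integrable μ)
    (hs : ∀ k, μ k ≠ 0 → ‖k‖ ≤ R) (i : Fin d) : Integrable (partialSymbol i μ) :=
  (h1.norm.const_mul (2 * Real.pi * R)).mono' (aestronglyMeasurable_partialSymbol h1.1 i)
    (ae_of_all _ fun k => norm_partialSymbol_le hs i k)

theorem memLp_partialSymbol {R : ℝ} {μ : Pos d → CPos d} (h2 : MemLp μ 2)
    (hs : ∀ k, μ k ≠ 0 → ‖k‖ ≤ R) (i : Fin d) : MemLp (partialSymbol i μ) 2 :=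
  h2.of_le_mul (aestronglyMeasurable_partialSymbol h2.1 i)
    (ae_of_all _ fun k => norm_partialSymbol_le hs i k)

theorem partialSymbol_ne_zero {i : Fin d} {μ : Pos d → CPos d} {k : Pos d}
    (h : partialSymbol i μ k ≠ 0) : μ k ≠ 0 := fun h0 => h (by simp [partialSymbol, h0])

/-- The derivative of `𝓕⁻ μ`. -/
noncomputable def fourierInvDeriv (μ : Pos d → CPos d) (x : Pos d) : Pos d →L[ℝ] CPos d :=
  ∑ i, (EuclideanSpace.proj i : Pos d →L[ℝ] ℝ).smulRight (𝓕⁻ (partialSymbol i μ) x)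

theorem fourierInvDeriv_apply (μ : Pos d → CPos d) (x y : Pos d) :
    fourierInvDeriv μ x y = ∑ i, y i • 𝓕⁻ (partialSymbol i μ) x := by
  simp [fourierInvDeriv]

/-- The derivative is expanded in coordinates so that each partial derivative is again the inverse
transform of a symbol supported in the ball of radius R, to which the same majorants apply. -/
theorem hasFDerivAt_fourierInv {R : ℝ} {μ : Pos d → CPos d} (h1 : Integrable μ)
    (hs : ∀ k, μ k ≠ 0 → ‖k‖ ≤ R) (x : Pos d) :
    HasFDerivAt (𝓕⁻ μ) (fourierInvDeriv μ x) x := by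
  have h1' : Integrable fun k => ‖k‖ * ‖μ k‖ := by
    refine (h1.norm.const_mul R).mono' ((by fun_prop : Continuous fun k : Pos d =>
      ‖k‖).aestronglyMeasurable.mul h1.1.norm) (ae_of_all _ fun k => ?_)
    rw [norm_mul, norm_norm, norm_norm]
    by_cases hk : μ k = 0
    · simp [hk]
    · gcongr; exact hs k hk
  set L : Pos d →L[ℝ] Pos d →L[ℝ] ℝ := -innerSL ℝ with hL
  have key := VectorFourier.hasFDerivAt_fourierIntegral L h1 h1' x
  refine key.congr_fderiv ?_
  ext1 y
  have hint : Integrable (VectorFourier.fourierSMulRight L μ) := by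
    refine (h1'.const_mul (2 * Real.pi * ‖L‖)).mono' h1.1.fourierSMulRight
      (ae_of_all _ fun k => ?_)
    rw [← mul_assoc]
    exact VectorFourier.norm_fourierSMulRight_le L μ k
  rw [VectorFourier.fourierIntegral_continuousLinearMap_apply Real.continuous_fourierChar hint,
    fourierInvDeriv_apply]
  have e : ∀ i, y i • 𝓕⁻ (partialSymbol i μ) x
      = ∫ k, y i • Real.fourierChar ⟪k, x⟫ • partialSymbol i μ k := by
    intro i
    rw [Real.fourierInv_eq, integral_smul]
  have hc : ∀ i, Integrable fun k => y i • Real.fourierChar ⟪k, x⟫ • partialSymbol i μ k := by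
    intro i
    have hi := integrable_partialSymbol h1 hs i
    refine Integrable.smul (y i) (hi.norm.mono' ?_ (ae_of_all _ fun k => ?_))
    · simp only [Circle.smul_def]
      exact (show Continuous fun k : Pos d => (Real.fourierChar ⟪k, x⟫ : ℂ) by
        fun_prop).aestronglyMeasurable.smul hi.1
    · rw [Circle.norm_smul]
  simp_rw [e]
  rw [← integral_finsetSum _ fun i _ => hc i, VectorFourier.fourierIntegral]
  refine integral_congr_ae (ae_of_all _ fun k => ?_)
  have hin : ⟪k, y⟫ = ∑ i, y i * k i := by
    simp [PiLp.inner_apply]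
  change Real.fourierChar (-(-⟪k, x⟫)) • (-(2 * Real.pi * Complex.I) • (-⟪k, y⟫) • μ k)
    = ∑ i, y i • Real.fourierChar ⟪k, x⟫ • partialSymbol i μ k
  simp only [neg_neg, hin, Circle.smul_def, partialSymbol, smul_smul, ← Complex.coe_smul,
    ← Finset.sum_smul]
  congr 1
  push_cast
  rw [mul_neg, neg_mul, neg_neg, Finset.mul_sum, Finset.mul_sum]
  refine Finset.sum_congr rfl fun i _ => ?_
  ring

end Corrector

section Corrector

open scoped RealInnerProductSpace

variable {d : ℕ}

theorem lineAvg_fourierInvDeriv_apply {w : ℝ → ℝ} (hw : IsUnitWeight w) (h : ℝ) {R : ℝ}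
    {μ : Pos d → CPos d} (h1 : Integrable μ) (hs : ∀ k, μ k ≠ 0 → ‖k‖ ≤ R) (x v y : Pos d) :
    lineAvg w h (fourierInvDeriv μ) x v y
      = ∑ i, y i • lineAvg w h (𝓕⁻ (partialSymbol i μ)) x v := by
  have hc := hw.continuous
  have hg : ∀ i, Continuous (𝓕⁻ (partialSymbol i μ)) := fun i =>
    continuous_fourierInv (integrable_partialSymbol h1 hs i)
  have hI : ∀ {F : Type} [NormedAddCommGroup F] (u : ℝ → F), Continuous u →
      Integrable u unitMeasure := fun u hu => hu.integrableOn_Icc.mono_set Ioc_subset_Icc_self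
  have hgd : Continuous (fourierInvDeriv μ) := by unfold fourierInvDeriv; fun_prop
  simp only [lineAvg]
  rw [ContinuousLinearMap.integral_apply (hI _ (by fun_prop))]
  simp only [smul_apply, fourierInvDeriv_apply, Finset.smul_sum, ← integral_smul]
  rw [integral_finsetSum _ fun i _ => hI _ (by fun_prop)]
  refine Finset.sum_congr rfl fun i _ => integral_congr_ae (ae_of_all _ fun s => ?_)
  exact smul_comm _ _ _

theorem norm_sum_smul_le {F : Type*} [NormedAddCommGroup F] [NormedSpace ℝ F] (y : Pos d)
    (a : Fin d → F) : ‖∑ i, y i • a i‖ ≤ ‖y‖ * ∑ i, ‖a i‖ := by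
  rw [Finset.mul_sum]
  refine norm_sum_le_of_le _ fun i _ => ?_
  rw [norm_smul]
  exact mul_le_mul_of_nonneg_right (PiLp.norm_apply_le y i) (norm_nonneg _)

/-- `H` corrects the field `g` of length scale `1 / R` on trajectories, up to the remainder `r`:
along the free transport, `H` has derivative `g - r`.  All quantities are controlled by `B`. -/
structure IsCorrector (K R h : ℝ) (g : Pos d → CPos d) (H : Phase d → CPos d)
    (H' : Phase d → Phase d →L[ℝ] CPos d) (r : Phase d → CPos d) (B : Phase d → ℝ) : Prop where
  hasFDerivAt : ∀ p, HasFDerivAt H (H' p) p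
  continuous_deriv : Continuous H'
  transport : ∀ p, H' p (p.2, 0) = g p.1 - r p
  continuous_majorant : Continuous B
  majorant_nonneg : ∀ p, 0 ≤ B p
  value_le : ∀ x x' v, ‖H (x', v)‖ ≤ K * h * (1 + R * ‖x' - x‖) ^ decayExp (Pos d) * B (x, v)
  value_sub_le : ∀ x x' v, ‖H (x', v) - H (x, v)‖
    ≤ K * h * (R * ‖x' - x‖) * (1 + R * ‖x' - x‖) ^ decayExp (Pos d) * B (x, v)
  fst_le : ∀ x x' v y, ‖H' (x', v) (y, 0)‖
    ≤ K * (h * R) * ‖y‖ * (1 + R * ‖x' - x‖) ^ decayExp (Pos d) * B (x, v)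
  snd_le : ∀ x x' v b, ‖H' (x', v) (0, b)‖
    ≤ K * ‖b‖ * (1 + R * ‖x' - x‖) ^ decayExp (Pos d) * B (x, v)
  snd_sub_le : ∀ x x' v b, ‖H' (x', v) (0, b) - H' (x, v) (0, b)‖
    ≤ K * ‖b‖ * (R * ‖x' - x‖) * (1 + R * ‖x' - x‖) ^ decayExp (Pos d) * B (x, v)
  rem_le : ∀ x x' v, ‖r (x', v)‖ ≤ K * (1 + R * ‖x' - x‖) ^ decayExp (Pos d) * B (x, v)
  rem_sub_le : ∀ x x' v, ‖r (x', v) - r (x, v)‖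
    ≤ K * (R * ‖x' - x‖) * (1 + R * ‖x' - x‖) ^ decayExp (Pos d) * B (x, v)

theorem isUnitWeight_one : IsUnitWeight fun _ => 1 := ⟨by fun_prop, fun s _ => by simp⟩

theorem isUnitWeight_one_sub : IsUnitWeight fun s => 1 - s :=
  ⟨by fun_prop, fun s hs => abs_le.2 ⟨by linarith [hs.2], by linarith [hs.1]⟩⟩

theorem isUnitWeight_mul_one_sub : IsUnitWeight fun s => s * (1 - s) :=
  ⟨by fun_prop, fun s hs => by
    rw [abs_mul, abs_of_pos hs.1]
    exact mul_le_one₀ hs.2 (abs_nonneg _) (isUnitWeight_one_sub.abs_le s hs)⟩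

/-- The majorant of the corrector. -/
noncomputable def blockMajorant (R h : ℝ) (μ : Pos d → CPos d) (p : Phase d) : ℝ :=
  lineMajorant R h (fun _ => 1) μ p + lineMajorant R h (fun s => 1 - s) μ p +
    R⁻¹ * ∑ i, (lineMajorant R h (fun s => 1 - s) (partialSymbol i μ) p +
      lineMajorant R h (fun s => s * (1 - s)) (partialSymbol i μ) p)

theorem continuous_blockMajorant (R h : ℝ) {μ : Pos d → CPos d} (h1 : Integrable μ) {R' : ℝ}
    (hs : ∀ k, μ k ≠ 0 → ‖k‖ ≤ R') : Continuous (blockMajorant R h μ) := by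
  have c1 := continuous_lineMajorant R h isUnitWeight_one h1
  have c2 := continuous_lineMajorant R h isUnitWeight_one_sub h1
  have c3 := fun i => continuous_lineMajorant R h isUnitWeight_one_sub
    (integrable_partialSymbol h1 hs i)
  have c4 := fun i => continuous_lineMajorant R h isUnitWeight_mul_one_sub
    (integrable_partialSymbol h1 hs i)
  have c5 := continuous_finsetSum Finset.univ fun i _ => (c3 i).add (c4 i)
  exact (c1.add c2).add (continuous_const.mul c5)

-- H is -h times the average of g with weight 1 - s. By `lineAvg_one_sub_fderiv_apply` its
-- derivative along (v, 0) is g minus the plain average, which is the remainder r. A derivative in x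
-- costs R, and one in v costs hR; since R h² = 1, the velocity derivative of H has the size of r.
set_option maxHeartbeats 1000000 in
variable (d) in
theorem exists_isCorrector :
    ∃ K : ℝ, 0 < K ∧ ∀ (R h : ℝ) (μ : Pos d → CPos d), 0 < R → 0 < h → R * h ^ 2 = 1 →
      Integrable μ → (∀ k, μ k ≠ 0 → ‖k‖ ≤ R) →
      ∃ H H' r, IsCorrector K R h (𝓕⁻ μ) H H' r (blockMajorant R h μ) := by
  obtain ⟨K, hK, hU⟩ := exists_lineMajorant_bounds (Pos d)
  refine ⟨K, hK, fun R h μ hR hh hRh h1 hs => ?_⟩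
  have h1i := fun i => integrable_partialSymbol h1 hs i
  have hsi : ∀ i k, partialSymbol i μ k ≠ 0 → ‖k‖ ≤ R := fun i k hk =>
    hs k (partialSymbol_ne_zero hk)
  have hw1 := isUnitWeight_one
  have hw2 := isUnitWeight_one_sub
  have hw3 := isUnitWeight_mul_one_sub
  set g := 𝓕⁻ μ with hg
  have hgc : Continuous g := continuous_fourierInv h1
  have hgb : ∀ x, ‖g x‖ ≤ ∫ k, ‖μ k‖ := norm_fourierInv_le μ
  have hgic : ∀ i, Continuous (𝓕⁻ (partialSymbol i μ)) := fun i => continuous_fourierInv (h1i i)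
  have hg' : ∀ x, HasFDerivAt g (fourierInvDeriv μ x) x := hasFDerivAt_fourierInv h1 hs
  have hg'c : Continuous (fourierInvDeriv μ) := by unfold fourierInvDeriv; fun_prop
  have hg'b : ∀ x, ‖fourierInvDeriv μ x‖ ≤ ∑ i, ∫ k, ‖partialSymbol i μ k‖ := by
    intro x
    refine ContinuousLinearMap.opNorm_le_bound _
      (Finset.sum_nonneg fun i _ => integral_nonneg fun k => norm_nonneg _) fun y => ?_
    rw [fourierInvDeriv_apply, mul_comm]
    refine (norm_sum_smul_le _ _).trans ?_
    gcongr with i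
    exact norm_fourierInv_le _ _
  have hU0 := fun (w : ℝ → ℝ) (μ : Pos d → CPos d) (p : Phase d) => lineMajorant_nonneg R h w μ p
  have hsum0 : ∀ p : Phase d, 0 ≤ ∑ i, (lineMajorant R h (fun s => 1 - s) (partialSymbol i μ) p +
      lineMajorant R h (fun s => s * (1 - s)) (partialSymbol i μ) p) := fun p =>
    Finset.sum_nonneg fun i _ => add_nonneg (hU0 ..) (hU0 ..)
  have hB1 : ∀ p, lineMajorant R h (fun _ => 1) μ p ≤ blockMajorant R h μ p := fun p => by
    have := hU0 (fun s => 1 - s) μ p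
    have := mul_nonneg (inv_nonneg.2 hR.le) (hsum0 p)
    unfold blockMajorant; linarith
  have hB2 : ∀ p, lineMajorant R h (fun s => 1 - s) μ p ≤ blockMajorant R h μ p := fun p => by
    have := hU0 (fun s => 1) μ p
    have := mul_nonneg (inv_nonneg.2 hR.le) (hsum0 p)
    unfold blockMajorant; linarith
  -- The factor `R⁻¹` in `blockMajorant` puts the derivative terms on the same scale as the others;
  -- undoing it here costs one factor R.
  have hB34 : ∀ p, ∑ i, (lineMajorant R h (fun s => 1 - s) (partialSymbol i μ) p +
      lineMajorant R h (fun s => s * (1 - s)) (partialSymbol i μ) p)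
        ≤ R * blockMajorant R h μ p := fun p => by
    have h1 := hU0 (fun s => 1) μ p
    have h2 := hU0 (fun s => 1 - s) μ p
    rw [← inv_mul_le_iff₀ hR]
    unfold blockMajorant; linarith
  have hB3 : ∀ p, ∑ i, lineMajorant R h (fun s => 1 - s) (partialSymbol i μ) p
        ≤ R * blockMajorant R h μ p := fun p =>
    le_trans (Finset.sum_le_sum fun i _ => le_add_of_nonneg_right (hU0 ..)) (hB34 p)
  have hB4 : ∀ p, ∑ i, lineMajorant R h (fun s => s * (1 - s)) (partialSymbol i μ) p
        ≤ R * blockMajorant R h μ p := fun p =>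
    le_trans (Finset.sum_le_sum fun i _ => le_add_of_nonneg_left (hU0 ..)) (hB34 p)
  have hpol : ∀ x x' : Pos d, 0 ≤ (1 + R * ‖x' - x‖) ^ decayExp (Pos d) := fun x x' => by
    positivity
  set H' : Phase d → Phase d →L[ℝ] CPos d := fun p => (-h) •
    ((lineAvg (fun s => 1 - s) h (fourierInvDeriv μ) p.1 p.2).comp
        (ContinuousLinearMap.fst ℝ (Pos d) (Pos d)) +
      (h • lineAvg (fun s => s * (1 - s)) h (fourierInvDeriv μ) p.1 p.2).comp
        (ContinuousLinearMap.snd ℝ (Pos d) (Pos d))) with hH'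
  have hH'1 : ∀ p y, H' p (y, 0)
      = (-h) • lineAvg (fun s => 1 - s) h (fourierInvDeriv μ) p.1 p.2 y := fun p y => by
    simp [hH']
  have hH'2 : ∀ p b, H' p (0, b)
      = (-h * h) • lineAvg (fun s => s * (1 - s)) h (fourierInvDeriv μ) p.1 p.2 b := fun p b => by
    simp [hH', smul_smul]
  refine ⟨fun p => (-h) • lineAvg (fun s => 1 - s) h g p.1 p.2, H',
    fun p => lineAvg (fun _ => 1) h g p.1 p.2, ⟨fun p => ?_, ?_, fun p => ?_, ?_, fun p => ?_,
    fun x x' v => ?_, fun x x' v => ?_, fun x x' v y => ?_, fun x x' v b => ?_,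
    fun x x' v b => ?_, fun x x' v => ?_, fun x x' v => ?_⟩⟩
  · exact (hasFDerivAt_lineAvg hw2 h hg' hg'c hg'b hgb p).const_smul (-h)
  · have c2 := continuous_lineAvg hw2 h hg'c hg'b
    have c3 := continuous_lineAvg hw3 h hg'c hg'b
    simp only [hH']
    fun_prop
  · rw [hH'1, neg_smul, lineAvg_one_sub_fderiv_apply h hg' hg'c, neg_sub]
  · exact continuous_blockMajorant R h h1 hs
  · exact (hU0 _ _ _).trans (hB1 p)
  · rw [norm_smul, norm_neg, Real.norm_eq_abs, abs_of_pos hh]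
    calc h * ‖lineAvg (fun s => 1 - s) h g x' v‖
        ≤ h * (K * (1 + R * ‖x' - x‖) ^ decayExp (Pos d) * blockMajorant R h μ (x, v)) := by
          gcongr
          exact ((hU (CPos d) _ hw2 h μ h1 R hR hs x x' v).1).trans
            (mul_le_mul_of_nonneg_left (hB2 _) (mul_nonneg hK.le (hpol x x')))
      _ = _ := by ring
  · rw [← smul_sub, norm_smul, norm_neg, Real.norm_eq_abs, abs_of_pos hh]
    calc h * ‖lineAvg (fun s => 1 - s) h g x' v - lineAvg (fun s => 1 - s) h g x v‖
        ≤ h * (K * (R * ‖x' - x‖) * (1 + R * ‖x' - x‖) ^ decayExp (Pos d) *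
            blockMajorant R h μ (x, v)) := by
          gcongr
          exact ((hU (CPos d) _ hw2 h μ h1 R hR hs x x' v).2).trans
            (mul_le_mul_of_nonneg_left (hB2 _) (by positivity))
      _ = _ := by ring
  · rw [hH'1, norm_smul, norm_neg, Real.norm_eq_abs, abs_of_pos hh,
      lineAvg_fourierInvDeriv_apply hw2 h h1 hs]
    calc h * ‖∑ i, y i • lineAvg (fun s => 1 - s) h (𝓕⁻ (partialSymbol i μ)) x' v‖
        ≤ h * (‖y‖ * ∑ i, K * (1 + R * ‖x' - x‖) ^ decayExp (Pos d) *
            lineMajorant R h (fun s => 1 - s) (partialSymbol i μ) (x, v)) := by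
          gcongr
          refine (norm_sum_smul_le _ _).trans ?_
          gcongr with i
          exact (hU (CPos d) _ hw2 h _ (h1i i) R hR (hsi i) x x' v).1
      _ ≤ h * (‖y‖ * (K * (1 + R * ‖x' - x‖) ^ decayExp (Pos d) *
            (R * blockMajorant R h μ (x, v)))) := by
          rw [← Finset.mul_sum]
          gcongr
          exact hB3 _
      _ = _ := by ring
  · rw [hH'2, norm_smul, neg_mul, norm_neg, Real.norm_eq_abs, abs_of_pos (mul_pos hh hh),
      lineAvg_fourierInvDeriv_apply hw3 h h1 hs]
    calc h * h * ‖∑ i, b i • lineAvg (fun s => s * (1 - s)) h (𝓕⁻ (partialSymbol i μ)) x' v‖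
        ≤ h * h * (‖b‖ * ∑ i, K * (1 + R * ‖x' - x‖) ^ decayExp (Pos d) *
            lineMajorant R h (fun s => s * (1 - s)) (partialSymbol i μ) (x, v)) := by
          gcongr
          refine (norm_sum_smul_le _ _).trans ?_
          gcongr with i
          exact (hU (CPos d) _ hw3 h _ (h1i i) R hR (hsi i) x x' v).1
      _ ≤ h * h * (‖b‖ * (K * (1 + R * ‖x' - x‖) ^ decayExp (Pos d) *
            (R * blockMajorant R h μ (x, v)))) := by
          rw [← Finset.mul_sum]
          gcongr
          exact hB4 _
      -- One h is the prefactor of H, the other comes from differentiating in v; together they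
      -- absorb the R of the derivative.
      _ = (R * h ^ 2) * (K * ‖b‖ * (1 + R * ‖x' - x‖) ^ decayExp (Pos d) *
            blockMajorant R h μ (x, v)) := by ring
      _ = _ := by rw [hRh, one_mul]
  · rw [hH'2, hH'2, ← smul_sub, norm_smul, neg_mul, norm_neg, Real.norm_eq_abs,
      abs_of_pos (mul_pos hh hh),
      lineAvg_fourierInvDeriv_apply hw3 h h1 hs, lineAvg_fourierInvDeriv_apply hw3 h h1 hs,
      ← Finset.sum_sub_distrib]
    simp_rw [← smul_sub]
    calc h * h * ‖∑ i, b i • (lineAvg (fun s => s * (1 - s)) h (𝓕⁻ (partialSymbol i μ)) x' v -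
            lineAvg (fun s => s * (1 - s)) h (𝓕⁻ (partialSymbol i μ)) x v)‖
        ≤ h * h * (‖b‖ * ∑ i, K * (R * ‖x' - x‖) * (1 + R * ‖x' - x‖) ^ decayExp (Pos d) *
            lineMajorant R h (fun s => s * (1 - s)) (partialSymbol i μ) (x, v)) := by
          gcongr
          refine (norm_sum_smul_le _ _).trans ?_
          gcongr with i
          exact (hU (CPos d) _ hw3 h _ (h1i i) R hR (hsi i) x x' v).2
      _ ≤ h * h * (‖b‖ * (K * (R * ‖x' - x‖) * (1 + R * ‖x' - x‖) ^ decayExp (Pos d) *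
            (R * blockMajorant R h μ (x, v)))) := by
          rw [← Finset.mul_sum]
          gcongr
          exact hB4 _
      _ = (R * h ^ 2) * (K * ‖b‖ * (R * ‖x' - x‖) * (1 + R * ‖x' - x‖) ^ decayExp (Pos d) *
            blockMajorant R h μ (x, v)) := by ring
      _ = _ := by rw [hRh, one_mul]
  · exact ((hU (CPos d) _ hw1 h μ h1 R hR hs x x' v).1).trans
      (mul_le_mul_of_nonneg_left (hB1 _) (mul_nonneg hK.le (hpol x x')))
  · exact ((hU (CPos d) _ hw1 h μ h1 R hR hs x x' v).2).trans
      (mul_le_mul_of_nonneg_left (hB1 _) (by positivity))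

end Corrector

section Corrector

open scoped RealInnerProductSpace

variable {d : ℕ}

/-- There are two terms without derivative and 2d with one; each derivative costs 2πR, of which
`R⁻¹` leaves 2π. Hence the factor 2 + 4πd. -/
theorem eLpNorm_blockMajorant_le {R h : ℝ} (hR : 0 < R) {μ : Pos d → CPos d}
    (h1 : Integrable μ) (h2 : MemLp μ 2) (hs : ∀ k, μ k ≠ 0 → ‖k‖ ≤ R) {B : ℝ} (hB0 : 0 ≤ B)
    (hB : ∀ k, μ k ≠ 0 → 1 ≤ B ∨ 1 ≤ B * |h * ‖k‖|) {S : Set (Phase d)} (hS : MeasurableSet S)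
    {D : ℝ} (v₀ : Pos d) (hD : ∀ p ∈ S, ‖p.2 - v₀‖ ≤ D) :
    eLpNorm (blockMajorant R h μ) 2 (volume.restrict S)
      ≤ ENNReal.ofReal ((2 + 4 * Real.pi * d) * majorantConst (Pos d) D * √B) *
        eLpNorm μ 2 volume := by
  set c := majorantConst (Pos d) D * √B with hc
  have hc0 : 0 ≤ c := mul_nonneg (majorantConst_nonneg D) (Real.sqrt_nonneg _)
  set N := eLpNorm μ 2 volume with hN
  have hπ := Real.pi_pos
  have h1i := fun i => integrable_partialSymbol h1 hs i
  have h2i := fun i => memLp_partialSymbol h2 hs i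
  have hBi : ∀ i k, partialSymbol i μ k ≠ 0 → 1 ≤ B ∨ 1 ≤ B * |h * ‖k‖| := fun i k hk =>
    hB k (partialSymbol_ne_zero hk)
  have hNi : ∀ i, eLpNorm (partialSymbol i μ) 2 volume ≤ ENNReal.ofReal (2 * Real.pi * R) * N :=
    fun i => eLpNorm_le_mul_eLpNorm_of_ae_le_mul
      (ae_of_all _ fun k => norm_partialSymbol_le hs i k) 2
  have hl : ∀ {w : ℝ → ℝ}, IsUnitWeight w →
      eLpNorm (lineMajorant R h w μ) 2 (volume.restrict S) ≤ ENNReal.ofReal c * N :=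
    fun hw => eLpNorm_lineMajorant_le R h hw h1 h2 hB0 hB hS v₀ hD
  have hli : ∀ {w : ℝ → ℝ}, IsUnitWeight w → ∀ i,
      eLpNorm (lineMajorant R h w (partialSymbol i μ)) 2 (volume.restrict S)
        ≤ ENNReal.ofReal c * (ENNReal.ofReal (2 * Real.pi * R) * N) := fun hw i =>
    (eLpNorm_lineMajorant_le R h hw (h1i i) (h2i i) hB0 (hBi i) hS v₀ hD).trans
      (mul_le_mul' le_rfl (hNi i))
  have m1 : ∀ {w : ℝ → ℝ}, IsUnitWeight w →
      AEStronglyMeasurable (lineMajorant R h w μ) (volume.restrict S) := fun hw =>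
    (continuous_lineMajorant R h hw h1).aestronglyMeasurable
  have m2 : ∀ {w : ℝ → ℝ}, IsUnitWeight w → ∀ i,
      AEStronglyMeasurable (lineMajorant R h w (partialSymbol i μ)) (volume.restrict S) :=
    fun hw i => (continuous_lineMajorant R h hw (h1i i)).aestronglyMeasurable
  have m3 := fun i => (m2 isUnitWeight_one_sub i).add (m2 isUnitWeight_mul_one_sub i)
  have hsum : eLpNorm (∑ i, (lineMajorant R h (fun s => 1 - s) (partialSymbol i μ) +
      lineMajorant R h (fun s => s * (1 - s)) (partialSymbol i μ))) 2 (volume.restrict S)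
      ≤ ∑ _i : Fin d, (ENNReal.ofReal c * (ENNReal.ofReal (2 * Real.pi * R) * N) +
        ENNReal.ofReal c * (ENNReal.ofReal (2 * Real.pi * R) * N)) := by
    refine (eLpNorm_sum_le (fun i _ => m3 i) one_le_two).trans (Finset.sum_le_sum fun i _ => ?_)
    exact (eLpNorm_add_le (m2 isUnitWeight_one_sub i) (m2 isUnitWeight_mul_one_sub i)
      one_le_two).trans (add_le_add (hli isUnitWeight_one_sub i) (hli isUnitWeight_mul_one_sub i))
  have e : blockMajorant R h μ = (lineMajorant R h (fun _ => 1) μ +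
      lineMajorant R h (fun s => 1 - s) μ) +
      R⁻¹ • ∑ i, (lineMajorant R h (fun s => 1 - s) (partialSymbol i μ) +
        lineMajorant R h (fun s => s * (1 - s)) (partialSymbol i μ)) := by
    funext p
    simp only [blockMajorant, Pi.add_apply, Pi.smul_apply, Finset.sum_apply, smul_eq_mul]
  have m4 : AEStronglyMeasurable (∑ i, (lineMajorant R h (fun s => 1 - s) (partialSymbol i μ) +
      lineMajorant R h (fun s => s * (1 - s)) (partialSymbol i μ))) (volume.restrict S) :=
    Finset.aestronglyMeasurable_sum _ fun i _ => m3 i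
  rw [e]
  refine (eLpNorm_add_le ((m1 isUnitWeight_one).add (m1 isUnitWeight_one_sub))
    (m4.const_smul _) one_le_two).trans ?_
  refine (add_le_add (eLpNorm_add_le (m1 isUnitWeight_one) (m1 isUnitWeight_one_sub)
    one_le_two) (eLpNorm_const_smul_le)).trans ?_
  refine (add_le_add (add_le_add (hl isUnitWeight_one) (hl isUnitWeight_one_sub))
    (mul_le_mul' le_rfl hsum)).trans (le_of_eq ?_)
  rw [Finset.sum_const, Finset.card_univ, Fintype.card_fin, nsmul_eq_mul,
    Real.enorm_eq_ofReal (inv_nonneg.2 hR.le), mul_assoc _ (majorantConst _ _), ← hc,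
    ← ENNReal.ofReal_natCast, ← two_mul, ← two_mul, ← ENNReal.ofReal_ofNat 2]
  generalize hn : (d : ℝ) = n
  have hn0 : 0 ≤ n := hn ▸ Nat.cast_nonneg d
  simp only [← mul_assoc]
  rw [← ENNReal.ofReal_mul (by norm_num), ← ENNReal.ofReal_mul (by positivity),
    ← ENNReal.ofReal_mul (by positivity), ← ENNReal.ofReal_mul (by positivity),
    ← ENNReal.ofReal_mul (by positivity), ← add_mul, ← ENNReal.ofReal_add (by positivity)
      (by positivity)]
  congr 2
  field_simp
  ring

end Corrector

/-! ### Dyadic decomposition of a Sobolev field -/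

section Dyadic

open Filter Topology

variable {d : ℕ}

/-- Plancherel for the error of a frequency truncation, stated with the pointwise inverse transform
of ν. -/
theorem eLpNorm_sub_fourierInv {V E : Type*} [NormedAddCommGroup V] [InnerProductSpace ℝ V]
    [FiniteDimensional ℝ V] [MeasurableSpace V] [BorelSpace V] [NormedAddCommGroup E]
    [InnerProductSpace ℂ E] [CompleteSpace E] (f : Lp E 2 (volume : Measure V)) {ν : V → E}
    (h1 : Integrable ν) (h2 : MemLp ν 2) :
    eLpNorm (⇑f - 𝓕⁻ ν) 2 volume
      = eLpNorm (⇑(𝓕 f : Lp E 2 (volume : Measure V)) - ν) 2 volume := by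
  have e1 : (⇑f - 𝓕⁻ ν) =ᵐ[volume] ⇑(f - 𝓕⁻ (h2.toLp ν)) := by
    filter_upwards [Lp.coeFn_sub f (𝓕⁻ (h2.toLp ν)), fourierInv_toLp_ae_eq h1 h2] with x hx hx'
    rw [hx, Pi.sub_apply, Pi.sub_apply, hx']
  have e2 : (⇑(𝓕 f : Lp E 2 (volume : Measure V)) - ν) =ᵐ[volume] ⇑(𝓕 f - h2.toLp ν) := by
    filter_upwards [Lp.coeFn_sub (𝓕 f) (h2.toLp ν), h2.coeFn_toLp] with x hx hx'
    rw [hx, Pi.sub_apply, Pi.sub_apply, hx']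
  have e3 : ‖f - 𝓕⁻ (h2.toLp ν)‖ = ‖𝓕 f - h2.toLp ν‖ := by
    have e4 : 𝓕 (f - 𝓕⁻ (h2.toLp ν)) = 𝓕 f - 𝓕 (𝓕⁻ (h2.toLp ν)) :=
      (Lp.fourierTransformₗᵢ V E).map_sub _ _
    rw [← Lp.norm_fourier_eq (f - 𝓕⁻ (h2.toLp ν)), e4, FourierTransform.fourier_fourierInv_eq]
  rw [eLpNorm_congr_ae e1, eLpNorm_congr_ae e2, ← Lp.enorm_def, ← Lp.enorm_def, ← ofReal_norm,
    ← ofReal_norm, e3]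

open scoped RealInnerProductSpace in
theorem fourierInv_finsetSum {V E ι : Type*} [NormedAddCommGroup V] [InnerProductSpace ℝ V]
    [FiniteDimensional ℝ V] [MeasurableSpace V] [BorelSpace V] [NormedAddCommGroup E]
    [InnerProductSpace ℂ E] (s : Finset ι) {f : ι → V → E} (h : ∀ j ∈ s, Integrable (f j))
    (x : V) : 𝓕⁻ (∑ j ∈ s, f j) x = ∑ j ∈ s, 𝓕⁻ (f j) x := by
  simp only [Real.fourierInv_eq, Finset.sum_apply, Finset.smul_sum]
  refine integral_finsetSum _ fun j hj => ?_
  have := (Real.fourierIntegral_convergent_iff (μ := volume) (-x)).2 (h j hj)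
  simpa only [inner_neg_right, neg_neg] using this

/-- The dyadic frequency shells. -/
def dyadicShell (d : ℕ) : ℕ → Set (Pos d)
  | 0 => {k | ‖k‖ < 1}
  | j + 1 => {k | 2 ^ j ≤ ‖k‖ ∧ ‖k‖ < 2 ^ (j + 1)}

theorem measurableSet_dyadicShell (j : ℕ) : MeasurableSet (dyadicShell d j) := by
  cases j with
  | zero => exact measurableSet_lt measurable_norm measurable_const
  | succ j =>
    exact (measurableSet_le (measurable_const (a := (2 : ℝ) ^ j)) measurable_norm).inter
      (measurableSet_lt measurable_norm (measurable_const (a := (2 : ℝ) ^ (j + 1))))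

theorem norm_lt_of_mem_dyadicShell {j : ℕ} {k : Pos d} (hk : k ∈ dyadicShell d j) :
    ‖k‖ < 2 ^ j := by
  cases j with
  | zero => simpa [dyadicShell] using hk
  | succ j => exact hk.2

theorem le_norm_of_mem_dyadicShell {j : ℕ} {k : Pos d} (hk : k ∈ dyadicShell d j) :
    j = 0 ∨ (2 : ℝ) ^ j / 2 ≤ ‖k‖ := by
  cases j with
  | zero => exact Or.inl rfl
  | succ j => right; rw [pow_succ]; simpa using hk.1

theorem sum_indicator_dyadicShell {E : Type*} [NormedAddCommGroup E] (f : Pos d → E) (J : ℕ) :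
    ∑ j ∈ Finset.range (J + 1), (dyadicShell d j).indicator f
      = {k : Pos d | ‖k‖ < 2 ^ J}.indicator f := by
  induction J with
  | zero => simp [dyadicShell]
  | succ J ih =>
    rw [Finset.sum_range_succ, ih]
    funext k
    have h2 : (2 : ℝ) ^ J ≤ 2 ^ (J + 1) := pow_le_pow_right₀ one_le_two (Nat.le_succ J)
    by_cases h : ‖k‖ < 2 ^ J
    · simp [indicator, dyadicShell, h, h.trans_le h2, not_le.2 h]
    · simp [indicator, dyadicShell, h, not_lt.1 h]

/-- The dyadic pieces of `f`, on the Fourier side. -/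
noncomputable def dyadicPiece (f : Pos d → CPos d) (j : ℕ) : Pos d → CPos d :=
  (dyadicShell d j).indicator f

theorem memLp_dyadicPiece {f : Pos d → CPos d} (hf : MemLp f 2) (j : ℕ) :
    MemLp (dyadicPiece f j) 2 := hf.indicator (measurableSet_dyadicShell j)

theorem integrable_dyadicPiece {f : Pos d → CPos d} (hf : MemLp f 2) (j : ℕ) :
    Integrable (dyadicPiece f j) := by
  rw [dyadicPiece, integrable_indicator_iff (measurableSet_dyadicShell j)]
  have hfin : volume (dyadicShell d j) ≠ ∞ := by
    refine ((measure_mono fun k hk => ?_).trans_lt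
      (measure_ball_lt_top (x := (0 : Pos d)) (r := 2 ^ j))).ne
    simpa using norm_lt_of_mem_dyadicShell hk
  have : IsFiniteMeasure (volume.restrict (dyadicShell d j)) :=
    isFiniteMeasure_restrict.2 hfin
  exact (hf.restrict _).integrable one_le_two

theorem dyadicPiece_ne_zero {f : Pos d → CPos d} {j : ℕ} {k : Pos d}
    (h : dyadicPiece f j k ≠ 0) : k ∈ dyadicShell d j := by
  by_contra hk
  exact h (indicator_of_notMem hk f)

/-- The length of the averages that correspond to frequencies of size `2 ^ j`. -/
noncomputable def dyadicLength (j : ℕ) : ℝ := (√(2 ^ j))⁻¹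

theorem dyadicLength_pos (j : ℕ) : 0 < dyadicLength j := by unfold dyadicLength; positivity

theorem pow_mul_dyadicLength_sq (j : ℕ) : 2 ^ j * dyadicLength j ^ 2 = 1 := by
  rw [dyadicLength, inv_pow, Real.sq_sqrt (by positivity), mul_inv_cancel₀ (by positivity)]

/-- With h = 2^(-j/2) and |k| ≥ 2^j/2 one has h|k| ≥ 1/(2h), so the averaging gain is `B` = 2h. The
lowest shell reaches k = 0, but there 2h = 2 already exceeds 1. -/
theorem dyadicPiece_separation {f : Pos d → CPos d} {j : ℕ} {k : Pos d}
    (h : dyadicPiece f j k ≠ 0) :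
    1 ≤ 2 * dyadicLength j ∨ 1 ≤ 2 * dyadicLength j * |dyadicLength j * ‖k‖| := by
  rcases le_norm_of_mem_dyadicShell (dyadicPiece_ne_zero h) with rfl | hk
  · left; simp [dyadicLength]
  · right
    have h0 := dyadicLength_pos j
    rw [abs_of_nonneg (by positivity)]
    calc (1 : ℝ) = 2 * dyadicLength j * (dyadicLength j * (2 ^ j / 2)) := by
          linear_combination -pow_mul_dyadicLength_sq j
      _ ≤ _ := by gcongr

/-- On `s` the Sobolev weight is at least ρ^(2σ); the factor 2π more than compensates the half in
ρ/2. It serves both for a single shell and for the tail beyond 2^J. -/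
theorem eLpNorm_indicator_le {s : Set (Pos d)} {σ ρ : ℝ} (hσ : 0 ≤ σ)
    (hρ : 0 < ρ) (h : ∀ k ∈ s, ρ ≤ 1 ∨ ρ / 2 ≤ ‖k‖) {f : Pos d → CPos d} :
    eLpNorm (s.indicator f) 2 volume ≤ ENNReal.ofReal (ρ ^ (-σ)) *
      (∫⁻ k : Pos d, ENNReal.ofReal ((1 + (2 * Real.pi * ‖k‖) ^ 2) ^ σ) * ‖f k‖ₑ ^ 2) ^
        (1 / 2 : ℝ) := by
  rw [eLpNorm_eq_lintegral_rpow_enorm_toReal two_ne_zero ENNReal.ofNat_ne_top]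
  simp only [ENNReal.toReal_ofNat, ENNReal.rpow_ofNat]
  have e : ENNReal.ofReal (ρ ^ (-σ)) = (ENNReal.ofReal (ρ ^ (-σ)) ^ 2) ^ (1 / 2 : ℝ) := by
    rw [← ENNReal.rpow_natCast, ← ENNReal.rpow_mul]; norm_num
  rw [e, ← ENNReal.mul_rpow_of_nonneg _ _ (by norm_num), ← ENNReal.ofReal_pow (by positivity)]
  refine ENNReal.rpow_le_rpow ?_ (by norm_num)
  rw [← lintegral_const_mul' _ _ ENNReal.ofReal_ne_top]
  refine lintegral_mono fun k => ?_
  by_cases hk : k ∈ s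
  · rw [indicator_of_mem hk, ← mul_assoc, ← ENNReal.ofReal_mul (by positivity)]
    refine le_mul_of_one_le_left' ?_
    rw [ENNReal.one_le_ofReal]
    have hπ := Real.pi_gt_three
    have h1 : ρ ^ 2 ≤ 1 + (2 * Real.pi * ‖k‖) ^ 2 := by
      rcases h k hk with h | h
      · nlinarith [sq_nonneg (2 * Real.pi * ‖k‖)]
      · have : ρ ≤ 2 * Real.pi * ‖k‖ := by nlinarith
        nlinarith
    have h2 := Real.rpow_le_rpow (by positivity) h1 hσ
    calc (1 : ℝ) = (ρ ^ (-σ)) ^ 2 * (ρ ^ 2) ^ σ := by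
          rw [← Real.rpow_natCast, ← Real.rpow_natCast, ← Real.rpow_mul hρ.le,
            ← Real.rpow_mul hρ.le, ← Real.rpow_add hρ]
          norm_num
          ring_nf
          simp
      _ ≤ _ := by gcongr
  · simp [hk]

/-- A field of finite Sobolev norm has a dyadic decomposition. -/
theorem exists_dyadic {σ : ℝ} (hσ : 0 < σ) {G : Pos d → Pos d} (hG : sobolevENorm σ G < ∞) :
    ∃ μ : ℕ → Pos d → CPos d,
      (∀ j, Integrable (μ j)) ∧ (∀ j, MemLp (μ j) 2) ∧
      (∀ j k, μ j k ≠ 0 → ‖k‖ ≤ 2 ^ j) ∧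
      (∀ j k, μ j k ≠ 0 →
        1 ≤ 2 * dyadicLength j ∨ 1 ≤ 2 * dyadicLength j * |dyadicLength j * ‖k‖|) ∧
      (∀ j, eLpNorm (μ j) 2 volume ≤ ENNReal.ofReal ((2 ^ j : ℝ) ^ (-σ)) * sobolevENorm σ G) ∧
      Tendsto (fun J => eLpNorm (fun x => complexify G x -
        ∑ j ∈ Finset.range (J + 1), 𝓕⁻ (μ j) x) 2 volume) atTop (𝓝 0) := by
  have hm : MemLp (complexify G) 2 volume := by
    by_contra h
    rw [sobolevENorm, iInf_neg h] at hG
    exact lt_irrefl _ hG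
  set f : Lp (CPos d) 2 (volume : Measure (Pos d)) := 𝓕 (hm.toLp (complexify G)) with hf
  have hN : sobolevENorm σ G = (∫⁻ k : Pos d,
      ENNReal.ofReal ((1 + (2 * Real.pi * ‖k‖) ^ 2) ^ σ) * ‖f k‖ₑ ^ 2) ^ (1 / 2 : ℝ) := by
    rw [sobolevENorm, iInf_pos hm]
  have hf2 : MemLp f 2 volume := Lp.memLp f
  have h1 := integrable_dyadicPiece hf2
  have h2 := memLp_dyadicPiece hf2
  refine ⟨dyadicPiece f, h1, h2, fun j k hk =>
    (norm_lt_of_mem_dyadicShell (dyadicPiece_ne_zero hk)).le,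
    fun j k hk => dyadicPiece_separation hk, fun j => ?_, ?_⟩
  · rw [hN]
    refine eLpNorm_indicator_le hσ.le (by positivity) fun k hk => ?_
    rcases le_norm_of_mem_dyadicShell hk with rfl | h
    · left; simp
    · exact Or.inr h
  · have hle : ∀ J : ℕ, eLpNorm (fun x => complexify G x -
        ∑ j ∈ Finset.range (J + 1), 𝓕⁻ (dyadicPiece f j) x) 2 volume
          ≤ ENNReal.ofReal (((2 : ℝ) ^ (-σ)) ^ J) * sobolevENorm σ G := by
      intro J
      set ν : Pos d → CPos d := ∑ j ∈ Finset.range (J + 1), dyadicPiece f j with hν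
      have n1 : Integrable ν := integrable_finsetSum' _ fun j _ => h1 j
      have n2 : MemLp ν 2 := memLp_finsetSum' _ fun j _ => h2 j
      have e1 : ∀ x, ∑ j ∈ Finset.range (J + 1), 𝓕⁻ (dyadicPiece f j) x = 𝓕⁻ ν x := by
        intro x
        rw [hν, fourierInv_finsetSum _ fun j _ => h1 j]
      have e2 : eLpNorm (fun x => complexify G x - 𝓕⁻ ν x) 2 volume
          = eLpNorm (⇑(hm.toLp (complexify G)) - 𝓕⁻ ν) 2 volume := by
        refine eLpNorm_congr_ae ?_
        filter_upwards [hm.coeFn_toLp] with x hx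
        rw [Pi.sub_apply, hx]
      simp only [e1]
      rw [e2, eLpNorm_sub_fourierInv _ n1 n2, ← hf]
      -- The shells telescope to a ball, so the error is the high-frequency tail of f, of size
      -- 2^(-Jσ) relative to the norm.
      have e3 : ⇑f - ν = {k : Pos d | ‖k‖ < 2 ^ J}ᶜ.indicator f := by
        rw [hν]
        simp only [dyadicPiece]
        rw [sum_indicator_dyadicShell, indicator_compl]
      have e4 : ((2 : ℝ) ^ (-σ)) ^ J = ((2 : ℝ) ^ J) ^ (-σ) := by
        rw [← Real.rpow_natCast, ← Real.rpow_natCast, ← Real.rpow_mul zero_le_two,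
          ← Real.rpow_mul zero_le_two, mul_comm]
      rw [e3, hN, e4]
      refine eLpNorm_indicator_le hσ.le (by positivity) fun k hk => ?_
      have h3 : (2 : ℝ) ^ J ≤ ‖k‖ := not_lt.1 hk
      exact Or.inr ((half_le_self (by positivity)).trans h3)
    refine tendsto_of_tendsto_of_tendsto_of_le_of_le tendsto_const_nhds ?_
      (fun J => zero_le) hle
    have h3 : Tendsto (fun J : ℕ => ((2 : ℝ) ^ (-σ)) ^ J) atTop (𝓝 0) :=
      tendsto_pow_atTop_nhds_zero_of_lt_one (by positivity)
        (Real.rpow_lt_one_of_one_lt_of_neg one_lt_two (by linarith))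
    have h4 := ENNReal.Tendsto.mul_const (b := sobolevENorm σ G) (ENNReal.tendsto_ofReal h3)
      (Or.inr hG.ne)
    simpa using h4

end Dyadic

/-! ### Trajectories of bounded forces -/

section Trajectories

variable {d : ℕ} {F : Pos d → Pos d} {x v : ℝ → Pos d} {A : ℝ}

theorem IsNewtonTrajectory.velocity_sub (h : IsNewtonTrajectory F x v) (s t : ℝ) :
    v t - v s = ∫ r in s..t, F (x r) := by
  rw [h.velocity t, h.velocity s, add_sub_add_left_eq_sub,
    intervalIntegral.integral_interval_sub_left (h.force_integrable t) (h.force_integrable s)]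

theorem IsNewtonTrajectory.norm_velocity_sub_le (h : IsNewtonTrajectory F x v)
    (hA : ∀ y, ‖F y‖ ≤ A) (s t : ℝ) : ‖v t - v s‖ ≤ A * |t - s| := by
  rw [h.velocity_sub]
  exact intervalIntegral.norm_integral_le_of_norm_le_const fun r _ => hA _

theorem IsNewtonTrajectory.lipschitzWith_velocity (h : IsNewtonTrajectory F x v)
    (hA : ∀ y, ‖F y‖ ≤ A) : LipschitzWith A.toNNReal v :=
  LipschitzWith.of_dist_le_mul fun t s => by
    rw [dist_eq_norm, dist_eq_norm, Real.coe_toNNReal _ ((norm_nonneg _).trans (hA 0)),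
      Real.norm_eq_abs]
    exact h.norm_velocity_sub_le hA s t

theorem IsNewtonTrajectory.continuous_position (h : IsNewtonTrajectory F x v) : Continuous x :=
  continuous_iff_continuousAt.2 fun t => (h.position t).continuousAt

theorem IsNewtonTrajectory.exists_lipschitzOnWith (h : IsNewtonTrajectory F x v)
    (hA : ∀ y, ‖F y‖ ≤ A) (a b : ℝ) :
    ∃ K, LipschitzOnWith K (fun t => (x t, v t)) (Icc a b) := by
  have hv := h.lipschitzWith_velocity hA
  have hx : ContDiff ℝ 1 x := by
    refine contDiff_one_iff_deriv.2 ⟨fun t => (h.position t).differentiableAt, ?_⟩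
    rw [show deriv x = v from funext fun t => (h.position t).deriv]
    exact hv.continuous
  obtain ⟨K, hK⟩ := hx.contDiffOn.exists_lipschitzOnWith one_ne_zero (convex_Icc a b) isCompact_Icc
  exact ⟨_, hK.prodMk hv.lipschitzOnWith⟩

theorem IsNewtonTrajectory.ae_hasDerivAt_velocity (h : IsNewtonTrajectory F x v) (T : ℝ) :
    ∀ᵐ t, t ∈ uIcc 0 T → HasDerivAt v (F (x t)) t := by
  filter_upwards [(h.force_integrable T).ae_hasDerivAt_integral] with t ht hm
  have h1 := (ht hm 0 left_mem_uIcc).const_add (v 0)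
  rwa [show (fun t => v 0 + ∫ s in (0 : ℝ)..t, F (x s)) = v from
    funext fun t => (h.velocity t).symm] at h1

/-- A differential inequality that holds almost everywhere can be integrated. -/
theorem sub_le_integral_of_ae_hasDerivAt {E : Type*} [NormedAddCommGroup E] [NormedSpace ℝ E]
    {Ψ : E → ℝ} (hΨ : ContDiff ℝ 1 Ψ) {γ : ℝ → E} {T : ℝ} (hT : 0 ≤ T) {K : NNReal}
    (hγ : LipschitzOnWith K γ (Icc 0 T)) {m : ℝ → ℝ} (hm : IntervalIntegrable m volume 0 T)
    (h : ∀ᵐ t, t ∈ Icc 0 T → ∃ c, HasDerivAt (fun t => Ψ (γ t)) c t ∧ c ≤ m t) :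
    Ψ (γ T) - Ψ (γ 0) ≤ ∫ t in (0 : ℝ)..T, m t := by
  obtain ⟨K', hK'⟩ := (hΨ.locallyLipschitz.locallyLipschitzOn
    (s := γ '' Icc 0 T)).exists_lipschitzOnWith_of_compact (isCompact_Icc.image_of_continuousOn
      hγ.continuousOn)
  -- The velocity is differentiable only almost everywhere; a C¹ function of a Lipschitz curve is
  -- nevertheless Lipschitz on a compact interval, so the integral of its a.e. derivative recovers
  -- the increment.
  have hac : AbsolutelyContinuousOnInterval (fun t => Ψ (γ t)) 0 T := by
    refine LipschitzOnWith.absolutelyContinuousOnInterval (K := K' * K) ?_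
    rw [uIcc_of_le hT]
    exact hK'.comp hγ (mapsTo_image _ _)
  rw [← hac.integral_deriv_eq_sub]
  refine intervalIntegral.integral_mono_ae_restrict hT hac.intervalIntegrable_deriv hm ?_
  rw [Filter.EventuallyLE, ae_restrict_iff' measurableSet_Icc]
  filter_upwards [h] with t ht hmem
  obtain ⟨c, hc, hcm⟩ := ht hmem
  rwa [hc.deriv]

end Trajectories

/-! ### Cutoff and three-point interpolation -/

section ThreePoint

/-- The cutoff used to pass from the pair `(X, V)`, `(X', V)` to the pair `(X, V)`, `(X', V')`. -/
noncomputable def cutoff (q : ℕ) (s : ℝ) : ℝ := ((1 + s ^ 2) ^ q)⁻¹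

theorem cutoff_pos (q : ℕ) (s : ℝ) : 0 < cutoff q s := by unfold cutoff; positivity

theorem cutoff_le_one (q : ℕ) (s : ℝ) : cutoff q s ≤ 1 :=
  inv_le_one_of_one_le₀ (one_le_pow₀ (by nlinarith [sq_nonneg s]))

theorem pow_mul_cutoff_le (q : ℕ) {s : ℝ} (hs : 0 ≤ s) : (1 + s) ^ q * cutoff q s ≤ 2 ^ q := by
  rw [cutoff, mul_inv_le_iff₀ (by positivity), ← mul_pow]
  exact pow_le_pow_left₀ (by positivity) (by nlinarith [sq_nonneg (s - 1)]) q

/-- For s ≤ 1, Bernoulli's inequality gives even q s²; for s ≥ 1 the left side is below 1 ≤ q s. -/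
theorem one_sub_cutoff_le {q : ℕ} (hq : 1 ≤ q) {s : ℝ} (hs : 0 ≤ s) : 1 - cutoff q s ≤ q * s := by
  have hq' : (1 : ℝ) ≤ q := by exact_mod_cast hq
  rcases le_total s 1 with h | h
  · have h2 : 1 - (q : ℝ) * s ^ 2 ≤ cutoff q s := by
      have hs2 : s ^ 2 ≤ 1 := by nlinarith
      have h3 := one_add_mul_le_pow (a := -s ^ 2) (by linarith) q
      have h4 : 1 + -s ^ 2 ≤ (1 + s ^ 2)⁻¹ := by
        rw [← one_div, le_div_iff₀ (by positivity)]
        nlinarith [sq_nonneg (s ^ 2)]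
      calc 1 - (q : ℝ) * s ^ 2 = 1 + q * -s ^ 2 := by ring
        _ ≤ (1 + -s ^ 2) ^ q := h3
        _ ≤ ((1 + s ^ 2)⁻¹) ^ q := pow_le_pow_left₀ (by linarith) h4 q
        _ = cutoff q s := inv_pow _ _
    have : (q : ℝ) * s ^ 2 ≤ q * s := by gcongr; nlinarith
    linarith
  · have := cutoff_pos q s
    nlinarith

/-- The combination equals (1-χ)(a-c) - χ(b-a). The first term is O(s) because 1-χ ≤ qs, without any
comparison between a and c; in the second, χ absorbs the polynomial growth (1+s)^q. In use, a, b, c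
are values at (X,V), (X',V), (X',V'). -/
theorem norm_threePoint_le {E : Type*} [NormedAddCommGroup E] [NormedSpace ℝ E] {q : ℕ}
    (hq : 1 ≤ q) {s κ B B' : ℝ} (hs : 0 ≤ s) (hκ : 0 ≤ κ) (hB : 0 ≤ B) (hB' : 0 ≤ B') {a b c : E}
    (hab : ‖b - a‖ ≤ κ * s * (1 + s) ^ q * B) (ha : ‖a‖ ≤ κ * B) (hc : ‖c‖ ≤ κ * B') :
    ‖a - cutoff q s • b - (1 - cutoff q s) • c‖ ≤ κ * (2 ^ q + q) * s * (B + B') := by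
  set χ := cutoff q s with hχ
  have h0 : 0 < χ := cutoff_pos q s
  have h1 : χ ≤ 1 := cutoff_le_one q s
  have h2 := pow_mul_cutoff_le q hs
  have h3 := one_sub_cutoff_le hq hs
  have e : a - χ • b - (1 - χ) • c = (1 - χ) • (a - c) - χ • (b - a) := by
    module
  rw [e]
  calc ‖(1 - χ) • (a - c) - χ • (b - a)‖ ≤ (1 - χ) * (‖a‖ + ‖c‖) + χ * ‖b - a‖ := by
        refine (norm_sub_le _ _).trans ?_
        rw [norm_smul, norm_smul, Real.norm_of_nonneg (sub_nonneg.2 h1), Real.norm_of_nonneg h0.le]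
        have := norm_sub_le a c
        have := mul_le_mul_of_nonneg_left this (sub_nonneg.2 h1)
        linarith
    _ ≤ (q * s) * (κ * B + κ * B') + χ * (κ * s * (1 + s) ^ q * B) := by
        gcongr
    _ = (q * s) * (κ * B + κ * B') + ((1 + s) ^ q * χ) * (κ * s * B) := by ring
    _ ≤ (q * s) * (κ * B + κ * B') + 2 ^ q * (κ * s * B) := by gcongr
    _ ≤ _ := by
        have : 0 ≤ 2 ^ q * (κ * s * B') := by positivity
        linarith

end ThreePoint

/-! ### Correction of the velocity difference by one block -/

section BlockCorrection

open scoped RealInnerProductSpace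

variable {d : ℕ}

/-- The correction of the velocity difference that is due to one frequency block. -/
noncomputable def blockCorrection (R : ℝ) (H : Phase d → CPos d) (p p' : Phase d) : CPos d :=
  H p - cutoff (decayExp (Pos d)) (R * ‖p.1 - p'.1‖) • H (p'.1, p.2) -
    (1 - cutoff (decayExp (Pos d)) (R * ‖p.1 - p'.1‖)) • H p'

variable {K R h : ℝ} {g : Pos d → CPos d} {H : Phase d → CPos d}
  {H' : Phase d → Phase d →L[ℝ] CPos d} {r : Phase d → CPos d} {B : Phase d → ℝ}

theorem one_le_decayExp : 1 ≤ decayExp (Pos d) := Nat.le_add_left _ _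

theorem IsCorrector.norm_blockCorrection_le (hc : IsCorrector K R h g H H' r B) (hK : 0 ≤ K)
    (hR : 0 ≤ R) (hh : 0 ≤ h) (p p' : Phase d) :
    ‖blockCorrection R H p p'‖ ≤ K * h * (2 ^ decayExp (Pos d) + decayExp (Pos d)) *
      (R * ‖p.1 - p'.1‖) * (B p + B p') := by
  obtain ⟨x, v⟩ := p
  obtain ⟨x', v'⟩ := p'
  refine norm_threePoint_le one_le_decayExp (by positivity) (by positivity)
    (hc.majorant_nonneg _) (hc.majorant_nonneg _) ?_ ?_ ?_
  · rw [norm_sub_rev x x']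
    exact hc.value_sub_le x x' v
  · simpa using hc.value_le x x v
  · simpa using hc.value_le x' x' v'

theorem cutoff_eq (q : ℕ) (R : ℝ) (y : Pos d) :
    cutoff q (R * ‖y‖) = ((1 + R ^ 2 * ‖y‖ ^ 2) ^ q)⁻¹ := by
  rw [cutoff, mul_pow]

theorem contDiff_blockCorrection (R : ℝ) (hH : ContDiff ℝ 1 H) :
    ContDiff ℝ 1 fun P : Phase d × Phase d => blockCorrection R H P.1 P.2 := by
  have h1 : ContDiff ℝ 1 fun P : Phase d × Phase d =>
      ((1 + R ^ 2 * ‖P.1.1 - P.2.1‖ ^ 2) ^ decayExp (Pos d))⁻¹ := by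
    refine ContDiff.inv ?_ fun P => by positivity
    have : ContDiff ℝ 1 fun P : Phase d × Phase d => P.1.1 - P.2.1 := by fun_prop
    exact (contDiff_const.add (contDiff_const.mul (this.norm_sq ℝ))).pow _
  have h2 : ContDiff ℝ 1 fun P : Phase d × Phase d => H P.1 := hH.comp contDiff_fst
  have h3 : ContDiff ℝ 1 fun P : Phase d × Phase d => H P.2 := hH.comp contDiff_snd
  have h4 : ContDiff ℝ 1 fun P : Phase d × Phase d => H (P.2.1, P.1.2) :=
    hH.comp (by fun_prop : ContDiff ℝ 1 fun P : Phase d × Phase d => (P.2.1, P.1.2))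
  simp only [blockCorrection, cutoff_eq]
  exact (h2.sub (h1.smul h4)).sub ((contDiff_const.sub h1).smul h3)

theorem IsCorrector.contDiff (hc : IsCorrector K R h g H H' r B) : ContDiff ℝ 1 H :=
  contDiff_one_iff_hasFDerivAt.2 ⟨H', hc.continuous_deriv, hc.hasFDerivAt⟩

/-- Differentiating χ produces R|y'| times a factor that decays at least like χ itself, since s ≤ 1
+ s²; so the derivative still absorbs (1+s)^q. -/
theorem exists_hasDerivAt_cutoff (q : ℕ) {R : ℝ} (hR : 0 ≤ R) {y : ℝ → Pos d} {w : Pos d} {t : ℝ}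
    (hy : HasDerivAt y w t) : ∃ c, HasDerivAt (fun t => cutoff q (R * ‖y t‖)) c t ∧
      |c| * (1 + R * ‖y t‖) ^ q ≤ 2 * q * 2 ^ q * (R * ‖w‖) := by
  have h1 := ((((hy.norm_sq).const_mul (R ^ 2)).const_add 1).pow q).inv
    (by positivity : (1 + R ^ 2 * ‖y t‖ ^ 2) ^ q ≠ 0)
  simp only [cutoff_eq]
  refine ⟨_, h1, ?_⟩
  set s := R * ‖y t‖ with hs
  have hs0 : 0 ≤ s := by positivity
  have e : R ^ 2 * ‖y t‖ ^ 2 = s ^ 2 := by rw [hs]; ring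
  have hi : |R ^ 2 * (2 * ⟪y t, w⟫)| ≤ 2 * s * (R * ‖w‖) := by
    rw [abs_mul, abs_mul, abs_of_nonneg (sq_nonneg R), abs_two]
    have := abs_real_inner_le_norm (y t) w
    calc R ^ 2 * (2 * |⟪y t, w⟫|) ≤ R ^ 2 * (2 * (‖y t‖ * ‖w‖)) := by gcongr
      _ = _ := by rw [hs]; ring
  have h2 := pow_mul_cutoff_le q hs0
  rw [cutoff] at h2
  rcases q with _ | q
  · simp
  rw [Pi.pow_apply, e, abs_div, abs_neg, abs_mul, abs_mul, Nat.abs_cast, Nat.add_sub_cancel]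
  have h3 : 0 < 1 + s ^ 2 := by positivity
  rw [abs_of_pos (pow_pos h3 _), abs_of_pos (pow_pos (pow_pos h3 _) _)]
  have h4 : s ≤ 1 + s ^ 2 := by nlinarith [sq_nonneg (s - 1)]
  calc ((q + 1 : ℕ) : ℝ) * (1 + s ^ 2) ^ q * |R ^ 2 * (2 * ⟪y t, w⟫)| / ((1 + s ^ 2) ^ (q + 1)) ^ 2 *
        (1 + s) ^ (q + 1)
      ≤ ((q + 1 : ℕ) : ℝ) * (1 + s ^ 2) ^ q * (2 * (1 + s ^ 2) * (R * ‖w‖)) /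
          ((1 + s ^ 2) ^ (q + 1)) ^ 2 * (1 + s) ^ (q + 1) := by
        gcongr
        exact hi.trans (by gcongr)
    _ = 2 * ((q + 1 : ℕ) : ℝ) * ((1 + s) ^ (q + 1) * ((1 + s ^ 2) ^ (q + 1))⁻¹) * (R * ‖w‖) := by
        field_simp
        ring
    _ ≤ _ := by gcongr

/-- Along two trajectories, the correction compensates the difference of the forces that are due
to the block. -/
theorem IsCorrector.exists_hasDerivAt (hc : IsCorrector K R h g H H' r B) (hK : 0 ≤ K)
    (hR : 0 ≤ R) (hh : 0 ≤ h) {A : ℝ} {x v x' v' : ℝ → Pos d} {f f' : Pos d} {t : ℝ}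
    (hx : HasDerivAt x (v t) t) (hv : HasDerivAt v f t) (hx' : HasDerivAt x' (v' t) t)
    (hv' : HasDerivAt v' f' t) (hf : ‖f‖ ≤ A) (hf' : ‖f'‖ ≤ A) :
    ∃ z, HasDerivAt (fun t => blockCorrection R H (x t, v t) (x' t, v' t)) z t ∧
      ‖g (x t) - g (x' t) - z‖ ≤
        K * (1 + A) * (2 ^ decayExp (Pos d) + decayExp (Pos d)) * (R * ‖x t - x' t‖) *
            (B (x t, v t) + B (x' t, v' t)) +
          K * (1 + 4 * decayExp (Pos d)) * 2 ^ decayExp (Pos d) * (h * R) * ‖v t - v' t‖ *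
            (B (x t, v t) + B (x' t, v' t)) := by
  set q := decayExp (Pos d) with hq
  obtain ⟨c, hc1, hc2⟩ := exists_hasDerivAt_cutoff q hR (hx.sub hx')
  have a1 := (hc.hasFDerivAt (x t, v t)).comp_hasDerivAt t (hx.prodMk hv)
  have a2 := (hc.hasFDerivAt (x' t, v t)).comp_hasDerivAt t (hx'.prodMk hv)
  have a3 := (hc.hasFDerivAt (x' t, v' t)).comp_hasDerivAt t (hx'.prodMk hv')
  have hd := (a1.sub (hc1.smul a2)).sub ((hc1.const_sub 1).smul a3)
  refine ⟨_, hd, ?_⟩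
  simp only [Pi.sub_apply, Function.comp_apply] at hc2 ⊢
  set X := x t
  set X' := x' t
  set V := v t
  set V' := v' t
  set χ := cutoff q (R * ‖X - X'‖) with hχ
  set s := R * ‖X - X'‖ with hs
  have hs0 : 0 ≤ s := by positivity
  have hq1 : 1 ≤ q := one_le_decayExp
  have hA : 0 ≤ A := (norm_nonneg f).trans hf
  have hB := hc.majorant_nonneg (X, V)
  have hB' := hc.majorant_nonneg (X', V')
  have t1 : H' (X, V) (V, f) = g X - r (X, V) + H' (X, V) (0, f) := by
    rw [← hc.transport (X, V), ← map_add]; simp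
  -- The intermediate point (X', V) moves in position with velocity V' and not V, so the transport
  -- identity leaves an error ∇ₓH · (V - V').
  have t2 : H' (X', V) (V', f) = g X' - r (X', V) - H' (X', V) (V - V', 0) + H' (X', V) (0, f) := by
    rw [← hc.transport (X', V), ← map_sub, ← map_add]; simp
  have t3 : H' (X', V') (V', f') = g X' - r (X', V') + H' (X', V') (0, f') := by
    rw [← hc.transport (X', V'), ← map_add]; simp
  -- The weights of the two terms at X' add up to 1, so g(X) - g(X') cancels. There remain
  -- three-point combinations of r and of the force terms, both O(R|X-X'|), the transport error, and
  -- the derivative c of the cutoff; the last two are O(hR|V-V'|).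
  have e : g X - g X' - (H' (X, V) (V, f) - (χ • H' (X', V) (V', f) + c • H (X', V)) -
      ((1 - χ) • H' (X', V') (V', f') + (-c) • H (X', V')))
      = (r (X, V) - χ • r (X', V) - (1 - χ) • r (X', V')) -
        (H' (X, V) (0, f) - χ • H' (X', V) (0, f) - (1 - χ) • H' (X', V') (0, f')) -
        χ • H' (X', V) (V - V', 0) + (c • H (X', V) - c • H (X', V')) := by
    rw [t1, t2, t3]
    module
  have b1 : ‖r (X, V) - χ • r (X', V) - (1 - χ) • r (X', V')‖
      ≤ K * (2 ^ q + q) * s * (B (X, V) + B (X', V')) := by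
    refine norm_threePoint_le hq1 hs0 hK hB hB' ?_ ?_ ?_
    · rw [hs, norm_sub_rev X X']
      exact hc.rem_sub_le X X' V
    · simpa using hc.rem_le X X V
    · simpa using hc.rem_le X' X' V'
  have b2 : ‖H' (X, V) (0, f) - χ • H' (X', V) (0, f) - (1 - χ) • H' (X', V') (0, f')‖
      ≤ K * A * (2 ^ q + q) * s * (B (X, V) + B (X', V')) := by
    refine norm_threePoint_le hq1 hs0 (by positivity) hB hB' ?_ ?_ ?_
    · refine (hc.snd_sub_le X X' V f).trans ?_
      rw [hs, norm_sub_rev X X']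
      gcongr
    · have := hc.snd_le X X V f
      simp only [sub_self, norm_zero, mul_zero, add_zero, one_pow, mul_one] at this
      exact this.trans (by gcongr)
    · have := hc.snd_le X' X' V' f'
      simp only [sub_self, norm_zero, mul_zero, add_zero, one_pow, mul_one] at this
      exact this.trans (by gcongr)
  have hχ0 : 0 < χ := cutoff_pos q s
  have b3 : ‖χ • H' (X', V) (V - V', 0)‖ ≤ K * (h * R) * ‖V - V'‖ * 2 ^ q * B (X, V) := by
    rw [norm_smul, Real.norm_of_nonneg hχ0.le]
    calc χ * ‖H' (X', V) (V - V', 0)‖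
        ≤ χ * (K * (h * R) * ‖V - V'‖ * (1 + s) ^ q * B (X, V)) := by
          gcongr
          rw [hs, norm_sub_rev X X']
          exact hc.fst_le X X' V (V - V')
      _ = K * (h * R) * ‖V - V'‖ * ((1 + s) ^ q * χ) * B (X, V) := by ring
      _ ≤ _ := by gcongr; exact pow_mul_cutoff_le q hs0
  have b4 : ‖c • H (X', V)‖ ≤ K * h * (2 * q * 2 ^ q * (R * ‖V - V'‖)) * B (X, V) := by
    rw [norm_smul, Real.norm_eq_abs]
    calc |c| * ‖H (X', V)‖ ≤ |c| * (K * h * (1 + s) ^ q * B (X, V)) := by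
          gcongr
          rw [hs, norm_sub_rev X X']
          exact hc.value_le X X' V
      _ = K * h * (|c| * (1 + s) ^ q) * B (X, V) := by ring
      _ ≤ _ := by gcongr
  have b5 : ‖c • H (X', V')‖ ≤ K * h * (2 * q * 2 ^ q * (R * ‖V - V'‖)) * B (X', V') := by
    rw [norm_smul, Real.norm_eq_abs]
    have h1 : |c| ≤ 2 * q * 2 ^ q * (R * ‖V - V'‖) :=
      (le_mul_of_one_le_right (abs_nonneg c) (one_le_pow₀ (by linarith))).trans hc2
    calc |c| * ‖H (X', V')‖ ≤ |c| * (K * h * B (X', V')) := by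
          gcongr
          simpa using hc.value_le X' X' V'
      _ = K * h * |c| * B (X', V') := by ring
      _ ≤ _ := by gcongr
  rw [e]
  refine (norm_add_le _ _).trans ?_
  have n1 := norm_sub_le ((r (X, V) - χ • r (X', V) - (1 - χ) • r (X', V')) -
        (H' (X, V) (0, f) - χ • H' (X', V) (0, f) - (1 - χ) • H' (X', V') (0, f')))
        (χ • H' (X', V) (V - V', 0))
  have n2 := norm_sub_le (r (X, V) - χ • r (X', V) - (1 - χ) • r (X', V'))
        (H' (X, V) (0, f) - χ • H' (X', V) (0, f) - (1 - χ) • H' (X', V') (0, f'))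
  have n3 := norm_sub_le (c • H (X', V)) (c • H (X', V'))
  have p1 : 0 ≤ K * (h * R) * ‖V - V'‖ * 2 ^ q := by positivity
  have p2 := mul_nonneg p1 hB'
  have p3 := mul_nonneg (mul_nonneg (Nat.cast_nonneg (α := ℝ) q) p1) hB'
  have p4 := mul_nonneg (mul_nonneg (Nat.cast_nonneg (α := ℝ) q) p1) hB
  nlinarith [n1, n2, n3, b1, b2, b3, b4, b5, p2, p3, p4]

end BlockCorrection

/-! ### Logarithmic energy estimate for the corrected difference -/

section Gronwall

open scoped RealInnerProductSpace

variable {d : ℕ}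

/-- The embedding of real vectors into complex ones. -/
noncomputable def complexL (d : ℕ) : Pos d →ₗᵢ[ℝ] CPos d where
  toFun y := WithLp.toLp 2 fun i => ((y i : ℝ) : ℂ)
  map_add' y z := by ext i; simp
  map_smul' c y := by ext i; simp
  norm_map' y := by simp [EuclideanSpace.norm_eq]

theorem complexify_eq (F : Pos d → Pos d) (y : Pos d) : complexify F y = complexL d (F y) := rfl

/-- Young's inequality. The square of M appears because M‖W‖ with ‖W‖ ≤ ‖w‖ + M‖Y‖ produces M²‖Y‖.
The term ε uses δ‖w‖ ≤ δ² + ‖w‖²: regularizing by δ² allows an unresolved force at the price 1/δ. -/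
theorem log_energy_deriv_le {E E' : Type*} [NormedAddCommGroup E] [InnerProductSpace ℝ E]
    [NormedAddCommGroup E'] [InnerProductSpace ℝ E'] {Y W : E} {w w' : E'} {δ M M1 ε : ℝ}
    (hδ : 0 < δ) (hM : 0 ≤ M) (hM1 : 0 ≤ M1) (hε : 0 ≤ ε) (hW : ‖W‖ ≤ ‖w‖ + M * ‖Y‖)
    (hw' : ‖w'‖ ≤ ε + M1 * ‖Y‖ + M * ‖W‖) :
    (2 * ⟪Y, W⟫ + 2 * ⟪w, w'⟫) / (δ ^ 2 + ‖Y‖ ^ 2 + ‖w‖ ^ 2)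
      ≤ 2 + 2 * M ^ 2 + M1 + 2 / δ * ε := by
  rw [div_le_iff₀ (by positivity)]
  have i1 := real_inner_le_norm Y W
  have i2 := real_inner_le_norm w w'
  have hy := norm_nonneg Y
  have hz := norm_nonneg w
  generalize ‖Y‖ = y at *
  generalize ‖w‖ = z at *
  have j1 : y * ‖W‖ ≤ y * (z + M * y) := by gcongr
  have j2 : z * ‖w'‖ ≤ z * (ε + M1 * y + M * (z + M * y)) := by
    refine mul_le_mul_of_nonneg_left (hw'.trans ?_) hz
    gcongr
  have hyz : 2 * (y * z) ≤ y ^ 2 + z ^ 2 := by nlinarith [sq_nonneg (y - z)]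
  have k1 : 2 * z * ε ≤ 2 / δ * ε * (δ ^ 2 + y ^ 2 + z ^ 2) := by
    have : z ≤ 1 / δ * (δ ^ 2 + y ^ 2 + z ^ 2) := by
      rw [one_div, le_inv_mul_iff₀ hδ]
      nlinarith [sq_nonneg (δ - z), sq_nonneg y, sq_nonneg z, sq_nonneg δ]
    calc 2 * z * ε ≤ 2 * (1 / δ * (δ ^ 2 + y ^ 2 + z ^ 2)) * ε := by gcongr
      _ = _ := by ring
  have k2 : M1 * (2 * (y * z)) ≤ M1 * (δ ^ 2 + y ^ 2 + z ^ 2) := by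
    gcongr; nlinarith [sq_nonneg δ]
  have k3 : M ^ 2 * (2 * (y * z)) ≤ M ^ 2 * (δ ^ 2 + y ^ 2 + z ^ 2) := by
    gcongr; nlinarith [sq_nonneg δ]
  have k4 : 2 * M * (y ^ 2 + z ^ 2) ≤ (1 + M ^ 2) * (δ ^ 2 + y ^ 2 + z ^ 2) := by
    have : 2 * M ≤ 1 + M ^ 2 := by nlinarith [sq_nonneg (M - 1)]
    have h2 : y ^ 2 + z ^ 2 ≤ δ ^ 2 + y ^ 2 + z ^ 2 := by nlinarith [sq_nonneg δ]
    gcongr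
  nlinarith [sq_nonneg δ]

variable {ι : Type*} {F : Pos d → Pos d} {x v x' v' : ℝ → Pos d} {A K : ℝ} {R h : ι → ℝ}
  {g : ι → Pos d → CPos d} {H : ι → Phase d → CPos d}
  {H' : ι → Phase d → Phase d →L[ℝ] CPos d} {r : ι → Phase d → CPos d} {B : ι → Phase d → ℝ}

/-- The velocity difference, corrected in all the blocks. -/
noncomputable def correctedDiff (s : Finset ι) (R : ι → ℝ) (H : ι → Phase d → CPos d)
    (P : Phase d × Phase d) : CPos d :=
  complexL d (P.1.2 - P.2.2) - ∑ j ∈ s, blockCorrection (R j) (H j) P.1 P.2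

/-- The regularized energy of the separation of two trajectories. -/
noncomputable def energy (s : Finset ι) (R : ι → ℝ) (H : ι → Phase d → CPos d) (δ : ℝ)
    (P : Phase d × Phase d) : ℝ :=
  δ ^ 2 + ‖P.1.1 - P.2.1‖ ^ 2 + ‖correctedDiff s R H P‖ ^ 2

/-- The constant in the estimates of the corrections. -/
noncomputable def correctionConst (d : ℕ) (K : ℝ) : ℝ :=
  K * (1 + 4 * decayExp (Pos d)) * 2 ^ decayExp (Pos d)

theorem correctionConst_nonneg (hK : 0 ≤ K) : 0 ≤ correctionConst d K := by
  unfold correctionConst; positivity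

theorem le_correctionConst (hK : 0 ≤ K) :
    K * (2 ^ decayExp (Pos d) + decayExp (Pos d)) ≤ correctionConst d K := by
  rw [correctionConst, mul_assoc]
  refine mul_le_mul_of_nonneg_left ?_ hK
  have : (1 : ℝ) ≤ 2 ^ decayExp (Pos d) := one_le_pow₀ one_le_two
  nlinarith [Nat.cast_nonneg (α := ℝ) (decayExp (Pos d))]

/-- The weighted sum of the majorants that controls the corrections. -/
noncomputable def lowMajorant (K : ℝ) (s : Finset ι) (R h : ι → ℝ) (B : ι → Phase d → ℝ)
    (p : Phase d) : ℝ :=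
  correctionConst d K * ∑ j ∈ s, h j * R j * B j p

/-- The weighted sum of the majorants that controls the derivatives of the corrections. -/
noncomputable def highMajorant (K A : ℝ) (s : Finset ι) (R : ι → ℝ) (B : ι → Phase d → ℝ)
    (p : Phase d) : ℝ :=
  correctionConst d K * (1 + A) * ∑ j ∈ s, R j * B j p

/-- The part of the force that is not resolved by the blocks. -/
noncomputable def unresolved (F : Pos d → Pos d) (s : Finset ι) (g : ι → Pos d → CPos d)
    (y : Pos d) : CPos d :=
  complexify F y - ∑ j ∈ s, g j y

theorem norm_le_correctedDiff (hK : 0 ≤ K) (s : Finset ι) (hR : ∀ j, 0 ≤ R j) (hh : ∀ j, 0 ≤ h j)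
    (hc : ∀ j, IsCorrector K (R j) (h j) (g j) (H j) (H' j) (r j) (B j))
    (P : Phase d × Phase d) :
    ‖complexL d (P.1.2 - P.2.2) - correctedDiff s R H P‖ ≤
      (lowMajorant K s R h B P.1 + lowMajorant K s R h B P.2) * ‖P.1.1 - P.2.1‖ := by
  rw [correctedDiff, sub_sub_cancel, lowMajorant, lowMajorant, ← mul_add, ← Finset.sum_add_distrib,
    Finset.mul_sum, Finset.sum_mul]
  refine norm_sum_le_of_le _ fun j _ => ((hc j).norm_blockCorrection_le hK (hR j) (hh j) _ _).trans ?_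
  have b1 := (hc j).majorant_nonneg P.1
  have b2 := (hc j).majorant_nonneg P.2
  have := hR j
  have := hh j
  calc K * h j * (2 ^ decayExp (Pos d) + decayExp (Pos d)) * (R j * ‖P.1.1 - P.2.1‖) *
        (B j P.1 + B j P.2)
      = K * (2 ^ decayExp (Pos d) + decayExp (Pos d)) *
        (h j * (R j * ‖P.1.1 - P.2.1‖) * (B j P.1 + B j P.2)) := by ring
    _ ≤ correctionConst d K * (h j * (R j * ‖P.1.1 - P.2.1‖) * (B j P.1 + B j P.2)) :=
        mul_le_mul_of_nonneg_right (le_correctionConst hK) (by positivity)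
    _ = _ := by ring

theorem contDiff_correctedDiff (s : Finset ι) (R : ι → ℝ) (hH : ∀ j, ContDiff ℝ 1 (H j)) :
    ContDiff ℝ 1 (correctedDiff s R H) := by
  have h1 : ContDiff ℝ 1 fun P : Phase d × Phase d => complexL d (P.1.2 - P.2.2) :=
    (complexL d).contDiff.comp (by fun_prop)
  exact h1.sub (ContDiff.sum fun j _ => contDiff_blockCorrection (R j) (hH j))

theorem contDiff_energy (s : Finset ι) (R : ι → ℝ) (hH : ∀ j, ContDiff ℝ 1 (H j)) (δ : ℝ) :
    ContDiff ℝ 1 (energy s R H δ) := by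
  have h1 : ContDiff ℝ 1 fun P : Phase d × Phase d => P.1.1 - P.2.1 := by fun_prop
  exact (contDiff_const.add (h1.norm_sq ℝ)).add ((contDiff_correctedDiff s R hH).norm_sq ℝ)

theorem energy_pos (s : Finset ι) (R : ι → ℝ) (H : ι → Phase d → CPos d) {δ : ℝ} (hδ : 0 < δ)
    (P : Phase d × Phase d) : 0 < energy s R H δ P := by
  unfold energy; positivity

/-- The force difference splits into the blocks, each compensated by the derivative of its
correction, and the unresolved part, which is bounded without using any cancellation. -/
theorem exists_hasDerivAt_correctedDiff (hK : 0 ≤ K) (s : Finset ι) (hR : ∀ j, 0 ≤ R j)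
    (hh : ∀ j, 0 ≤ h j) (hc : ∀ j, IsCorrector K (R j) (h j) (g j) (H j) (H' j) (r j) (B j))
    (hA : ∀ y, ‖F y‖ ≤ A) {t : ℝ}
    (hx : HasDerivAt x (v t) t) (hv : HasDerivAt v (F (x t)) t) (hx' : HasDerivAt x' (v' t) t)
    (hv' : HasDerivAt v' (F (x' t)) t) :
    ∃ z, HasDerivAt (fun t => correctedDiff s R H ((x t, v t), (x' t, v' t))) z t ∧
      ‖z‖ ≤ (‖unresolved F s g (x t)‖ + ‖unresolved F s g (x' t)‖) +
        (highMajorant K A s R B (x t, v t) + highMajorant K A s R B (x' t, v' t)) *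
          ‖x t - x' t‖ +
        (lowMajorant K s R h B (x t, v t) + lowMajorant K s R h B (x' t, v' t)) *
          ‖v t - v' t‖ := by
  choose z hz hzb using fun j => (hc j).exists_hasDerivAt hK (hR j) (hh j) hx hv hx' hv'
    (hA (x t)) (hA (x' t))
  have hA0 : 0 ≤ A := (norm_nonneg _).trans (hA (x t))
  have hd1 : HasDerivAt (fun t => complexL d (v t - v' t)) (complexL d (F (x t) - F (x' t))) t :=
    ((complexL d).toContinuousLinearMap.hasFDerivAt).comp_hasDerivAt t (hv.sub hv')
  have hd2 := hd1.sub (HasDerivAt.fun_sum (u := s) fun j _ => hz j)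
  refine ⟨_, hd2, ?_⟩
  have e : complexL d (F (x t) - F (x' t)) - ∑ j ∈ s, z j
      = (unresolved F s g (x t) - unresolved F s g (x' t)) +
        ∑ j ∈ s, (g j (x t) - g j (x' t) - z j) := by
    rw [unresolved, unresolved, complexify_eq, complexify_eq, map_sub, Finset.sum_sub_distrib,
      Finset.sum_sub_distrib]
    abel
  rw [e, add_assoc]
  refine (norm_add_le _ _).trans (add_le_add (norm_sub_le _ _) ?_)
  rw [lowMajorant, lowMajorant, highMajorant, highMajorant, ← mul_add, ← mul_add,
    ← Finset.sum_add_distrib, ← Finset.sum_add_distrib, Finset.mul_sum, Finset.mul_sum,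
    Finset.sum_mul, Finset.sum_mul, ← Finset.sum_add_distrib]
  refine norm_sum_le_of_le _ fun j _ => (hzb j).trans ?_
  have b1 := (hc j).majorant_nonneg (x t, v t)
  have b2 := (hc j).majorant_nonneg (x' t, v' t)
  have := hR j
  have := hh j
  have k := mul_le_mul_of_nonneg_right (le_correctionConst (d := d) hK) (show 0 ≤ (1 + A) *
    (R j * ‖x t - x' t‖) * (B j (x t, v t) + B j (x' t, v' t)) by positivity)
  rw [← correctionConst]
  linarith

/-- The rate of growth of the logarithm of the energy. -/
noncomputable def growthRate (K A : ℝ) (F : Pos d → Pos d) (s : Finset ι) (R h : ι → ℝ)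
    (g : ι → Pos d → CPos d) (B : ι → Phase d → ℝ) (δ : ℝ) (p p' : Phase d) : ℝ :=
  2 + 2 * (lowMajorant K s R h B p + lowMajorant K s R h B p') ^ 2 +
    (highMajorant K A s R B p + highMajorant K A s R B p') +
    2 / δ * (‖unresolved F s g p.1‖ + ‖unresolved F s g p'.1‖)

theorem lowMajorant_nonneg (hK : 0 ≤ K) (s : Finset ι) (hR : ∀ j, 0 ≤ R j) (hh : ∀ j, 0 ≤ h j)
    (hB : ∀ j p, 0 ≤ B j p) (p : Phase d) : 0 ≤ lowMajorant K s R h B p :=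
  mul_nonneg (correctionConst_nonneg hK)
    (Finset.sum_nonneg fun j _ => mul_nonneg (mul_nonneg (hh j) (hR j)) (hB j p))

theorem highMajorant_nonneg (hK : 0 ≤ K) (hA : 0 ≤ A) (s : Finset ι) (hR : ∀ j, 0 ≤ R j)
    (hB : ∀ j p, 0 ≤ B j p) (p : Phase d) : 0 ≤ highMajorant K A s R B p :=
  mul_nonneg (mul_nonneg (correctionConst_nonneg hK) (by positivity))
    (Finset.sum_nonneg fun j _ => mul_nonneg (hR j) (hB j p))

theorem continuous_lowMajorant (s : Finset ι) (hB : ∀ j, Continuous (B j)) :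
    Continuous (lowMajorant K s R h B) :=
  continuous_const.mul (continuous_finsetSum _ fun j _ => continuous_const.mul (hB j))

theorem continuous_highMajorant (s : Finset ι) (hB : ∀ j, Continuous (B j)) :
    Continuous (highMajorant K A s R B) :=
  continuous_const.mul (continuous_finsetSum _ fun j _ => continuous_const.mul (hB j))

theorem IsNewtonTrajectory.intervalIntegrable_unresolved (hn : IsNewtonTrajectory F x v)
    (s : Finset ι) (hg : ∀ j, Continuous (g j)) (T : ℝ) :
    IntervalIntegrable (fun t => unresolved F s g (x t)) volume 0 T := by
  have h1 : IntervalIntegrable (fun t => complexL d (F (x t))) volume 0 T :=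
    ⟨(complexL d).toContinuousLinearMap.integrable_comp (hn.force_integrable T).1,
      (complexL d).toContinuousLinearMap.integrable_comp (hn.force_integrable T).2⟩
  have hxc := hn.continuous_position
  have h2 : Continuous fun t => ∑ j ∈ s, g j (x t) :=
    continuous_finsetSum _ fun j _ => (hg j).comp hxc
  exact h1.sub (h2.intervalIntegrable 0 T)

theorem energy_le (hA : ∀ y, ‖F y‖ ≤ A) (hK : 0 ≤ K) (s : Finset ι) (hR : ∀ j, 0 ≤ R j)
    (hh : ∀ j, 0 ≤ h j) (hc : ∀ j, IsCorrector K (R j) (h j) (g j) (H j) (H' j) (r j) (B j))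
    (hg : ∀ j, Continuous (g j)) {δ : ℝ} (hδ : 0 < δ) {T : ℝ} (hT : 0 ≤ T)
    (hn : IsNewtonTrajectory F x v) (hn' : IsNewtonTrajectory F x' v') :
    IntervalIntegrable (fun t => growthRate K A F s R h g B δ (x t, v t) (x' t, v' t)) volume 0 T ∧
    Real.log (energy s R H δ ((x T, v T), (x' T, v' T))) -
      Real.log (energy s R H δ ((x 0, v 0), (x' 0, v' 0))) ≤
        ∫ t in (0 : ℝ)..T, growthRate K A F s R h g B δ (x t, v t) (x' t, v' t) := by
  have hA0 : 0 ≤ A := (norm_nonneg _).trans (hA 0)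
  have hB := fun j => (hc j).continuous_majorant
  have hB0 := fun j => (hc j).majorant_nonneg
  have hp : Continuous fun t => (x t, v t) :=
    hn.continuous_position.prodMk (hn.lipschitzWith_velocity hA).continuous
  have hp' : Continuous fun t => (x' t, v' t) :=
    hn'.continuous_position.prodMk (hn'.lipschitzWith_velocity hA).continuous
  have hi : IntervalIntegrable
      (fun t => growthRate K A F s R h g B δ (x t, v t) (x' t, v' t)) volume 0 T := by
    have c1 := (continuous_lowMajorant (K := K) (R := R) (h := h) s hB).comp hp
    have c2 := (continuous_lowMajorant (K := K) (R := R) (h := h) s hB).comp hp'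
    have c3 := (continuous_highMajorant (K := K) (A := A) (R := R) s hB).comp hp
    have c4 := (continuous_highMajorant (K := K) (A := A) (R := R) s hB).comp hp'
    have c5 := (continuous_const (y := (2 : ℝ))).add (continuous_const (y := (2 : ℝ)) |>.mul
      ((c1.add c2).pow 2)) |>.add (c3.add c4)
    exact (c5.intervalIntegrable 0 T).add (((hn.intervalIntegrable_unresolved s hg T).norm.add
      (hn'.intervalIntegrable_unresolved s hg T).norm).const_mul (2 / δ))
  refine ⟨hi, ?_⟩
  obtain ⟨K1, hK1⟩ := hn.exists_lipschitzOnWith hA 0 T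
  obtain ⟨K2, hK2⟩ := hn'.exists_lipschitzOnWith hA 0 T
  have hΨ : ContDiff ℝ 1 fun P => Real.log (energy s R H δ P) :=
    (contDiff_energy s R (fun j => (hc j).contDiff) δ).log fun P => (energy_pos s R H hδ P).ne'
  refine sub_le_integral_of_ae_hasDerivAt (γ := fun t => ((x t, v t), (x' t, v' t))) hΨ hT
    (hK1.prodMk hK2) hi ?_
  filter_upwards [hn.ae_hasDerivAt_velocity T, hn'.ae_hasDerivAt_velocity T] with t h1 h2 ht
  rw [uIcc_of_le hT] at h1 h2
  obtain ⟨z, hz, hzb⟩ := exists_hasDerivAt_correctedDiff hK s hR hh hc hA (hn.position t) (h1 ht)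
    (hn'.position t) (h2 ht)
  have hE : HasDerivAt (fun t => energy s R H δ ((x t, v t), (x' t, v' t)))
      (2 * ⟪x t - x' t, v t - v' t⟫ +
        2 * ⟪correctedDiff s R H ((x t, v t), (x' t, v' t)), z⟫) t :=
    ((((hn.position t).sub (hn'.position t)).norm_sq).const_add _).add hz.norm_sq
  refine ⟨_, hE.log (energy_pos s R H hδ _).ne', ?_⟩
  refine log_energy_deriv_le hδ
    (add_nonneg (lowMajorant_nonneg hK s hR hh hB0 _) (lowMajorant_nonneg hK s hR hh hB0 _))
    (add_nonneg (highMajorant_nonneg hK hA0 s hR hB0 _) (highMajorant_nonneg hK hA0 s hR hB0 _))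
    (by positivity) ?_ hzb
  have := norm_le_correctedDiff hK s hR hh hc ((x t, v t), (x' t, v' t))
  have h3 := norm_le_norm_add_norm_sub' (complexL d (v t - v' t))
    (correctedDiff s R H ((x t, v t), (x' t, v' t)))
  rw [LinearIsometry.norm_map] at h3
  exact h3.trans (add_le_add_right this _)

end Gronwall

/-! ### From the energy to the logarithmic separation -/

section LogSeparation

variable {d : ℕ} {ι : Type*} {F : Pos d → Pos d} {x v x' v' : ℝ → Pos d} {A K : ℝ} {R h : ι → ℝ}
  {g : ι → Pos d → CPos d} {H : ι → Phase d → CPos d}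
  {H' : ι → Phase d → Phase d →L[ℝ] CPos d} {r : ι → Phase d → CPos d} {B : ι → Phase d → ℝ}

/-- The density along a trajectory that controls the separation from another one. -/
noncomputable def separationDensity (K A : ℝ) (F : Pos d → Pos d) (s : Finset ι) (R h : ι → ℝ)
    (g : ι → Pos d → CPos d) (B : ι → Phase d → ℝ) (δ : ℝ) (p : Phase d) : ℝ :=
  8 * lowMajorant K s R h B p ^ 2 + highMajorant K A s R B p + 2 / δ * ‖unresolved F s g p.1‖

/-- Initially the corrected difference is at most (1 + M)δ, and (1 + M)² ≤ 2 + 2M². The correction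
at time 0 is what brings the initial values of the majorant into the final bound. -/
theorem energy_zero_le {s : Finset ι} {δ M : ℝ} (hM : 0 ≤ M) {P : Phase d × Phase d}
    (h1 : ‖P.1.1 - P.2.1‖ ≤ δ) (h2 : ‖P.1.2 - P.2.2‖ ≤ δ)
    (hW : ‖complexL d (P.1.2 - P.2.2) - correctedDiff s R H P‖ ≤ M * ‖P.1.1 - P.2.1‖) :
    energy s R H δ P ≤ δ ^ 2 * (4 + 2 * M ^ 2) := by
  have hδ : 0 ≤ δ := (norm_nonneg _).trans h1
  have h3 := norm_le_norm_add_norm_sub (complexL d (P.1.2 - P.2.2)) (correctedDiff s R H P)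
  rw [LinearIsometry.norm_map] at h3
  have h4 : ‖correctedDiff s R H P‖ ≤ δ + M * δ :=
    h3.trans (add_le_add h2 (hW.trans (by gcongr)))
  have h5 := pow_le_pow_left₀ (norm_nonneg _) h4 2
  have h6 := pow_le_pow_left₀ (norm_nonneg _) h1 2
  unfold energy
  nlinarith [sq_nonneg (M - 1), mul_nonneg (sq_nonneg δ) (sq_nonneg (M - 1))]

/-- The energy bounds |X-X'|² at every time. The velocities are recovered from w at the cost of
L²|X-X'|², with L the low majorant, which is controlled only after integration in time; this is why
the functional has a supremum for positions and a time integral for velocities. The logarithm of the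
resulting product is split, and its two polynomial factors are bounded by log y ≤ y - 1. -/
theorem log_separation_le (hA : ∀ y, ‖F y‖ ≤ A) (hK : 0 ≤ K) (s : Finset ι) (hR : ∀ j, 0 ≤ R j)
    (hh : ∀ j, 0 ≤ h j) (hc : ∀ j, IsCorrector K (R j) (h j) (g j) (H j) (H' j) (r j) (B j))
    (hg : ∀ j, Continuous (g j)) {δ : ℝ} (hδ : 0 < δ) {T : ℝ} (hT : 0 ≤ T)
    (hn : IsNewtonTrajectory F x v) (hn' : IsNewtonTrajectory F x' v')
    (hx0 : ‖x 0 - x' 0‖ ≤ δ) (hv0 : ‖v 0 - v' 0‖ ≤ δ) :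
    Real.log (1 + 1 / δ ^ 2 * (sSup ((fun t => ‖x t - x' t‖ ^ 2) '' Icc 0 T) +
        ∫ t in (0 : ℝ)..T, ‖v t - v' t‖ ^ 2)) ≤
      4 + 4 * T + 4 * lowMajorant K s R h B (x 0, v 0) ^ 2 +
        4 * lowMajorant K s R h B (x' 0, v' 0) ^ 2 +
        ((∫ t in (0 : ℝ)..T, separationDensity K A F s R h g B δ (x t, v t)) +
          ∫ t in (0 : ℝ)..T, separationDensity K A F s R h g B δ (x' t, v' t)) := by
  have hA0 : 0 ≤ A := (norm_nonneg _).trans (hA 0)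
  have hB := fun j => (hc j).continuous_majorant
  have hB0 := fun j => (hc j).majorant_nonneg
  have hp : Continuous fun t => (x t, v t) :=
    hn.continuous_position.prodMk (hn.lipschitzWith_velocity hA).continuous
  have hp' : Continuous fun t => (x' t, v' t) :=
    hn'.continuous_position.prodMk (hn'.lipschitzWith_velocity hA).continuous
  set L := lowMajorant K s R h B with hL
  have hL0 : ∀ p, 0 ≤ L p := lowMajorant_nonneg hK s hR hh hB0
  have hH0 : ∀ p, 0 ≤ highMajorant K A s R B p := highMajorant_nonneg hK hA0 s hR hB0
  have hLc := continuous_lowMajorant (K := K) (R := R) (h := h) s hB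
  have hHc := continuous_highMajorant (K := K) (A := A) (R := R) s hB
  have c1 := hLc.comp hp
  have c2 := hLc.comp hp'
  have c3 := hHc.comp hp
  have c4 := hHc.comp hp'
  simp only [Function.comp_def, ← hL] at c1 c2 c3 c4
  set m := fun t => growthRate K A F s R h g B δ (x t, v t) (x' t, v' t) with hm
  have hm0 : ∀ t, 0 ≤ m t := fun t => by
    have := hL0 (x t, v t)
    have := hL0 (x' t, v' t)
    have := hH0 (x t, v t)
    have := hH0 (x' t, v' t)
    simp only [hm, growthRate]
    positivity
  set N := fun t => energy s R H δ ((x t, v t), (x' t, v' t)) with hN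
  have hNpos : ∀ t, 0 < N t := fun t => energy_pos s R H hδ _
  set I := ∫ t in (0 : ℝ)..T, m t with hI
  have hmi : IntervalIntegrable m volume 0 T :=
    (energy_le hA hK s hR hh hc hg hδ hT hn hn').1
  have hI0 : 0 ≤ I := intervalIntegral.integral_nonneg hT fun t _ => hm0 t
  set U := N 0 * Real.exp I with hU
  have hNt : ∀ t ∈ Icc 0 T, N t ≤ U := by
    intro t ht
    have h1 := (energy_le hA hK s hR hh hc hg hδ ht.1 hn hn').2
    have h2 : ∫ r in (0 : ℝ)..t, m r ≤ I :=
      intervalIntegral.integral_mono_interval le_rfl ht.1 ht.2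
        (Filter.Eventually.of_forall hm0) hmi
    have h3 : Real.log (N t) ≤ Real.log (N 0) + I := by linarith
    rw [hU, ← Real.log_le_log_iff (hNpos t) (mul_pos (hNpos 0) (Real.exp_pos _)),
      Real.log_mul (hNpos 0).ne' (Real.exp_pos _).ne', Real.log_exp]
    exact h3
  have hY : ∀ t ∈ Icc 0 T, ‖x t - x' t‖ ^ 2 ≤ U := fun t ht => by
    refine le_trans ?_ (hNt t ht)
    simp only [hN, energy]
    nlinarith [sq_nonneg δ, sq_nonneg ‖correctedDiff s R H ((x t, v t), (x' t, v' t))‖]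
  set Q := fun t => (L (x t, v t) + L (x' t, v' t)) ^ 2 with hQ
  have hQc : Continuous Q := (c1.add c2).pow 2
  have hW : ∀ t ∈ Icc 0 T, ‖v t - v' t‖ ^ 2 ≤ (2 + 2 * Q t) * U := fun t ht => by
    have h1 := norm_le_correctedDiff hK s hR hh hc ((x t, v t), (x' t, v' t))
    have h2 := norm_le_norm_add_norm_sub' (complexL d (v t - v' t))
      (correctedDiff s R H ((x t, v t), (x' t, v' t)))
    rw [LinearIsometry.norm_map] at h2
    have h3 := h2.trans (add_le_add_right h1 _)
    have h4 := pow_le_pow_left₀ (norm_nonneg _) h3 2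
    have h5 := hY t ht
    have h6 : ‖correctedDiff s R H ((x t, v t), (x' t, v' t))‖ ^ 2 ≤ U := by
      refine le_trans ?_ (hNt t ht)
      simp only [hN, energy]
      nlinarith [sq_nonneg δ, sq_nonneg ‖x t - x' t‖]
    have h7 : Q t * ‖x t - x' t‖ ^ 2 ≤ Q t * U := mul_le_mul_of_nonneg_left h5 (sq_nonneg _)
    have h8 : ∀ a b : ℝ, (a + b) ^ 2 ≤ 2 * a ^ 2 + 2 * b ^ 2 := fun a b => by
      nlinarith [sq_nonneg (a - b)]
    have h9 := h8 ‖correctedDiff s R H ((x t, v t), (x' t, v' t))‖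
      ((L (x t, v t) + L (x' t, v' t)) * ‖x t - x' t‖)
    have h10 : ((L (x t, v t) + L (x' t, v' t)) * ‖x t - x' t‖) ^ 2 = Q t * ‖x t - x' t‖ ^ 2 :=
      mul_pow _ _ 2
    linarith
  have hS : sSup ((fun t => ‖x t - x' t‖ ^ 2) '' Icc 0 T) ≤ U :=
    csSup_le ((nonempty_Icc.2 hT).image _) (by rintro _ ⟨t, ht, rfl⟩; exact hY t ht)
  have hS0 : 0 ≤ sSup ((fun t => ‖x t - x' t‖ ^ 2) '' Icc 0 T) :=
    Real.sSup_nonneg (by rintro _ ⟨t, -, rfl⟩; positivity)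
  have hvc : Continuous fun t => ‖v t - v' t‖ ^ 2 :=
    (((hn.lipschitzWith_velocity hA).continuous).sub
      (hn'.lipschitzWith_velocity hA).continuous).norm.pow 2
  have hWi : ∫ t in (0 : ℝ)..T, ‖v t - v' t‖ ^ 2 ≤ (2 * T + 2 * ∫ t in (0 : ℝ)..T, Q t) * U := by
    have h1 : Continuous fun t => (2 + 2 * Q t) * U := by fun_prop
    refine (intervalIntegral.integral_mono_on hT (hvc.intervalIntegrable 0 T)
      (h1.intervalIntegrable 0 T) hW).trans (le_of_eq ?_)
    rw [intervalIntegral.integral_mul_const, intervalIntegral.integral_add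
      (continuous_const.intervalIntegrable 0 T) ((hQc.const_mul 2).intervalIntegrable 0 T),
      intervalIntegral.integral_const_mul, intervalIntegral.integral_const]
    simp only [sub_zero, smul_eq_mul]
    ring
  have hW0 : 0 ≤ ∫ t in (0 : ℝ)..T, ‖v t - v' t‖ ^ 2 :=
    intervalIntegral.integral_nonneg hT fun t _ => by positivity
  have hQ0 : 0 ≤ ∫ t in (0 : ℝ)..T, Q t :=
    intervalIntegral.integral_nonneg hT fun t _ => sq_nonneg _
  set q := ∫ t in (0 : ℝ)..T, Q t with hq
  have hN0 : N 0 ≤ δ ^ 2 * (4 + 2 * Q 0) :=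
    energy_zero_le (add_nonneg (hL0 _) (hL0 _)) hx0 hv0
      (norm_le_correctedDiff hK s hR hh hc ((x 0, v 0), (x' 0, v' 0)))
  have hN0' : δ ^ 2 ≤ N 0 := by
    simp only [hN, energy]
    nlinarith [sq_nonneg ‖x 0 - x' 0‖, sq_nonneg ‖correctedDiff s R H ((x 0, v 0), (x' 0, v' 0))‖]
  have hQ00 : 0 ≤ Q 0 := sq_nonneg _
  have hδ2 : 0 < δ ^ 2 := by positivity
  have hUδ : δ ^ 2 ≤ U := by
    have := mul_le_mul hN0' (Real.one_le_exp hI0) zero_le_one (hNpos 0).le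
    simpa using this
  have harg : 1 + 1 / δ ^ 2 * (sSup ((fun t => ‖x t - x' t‖ ^ 2) '' Icc 0 T) +
        ∫ t in (0 : ℝ)..T, ‖v t - v' t‖ ^ 2)
      ≤ (4 + 2 * Q 0) * Real.exp I * (2 + 2 * T + 2 * q) := by
    have h1 : 1 + 1 / δ ^ 2 * (sSup ((fun t => ‖x t - x' t‖ ^ 2) '' Icc 0 T) +
        ∫ t in (0 : ℝ)..T, ‖v t - v' t‖ ^ 2) ≤ 1 / δ ^ 2 * U * (2 + 2 * T + 2 * q) := by
      have : 1 ≤ 1 / δ ^ 2 * U := by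
        rw [one_div, le_inv_mul_iff₀ hδ2]; simpa using hUδ
      calc _ ≤ 1 / δ ^ 2 * U + 1 / δ ^ 2 * (U + (2 * T + 2 * q) * U) := by gcongr
        _ = _ := by ring
    refine h1.trans (mul_le_mul_of_nonneg_right ?_ (by positivity))
    rw [hU, ← mul_assoc]
    refine mul_le_mul_of_nonneg_right ?_ (Real.exp_pos _).le
    rw [one_div, inv_mul_le_iff₀ hδ2]
    exact hN0
  have hlog : Real.log (1 + 1 / δ ^ 2 * (sSup ((fun t => ‖x t - x' t‖ ^ 2) '' Icc 0 T) +
        ∫ t in (0 : ℝ)..T, ‖v t - v' t‖ ^ 2)) ≤ (3 + 2 * Q 0) + I + (1 + 2 * T + 2 * q) := by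
    refine (Real.log_le_log (by positivity) harg).trans ?_
    rw [Real.log_mul (by positivity) (by positivity), Real.log_mul (by positivity)
      (by positivity), Real.log_exp]
    have h1 := Real.log_le_sub_one_of_pos (show 0 < 4 + 2 * Q 0 by positivity)
    have h2 := Real.log_le_sub_one_of_pos (show 0 < 2 + 2 * T + 2 * q by positivity)
    linarith
  have hsq : ∀ a b : ℝ, (a + b) ^ 2 ≤ 2 * a ^ 2 + 2 * b ^ 2 := fun a b => by
    nlinarith [sq_nonneg (a - b)]
  have hd : ∀ {y w : ℝ → Pos d}, IsNewtonTrajectory F y w → (Continuous fun t => L (y t, w t)) →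
      (Continuous fun t => highMajorant K A s R B (y t, w t)) → IntervalIntegrable
        (fun t => separationDensity K A F s R h g B δ (y t, w t)) volume 0 T :=
    fun hy k1 k2 => ((((k1.pow 2).const_mul 8).add k2).intervalIntegrable 0 T).add
      ((hy.intervalIntegrable_unresolved s hg T).norm.const_mul _)
  have hd1 := hd hn c1 c3
  have hd2 := hd hn' c2 c4
  -- The rate contains 2 Q and the velocity integral contributes 2 Q more; since (L+L')² ≤ 2L² +
  -- 2L'², this gives the 8 in `separationDensity`.
  have hfin : 2 * q + I ≤ 2 * T +
      ((∫ t in (0 : ℝ)..T, separationDensity K A F s R h g B δ (x t, v t)) +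
        ∫ t in (0 : ℝ)..T, separationDensity K A F s R h g B δ (x' t, v' t)) := by
    have hT2 : 2 * T = ∫ _t in (0 : ℝ)..T, (2 : ℝ) := by simp [mul_comm]
    rw [hq, hI, hT2, ← intervalIntegral.integral_const_mul, ← intervalIntegral.integral_add
      ((hQc.const_mul 2).intervalIntegrable 0 T) hmi, ← intervalIntegral.integral_add hd1 hd2,
      ← intervalIntegral.integral_add (continuous_const.intervalIntegrable 0 T) (hd1.add hd2)]
    refine intervalIntegral.integral_mono_on hT
      (((hQc.const_mul 2).intervalIntegrable 0 T).add hmi)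
      ((continuous_const.intervalIntegrable 0 T).add (hd1.add hd2)) fun t _ => ?_
    have := hsq (L (x t, v t)) (L (x' t, v' t))
    simp only [hm, hQ, growthRate, separationDensity, ← hL]
    nlinarith
  have := hsq (L (x 0, v 0)) (L (x' 0, v' 0))
  simp only [hQ] at hlog
  linarith

end LogSeparation

/-! ### Crude logarithmic bound -/

section CrudeBound

variable {d : ℕ} {F : Pos d → Pos d} {x v x' v' : ℝ → Pos d} {A : ℝ}

/-- Two trajectories that start at distance `δ` separate at most at a linear rate. -/
theorem log_separation_le_log (hA : ∀ y, ‖F y‖ ≤ A) {δ : ℝ} (hδ : 0 < δ)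
    (hδ1 : 1 ≤ Real.log (1 / δ)) {T : ℝ} (hT : 0 ≤ T)
    (hn : IsNewtonTrajectory F x v) (hn' : IsNewtonTrajectory F x' v')
    (hx0 : ‖x 0 - x' 0‖ ≤ δ) (hv0 : ‖v 0 - v' 0‖ ≤ δ) :
    Real.log (1 + 1 / δ ^ 2 * (sSup ((fun t => ‖x t - x' t‖ ^ 2) '' Icc 0 T) +
        ∫ t in (0 : ℝ)..T, ‖v t - v' t‖ ^ 2)) ≤
      (2 + (1 + T) * ((1 + T) * (1 + 2 * A * T)) ^ 2) * Real.log (1 / δ) := by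
  have hA0 : 0 ≤ A := (norm_nonneg _).trans (hA 0)
  have hδle : δ ≤ 1 := by
    by_contra! h
    have := Real.log_nonpos (by positivity) ((div_le_one hδ).2 h.le)
    linarith
  set Γ := (1 + T) * (1 + 2 * A * T) with hΓ
  have hΓ1 : 1 + 2 * A * T ≤ Γ := by
    rw [hΓ]; nlinarith [mul_nonneg hT (show 0 ≤ 1 + 2 * A * T by positivity)]
  have hV : ∀ t ∈ Icc 0 T, ‖v t - v' t‖ ≤ 1 + 2 * A * T := fun t ht => by
    have h1 := hn.norm_velocity_sub_le hA 0 t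
    have h2 := hn'.norm_velocity_sub_le hA 0 t
    rw [sub_zero, abs_of_nonneg ht.1] at h1 h2
    have e : v t - v' t = (v 0 - v' 0) + (v t - v 0) - (v' t - v' 0) := by abel
    have h3 := norm_sub_le ((v 0 - v' 0) + (v t - v 0)) (v' t - v' 0)
    have h4 := norm_add_le (v 0 - v' 0) (v t - v 0)
    have h5 : A * t ≤ A * T := mul_le_mul_of_nonneg_left ht.2 hA0
    rw [e]
    linarith
  have hX : ∀ t ∈ Icc 0 T, ‖x t - x' t‖ ≤ Γ := fun t ht => by
    have h1 : ‖(x t - x' t) - (x 0 - x' 0)‖ ≤ (1 + 2 * A * T) * (t - 0) := by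
      refine norm_image_sub_le_of_norm_deriv_le_segment' (f := fun t => x t - x' t)
        (f' := fun t => v t - v' t) (a := 0) (b := T) (fun s _ =>
          ((hn.position s).sub (hn'.position s)).hasDerivWithinAt)
        (fun s hs => hV s (Ico_subset_Icc_self hs)) t ht
    have h2 := norm_le_norm_add_norm_sub' (x t - x' t) (x 0 - x' 0)
    have h3 : (1 + 2 * A * T) * (t - 0) ≤ (1 + 2 * A * T) * T := by
      gcongr; linarith [ht.2]
    have h4 : 0 ≤ 2 * A * T := by positivity
    rw [hΓ]
    linarith
  have hS : sSup ((fun t => ‖x t - x' t‖ ^ 2) '' Icc 0 T) ≤ Γ ^ 2 :=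
    csSup_le ((nonempty_Icc.2 hT).image _) (by
      rintro _ ⟨t, ht, rfl⟩; exact pow_le_pow_left₀ (norm_nonneg _) (hX t ht) 2)
  have hS0 : 0 ≤ sSup ((fun t => ‖x t - x' t‖ ^ 2) '' Icc 0 T) :=
    Real.sSup_nonneg (by rintro _ ⟨t, -, rfl⟩; positivity)
  have hvc : Continuous fun t => ‖v t - v' t‖ ^ 2 :=
    (((hn.lipschitzWith_velocity hA).continuous).sub
      (hn'.lipschitzWith_velocity hA).continuous).norm.pow 2
  have hW : ∫ t in (0 : ℝ)..T, ‖v t - v' t‖ ^ 2 ≤ T * Γ ^ 2 := by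
    refine (intervalIntegral.integral_mono_on hT (hvc.intervalIntegrable 0 T)
      (continuous_const.intervalIntegrable 0 T) fun t ht =>
        pow_le_pow_left₀ (norm_nonneg _) ((hV t ht).trans hΓ1) 2).trans (le_of_eq ?_)
    simp
  have hW0 : 0 ≤ ∫ t in (0 : ℝ)..T, ‖v t - v' t‖ ^ 2 :=
    intervalIntegral.integral_nonneg hT fun t _ => by positivity
  have hδ2 : 1 ≤ 1 / δ ^ 2 := by
    rw [le_div_iff₀ (by positivity), one_mul]
    exact pow_le_one₀ hδ.le hδle
  set a := (1 + T) * Γ ^ 2 with ha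
  have ha0 : 0 ≤ a := by positivity
  -- As δ ≤ 1, the summand 1 is absorbed into 1/δ²; the logarithm is then 2 log(1/δ) plus a
  -- constant, which the assumption log(1/δ) ≥ 1 absorbs.
  have h1 : 1 + 1 / δ ^ 2 * (sSup ((fun t => ‖x t - x' t‖ ^ 2) '' Icc 0 T) +
        ∫ t in (0 : ℝ)..T, ‖v t - v' t‖ ^ 2) ≤ (1 / δ) ^ 2 * (1 + a) := by
    calc _ ≤ 1 / δ ^ 2 + 1 / δ ^ 2 * (Γ ^ 2 + T * Γ ^ 2) := by gcongr
      _ = _ := by rw [ha]; ring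
  refine (Real.log_le_log (by positivity) h1).trans ?_
  rw [Real.log_mul (by positivity) (by positivity), Real.log_pow]
  have h2 := Real.log_le_sub_one_of_pos (show 0 < 1 + a by positivity)
  push_cast
  nlinarith

end CrudeBound

/-! ### Flows -/

section Flows

open Filter Topology

variable {d : ℕ} {F F₀ : Pos d → Pos d} {S : ℝ → Phase d → Phase d} {A : ℝ}

theorem IsNewtonTrajectory.continuous_velocity {x v : ℝ → Pos d} (h : IsNewtonTrajectory F x v) :
    Continuous v := by
  have h1 := intervalIntegral.continuous_primitive (μ := volume) (f := fun s => F (x s))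
    (fun a b => (h.force_integrable a).symm.trans (h.force_integrable b)) 0
  rw [show v = fun t => v 0 + ∫ s in (0 : ℝ)..t, F (x s) from funext h.velocity]
  exact continuous_const.add h1

theorem IsNewtonTrajectory.congr {x v : ℝ → Pos d} (h : IsNewtonTrajectory F x v)
    (he : ∀ᵐ t, F (x t) = F₀ (x t)) : IsNewtonTrajectory F₀ x v where
  position := h.position
  force_integrable t := (h.force_integrable t).congr_ae (ae_restrict_of_ae he)
  velocity t := by
    rw [h.velocity t]
    congr 1
    exact intervalIntegral.integral_congr_ae (he.mono fun t ht _ => ht)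

/-- A flow of trajectories has a jointly measurable version. -/
theorem exists_measurable_version (hS : SolvesNewton F S) (hH : IsHamiltonianFlow S) :
    ∃ S' : ℝ → Phase d → Phase d, Measurable (Function.uncurry S') ∧
      (∀ ξ, Continuous fun t => S' t ξ) ∧ ∀ᵐ ξ, ∀ t, S' t ξ = S t ξ := by
  obtain ⟨Z, hZ, hZm, hZ0⟩ := exists_measurable_superset_of_null (ae_iff.1 hS)
  classical
  have hgood : ∀ ξ, ξ ∉ Z → IsNewtonTrajectory F (fun t => (S t ξ).1) (fun t => (S t ξ).2) :=
    fun ξ hξ => by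
      by_contra h
      exact hξ (hZ h)
  have hc : ∀ ξ, Continuous fun t => Z.piecewise (fun _ => (0 : Phase d)) (S t) ξ := fun ξ => by
    by_cases hξ : ξ ∈ Z
    · simp only [piecewise_eq_of_mem _ _ _ hξ]
      exact continuous_const
    · simp only [piecewise_eq_of_notMem _ _ _ hξ]
      exact (hgood ξ hξ).continuous_position.prodMk (hgood ξ hξ).continuous_velocity
  have hm : ∀ t, Measurable (Z.piecewise (fun _ => (0 : Phase d)) (S t)) := fun t =>
    measurable_const.piecewise hZm (hH.volume_preserving t).measurable
  refine ⟨fun t => Z.piecewise (fun _ => 0) (S t), ?_, hc, ?_⟩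
  · have := measurable_uncurry_of_continuous_of_measurable
      (u := fun (t : ℝ) ξ => Z.piecewise (fun _ => (0 : Phase d)) (S t) ξ) hc hm
    exact this
  · filter_upwards [measure_eq_zero_iff_ae_notMem.1 hZ0] with ξ hξ t
    exact piecewise_eq_of_notMem _ _ _ hξ

theorem ae_fst {p : Pos d → Prop} (h : ∀ᵐ y, p y) : ∀ᵐ ξ : Phase d, p ξ.1 :=
  Measure.quasiMeasurePreserving_fst.ae h

/-- Measure preservation shows that at each time almost every label avoids the exceptional null set
of positions. Fubini, which requires the jointly measurable version, exchanges the quantifiers: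
almost every trajectory avoids it at almost every time. -/
theorem SolvesNewton.congr (hS : SolvesNewton F S) (hH : IsHamiltonianFlow S)
    (he : ∀ᵐ y, F y = F₀ y) : SolvesNewton F₀ S := by
  obtain ⟨S', hm, -, hS'⟩ := exists_measurable_version hS hH
  obtain ⟨Z, hZ, hZm, hZ0⟩ := exists_measurable_superset_of_null (ae_iff.1 he)
  have h1 : ∀ᵐ t : ℝ, ∀ᵐ ξ : Phase d, (S' t ξ).1 ∉ Z := by
    refine ae_of_all _ fun t => ?_
    have h2 := (hH.volume_preserving t).quasiMeasurePreserving.ae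
      (ae_fst (measure_eq_zero_iff_ae_notMem.1 hZ0))
    filter_upwards [h2, hS'] with ξ h3 h4
    rwa [h4 t]
  have hset : MeasurableSet {p : ℝ × Phase d | (S' p.1 p.2).1 ∉ Z} :=
    (measurable_fst.comp hm hZm).compl
  have h2 : ∀ᵐ ξ : Phase d, ∀ᵐ t : ℝ, (S' t ξ).1 ∉ Z :=
    (Measure.ae_ae_comm hset).1 h1
  filter_upwards [hS, h2, hS'] with ξ h3 h4 h5
  refine h3.congr ?_
  filter_upwards [h4] with t ht
  rw [h5 t] at ht
  by_contra hne
  exact ht (hZ hne)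

/-- An essentially bounded field has a version that is bounded and measurable. -/
theorem exists_bounded_version (hF : AEStronglyMeasurable F volume) (hA : 0 ≤ A)
    (hb : eLpNorm F ∞ volume ≤ ENNReal.ofReal A) :
    ∃ F₀ : Pos d → Pos d, Measurable F₀ ∧ (∀ y, ‖F₀ y‖ ≤ A) ∧ ∀ᵐ y, F y = F₀ y := by
  classical
  have hm : Measurable (hF.mk F) := hF.stronglyMeasurable_mk.measurable
  refine ⟨fun y => if ‖hF.mk F y‖ ≤ A then hF.mk F y else 0,
    Measurable.ite (measurableSet_le hm.norm measurable_const) hm measurable_const,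
    fun y => ?_, ?_⟩
  · dsimp only
    split_ifs with h
    · exact h
    · simpa using hA
  · have h1 : ∀ᵐ y, ‖F y‖ₑ ≤ ENNReal.ofReal A := by
      rw [eLpNorm_exponent_top] at hb
      exact (ae_le_eLpNormEssSup (f := F)).mono fun y hy => hy.trans hb
    filter_upwards [h1, hF.ae_eq_mk] with y h2 h3
    rw [← ofReal_norm, ENNReal.ofReal_le_ofReal_iff hA] at h2
    rw [← h3, if_pos h2]

theorem aestronglyMeasurable_of_complexify (h : AEStronglyMeasurable (complexify F) volume) :
    AEStronglyMeasurable F volume := by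
  have hc : Continuous fun z : CPos d => (WithLp.toLp 2 fun i => (z i).re : Pos d) := by fun_prop
  have := hc.comp_aestronglyMeasurable h
  refine this.congr (ae_of_all _ fun y => ?_)
  ext i
  simp [complexify]

theorem MemH.memLp {s : ℝ} (h : MemH s F) : MemLp (complexify F) 2 volume := by
  by_contra hn
  rw [MemH, sobolevENorm, iInf_neg hn] at h
  exact lt_irrefl _ h

/-- The time integral of a density along the trajectories that stay in `K`. -/
theorem lintegral_lintegral_flow_le {S' : ℝ → Phase d → Phase d} (hH : IsHamiltonianFlow S)
    (hm : Measurable (Function.uncurry S')) (he : ∀ᵐ ξ, ∀ t, S' t ξ = S t ξ)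
    {Ω K : Set (Phase d)} (hΩ : MeasurableSet Ω) (hK : MeasurableSet K) {T : ℝ}
    (hmem : ∀ᵐ ξ, ξ ∈ Ω → ∀ t ∈ Icc 0 T, S t ξ ∈ K) {P : Phase d → ℝ≥0∞} (hP : Measurable P) :
    (∀ t ∈ Icc 0 T, ∫⁻ ξ in Ω, P (S' t ξ) ≤ ∫⁻ ξ in K, P ξ) ∧
    ∫⁻ ξ in Ω, ∫⁻ t in Ioc 0 T, P (S' t ξ) ≤ ENNReal.ofReal T * ∫⁻ ξ in K, P ξ := by
  have h1 : ∀ t ∈ Icc 0 T, ∫⁻ ξ in Ω, P (S' t ξ) ≤ ∫⁻ ξ in K, P ξ := fun t ht => by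
    calc ∫⁻ ξ in Ω, P (S' t ξ) ≤ ∫⁻ ξ in Ω, K.indicator P (S t ξ) := by
          refine lintegral_mono_ae ?_
          rw [ae_restrict_iff' hΩ]
          filter_upwards [he, hmem] with ξ h2 h3 hξ
          rw [h2 t, indicator_of_mem (h3 hξ t ht)]
      _ ≤ ∫⁻ ξ, K.indicator P (S t ξ) := setLIntegral_le_lintegral _ _
      _ = ∫⁻ ξ, K.indicator P ξ := (hH.volume_preserving t).lintegral_comp (hP.indicator hK)
      _ = _ := lintegral_indicator hK _
  refine ⟨h1, ?_⟩
  rw [lintegral_lintegral_swap]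
  · calc ∫⁻ t in Ioc 0 T, ∫⁻ ξ in Ω, P (S' t ξ)
        ≤ ∫⁻ _t in Ioc 0 T, ∫⁻ ξ in K, P ξ :=
          setLIntegral_mono' measurableSet_Ioc fun t ht => h1 t (Ioc_subset_Icc_self ht)
      _ = _ := by simp [mul_comm]
  · exact (hP.comp (hm.comp measurable_swap)).aemeasurable

/-- By continuity in time, the supremum exceeds c exactly when c is exceeded at some time of a
countable dense set. -/
theorem measurable_sSup_image {Ξ : Type*} [MeasurableSpace Ξ] {f : ℝ → Ξ → ℝ} {T : ℝ}
    (hT : 0 ≤ T) (hf : ∀ t, Measurable (f t)) (hc : ∀ ξ, Continuous fun t => f t ξ) :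
    Measurable fun ξ => sSup ((fun t => f t ξ) '' Icc 0 T) := by
  obtain ⟨D, hD, hDd⟩ := TopologicalSpace.exists_countable_dense (Icc 0 T)
  refine measurable_of_Ioi fun c => ?_
  have : (fun ξ => sSup ((fun t => f t ξ) '' Icc 0 T)) ⁻¹' Ioi c
      = ⋃ t ∈ D, {ξ | c < f t ξ} := by
    ext ξ
    have hb : BddAbove ((fun t => f t ξ) '' Icc 0 T) :=
      (isCompact_Icc.image (hc ξ)).bddAbove
    simp only [mem_preimage, mem_Ioi, mem_iUnion, mem_ofPred_eq, exists_prop,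
      lt_csSup_iff hb ((nonempty_Icc.2 hT).image _), exists_mem_image]
    constructor
    · rintro ⟨t, ht, hlt⟩
      have ho : IsOpen {t : Icc 0 T | c < f t ξ} :=
        isOpen_lt continuous_const ((hc ξ).comp continuous_subtype_val)
      obtain ⟨t', h1, h2⟩ := hDd.inter_open_nonempty _ ho ⟨⟨t, ht⟩, hlt⟩
      exact ⟨t', h2, h1⟩
    · rintro ⟨t, -, hlt⟩
      exact ⟨t, t.2, hlt⟩
  rw [this]
  exact MeasurableSet.biUnion hD fun t _ => measurableSet_lt measurable_const (hf t)

theorem aestronglyMeasurable_logSeparation {S₁ S₂ : ℝ → Phase d → Phase d} {F₁ F₂ : Pos d → Pos d}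
    (h1 : SolvesNewton F₁ S₁) (hH1 : IsHamiltonianFlow S₁) (h2 : SolvesNewton F₂ S₂)
    (hH2 : IsHamiltonianFlow S₂) {T : ℝ} (hT : 0 ≤ T) (δ : ℝ) :
    AEStronglyMeasurable (logSeparation T δ S₁ S₂) volume := by
  obtain ⟨R₁, m1, c1, e1⟩ := exists_measurable_version h1 hH1
  obtain ⟨R₂, m2, c2, e2⟩ := exists_measurable_version h2 hH2
  have hm : Measurable (logSeparation T δ R₁ R₂) := by
    have k1 : ∀ t, Measurable fun ξ => ‖(R₁ t ξ).1 - (R₂ t ξ).1‖ ^ 2 := fun t => by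
      have a1 : Measurable fun ξ => R₁ t ξ := m1.comp measurable_prodMk_left
      have a2 : Measurable fun ξ => R₂ t ξ := m2.comp measurable_prodMk_left
      exact (a1.fst.sub a2.fst).norm.pow_const 2
    have k2 : ∀ ξ, Continuous fun t => ‖(R₁ t ξ).1 - (R₂ t ξ).1‖ ^ 2 := fun ξ =>
      ((c1 ξ).fst.sub (c2 ξ).fst).norm.pow 2
    have k3 : Measurable fun p : Phase d × ℝ => ‖(R₁ p.2 p.1).2 - (R₂ p.2 p.1).2‖ ^ 2 :=
      (((m1.comp measurable_swap).snd.sub (m2.comp measurable_swap).snd).norm.pow_const 2)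
    have k4 : Measurable fun ξ => ∫ t in (0 : ℝ)..T, ‖(R₁ t ξ).2 - (R₂ t ξ).2‖ ^ 2 := by
      simp only [intervalIntegral.integral_of_le hT]
      exact (k3.stronglyMeasurable.integral_prod_right'
        (ν := volume.restrict (Ioc 0 T))).measurable
    exact (measurable_const.add (measurable_const.mul
      ((measurable_sSup_image hT k1 k2).add k4))).log
  refine hm.aestronglyMeasurable.congr ?_
  filter_upwards [e1, e2] with ξ h3 h4
  simp only [logSeparation, h3, h4]

end Flows

/-! ### Integration of the separation estimate -/

section Integration

open Filter Topology

variable {d : ℕ}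

theorem eLpNorm_weighted_sum_le {α : Type*} [MeasurableSpace α] {m : Measure α} {n : ℕ}
    {B : ℕ → α → ℝ} {w b : ℕ → ℝ} {c W : ℝ} {N : ℝ≥0∞} (hc : 0 ≤ c) (hw : ∀ j, 0 ≤ w j)
    (hb : ∀ j, 0 ≤ b j) (hm : ∀ j, AEStronglyMeasurable (B j) m)
    (hB : ∀ j, eLpNorm (B j) 2 m ≤ ENNReal.ofReal (b j) * N)
    (hW : ∑ j ∈ Finset.range n, w j * b j ≤ W) :
    eLpNorm (fun p => c * ∑ j ∈ Finset.range n, w j * B j p) 2 m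
      ≤ ENNReal.ofReal (c * W) * N := by
  have e : (fun p => c * ∑ j ∈ Finset.range n, w j * B j p)
      = c • ∑ j ∈ Finset.range n, w j • B j := by
    funext p
    simp
  rw [e]
  refine eLpNorm_const_smul_le.trans ?_
  rw [Real.enorm_eq_ofReal hc, ENNReal.ofReal_mul hc, mul_assoc]
  refine mul_le_mul' le_rfl ((eLpNorm_sum_le (fun j _ => (hm j).const_smul (w j))
    one_le_two).trans ?_)
  calc ∑ j ∈ Finset.range n, eLpNorm (w j • B j) 2 m
      ≤ ∑ j ∈ Finset.range n, ENNReal.ofReal (w j * b j) * N := by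
        refine Finset.sum_le_sum fun j _ => eLpNorm_const_smul_le.trans ?_
        rw [Real.enorm_eq_ofReal (hw j), ENNReal.ofReal_mul (hw j), mul_assoc]
        exact mul_le_mul' le_rfl (hB j)
    _ = ENNReal.ofReal (∑ j ∈ Finset.range n, w j * b j) * N := by
        rw [ENNReal.ofReal_sum_of_nonneg fun j _ => mul_nonneg (hw j) (hb j), Finset.sum_mul]
    _ ≤ _ := mul_le_mul' (ENNReal.ofReal_le_ofReal hW) le_rfl

theorem dyadicLength_eq (j : ℕ) : dyadicLength j = ((2 : ℝ) ^ j) ^ (-(1 / 2) : ℝ) := by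
  rw [dyadicLength, Real.sqrt_eq_rpow, Real.rpow_neg (by positivity)]

theorem sqrt_two_mul_dyadicLength (j : ℕ) :
    √(2 * dyadicLength j) = √2 * ((2 : ℝ) ^ j) ^ (-(1 / 4) : ℝ) := by
  rw [Real.sqrt_mul zero_le_two, dyadicLength_eq, Real.sqrt_eq_rpow (_ ^ _),
    ← Real.rpow_mul (by positivity)]
  norm_num

theorem two_rpow_neg_le {a : ℝ} (h0 : 0 ≤ a) (h1 : a ≤ 1) : (2 : ℝ) ^ (-a) ≤ 1 - a / 2 := by
  have h := rpow_one_add_le_one_add_mul_self (s := -1 / 2) (by norm_num) h0 h1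
  rw [Real.rpow_neg zero_le_two, ← Real.inv_rpow zero_le_two]
  norm_num at h ⊢
  linarith

/-- A geometric series whose ratio 2^(-p) is at most 1 - p/2 by concavity; the blow-up like 1/p is
the source of the 1/a in the final estimate. -/
theorem sum_dyadic_rpow_le {p : ℝ} (h0 : 0 < p) (h1 : p ≤ 1) (n : ℕ) :
    ∑ j ∈ Finset.range n, ((2 : ℝ) ^ j) ^ (-p) ≤ 2 / p := by
  have h2 := two_rpow_neg_le h0.le h1
  have h3 : (0 : ℝ) ≤ 2 ^ (-p) := by positivity
  have e : ∀ j : ℕ, ((2 : ℝ) ^ j) ^ (-p) = ((2 : ℝ) ^ (-p)) ^ j := fun j => by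
    rw [← Real.rpow_natCast, ← Real.rpow_natCast, ← Real.rpow_mul zero_le_two,
      ← Real.rpow_mul zero_le_two, mul_comm]
  simp only [e]
  have h4 : (2 : ℝ) ^ (-p) < 1 := by linarith
  refine ((summable_geometric_of_lt_one h3 h4).sum_le_tsum _ fun j _ => by positivity).trans ?_
  rw [tsum_geometric_of_lt_one h3 h4, inv_le_comm₀ (by linarith) (by positivity), inv_div]
  linarith

theorem sqrt_two_le : √2 ≤ 3 / 2 := Real.sqrt_le_iff.2 ⟨by norm_num, by norm_num⟩

/-- With t = 2^j the exponents add up to 1/2 - 1/4 - (3/4 + a) = -(1/2 + a): weight hR, averaging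
gain, Sobolev decay. The sum is bounded uniformly in a. -/
theorem sum_low_weight_le {a c : ℝ} (h0 : 0 < a) (h1 : a < 1 / 4) (hc : 0 ≤ c) (n : ℕ) :
    ∑ j ∈ Finset.range n, dyadicLength j * 2 ^ j *
      (c * √(2 * dyadicLength j) * ((2 : ℝ) ^ j) ^ (-(3 / 4 + a))) ≤ c * 6 := by
  have e : ∀ j : ℕ, dyadicLength j * 2 ^ j *
      (c * √(2 * dyadicLength j) * ((2 : ℝ) ^ j) ^ (-(3 / 4 + a)))
        = c * √2 * ((2 : ℝ) ^ j) ^ (-(1 / 2 + a)) := fun j => by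
    rw [sqrt_two_mul_dyadicLength, dyadicLength_eq]
    have ht : (0 : ℝ) < 2 ^ j := by positivity
    generalize (2 : ℝ) ^ j = t at ht
    have : t ^ (-(1 / 2 + a)) = t ^ (-(1 / 2) : ℝ) * t * t ^ (-(1 / 4) : ℝ) * t ^ (-(3 / 4 + a)) := by
      nth_rewrite 3 [← Real.rpow_one t]
      rw [← Real.rpow_add ht, ← Real.rpow_add ht, ← Real.rpow_add ht]
      ring_nf
    rw [this]
    ring
  simp only [e, ← Finset.mul_sum]
  have h2 := sum_dyadic_rpow_le (p := 1 / 2 + a) (by linarith) (by linarith) n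
  have h3 : 2 / (1 / 2 + a) ≤ 4 := by rw [div_le_iff₀ (by linarith)]; linarith
  calc _ ≤ c * (3 / 2) * 4 := by
        have := sqrt_two_le
        have := h2.trans h3
        gcongr
    _ = c * 6 := by ring

/-- Here the weight is the full derivative R, and the exponents add up to 1 - 1/4 - (3/4 + a) = -a.
This is where 3/4 is critical. -/
theorem sum_high_weight_le {a c : ℝ} (h0 : 0 < a) (h1 : a < 1 / 4) (hc : 0 ≤ c) (n : ℕ) :
    ∑ j ∈ Finset.range n, (2 : ℝ) ^ j *
      (c * √(2 * dyadicLength j) * ((2 : ℝ) ^ j) ^ (-(3 / 4 + a))) ≤ c * 3 * (1 / a) := by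
  have e : ∀ j : ℕ, (2 : ℝ) ^ j *
      (c * √(2 * dyadicLength j) * ((2 : ℝ) ^ j) ^ (-(3 / 4 + a)))
        = c * √2 * ((2 : ℝ) ^ j) ^ (-a) := fun j => by
    rw [sqrt_two_mul_dyadicLength]
    have ht : (0 : ℝ) < 2 ^ j := by positivity
    generalize (2 : ℝ) ^ j = t at ht
    have : t ^ (-a) = t * t ^ (-(1 / 4) : ℝ) * t ^ (-(3 / 4 + a)) := by
      nth_rewrite 2 [← Real.rpow_one t]
      rw [← Real.rpow_add ht, ← Real.rpow_add ht]
      ring_nf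
    rw [this]
    ring
  simp only [e, ← Finset.mul_sum]
  have h2 := sum_dyadic_rpow_le h0 (by linarith) n
  calc _ ≤ c * (3 / 2) * (2 / a) := by
        have := sqrt_two_le
        gcongr
    _ = c * 3 * (1 / a) := by ring

theorem lintegral_enorm_sq_eq {α E : Type*} [MeasurableSpace α] {m : Measure α}
    [NormedAddCommGroup E] (f : α → E) : ∫⁻ p, ‖f p‖ₑ ^ 2 ∂m = eLpNorm f 2 m ^ 2 := by
  rw [eLpNorm_eq_lintegral_rpow_enorm_toReal two_ne_zero ENNReal.ofNat_ne_top,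
    ← ENNReal.rpow_natCast, ← ENNReal.rpow_mul]
  norm_num

theorem eLpNorm_comp_fst_le {E : Type*} [NormedAddCommGroup E] {u : Pos d → E}
    (hu : AEStronglyMeasurable u volume) {s : Set (Phase d)} {v₀ : Pos d} {D : ℝ}
    (hs : ∀ p ∈ s, ‖p.2 - v₀‖ ≤ D) :
    eLpNorm (fun p : Phase d => u p.1) 2 (volume.restrict s)
      ≤ volume (Metric.closedBall v₀ D) ^ (1 / 2 : ℝ) * eLpNorm u 2 volume := by
  refine eLpNorm_two_le ?_
  have hsub : s ⊆ univ ×ˢ Metric.closedBall v₀ D := fun p hp => by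
    simpa [dist_eq_norm] using hs p hp
  calc ∫⁻ p in s, ‖u p.1‖ₑ ^ 2
      ≤ ∫⁻ p in univ ×ˢ Metric.closedBall v₀ D, ‖u p.1‖ₑ ^ 2 := lintegral_mono_set hsub
    _ = ∫⁻ p : Phase d, ‖u p.1‖ₑ ^ 2 ∂(volume.prod (volume.restrict (Metric.closedBall v₀ D))) := by
        rw [Measure.volume_eq_prod, ← Measure.prod_restrict, Measure.restrict_univ]
    _ = volume (Metric.closedBall v₀ D) * ∫⁻ y, ‖u y‖ₑ ^ 2 := by
        rw [lintegral_prod]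
        · simp only [lintegral_const, Measure.restrict_apply MeasurableSet.univ, univ_inter]
          rw [lintegral_mul_const'' _ (hu.enorm.pow_const 2), mul_comm]
        · exact (hu.enorm.pow_const 2).comp_quasiMeasurePreserving Measure.quasiMeasurePreserving_fst
    _ = _ := by
        congr 1
        rw [← ENNReal.rpow_natCast, ← ENNReal.rpow_mul]
        norm_num

theorem lintegral_enorm_le_eLpNorm_two {E : Type*} [NormedAddCommGroup E] {f : Phase d → E}
    {s : Set (Phase d)} (hf : AEStronglyMeasurable f (volume.restrict s)) {m : ℝ≥0∞}
    (hm : volume s ≤ m) :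
    ∫⁻ p in s, ‖f p‖ₑ ≤ m ^ (1 / 2 : ℝ) * eLpNorm f 2 (volume.restrict s) := by
  have h := eLpNorm_le_eLpNorm_mul_rpow_measure_univ (p := 1) (q := 2) one_le_two hf
  rw [eLpNorm_one_eq_lintegral_enorm, Measure.restrict_apply_univ] at h
  refine h.trans ?_
  rw [mul_comm]
  norm_num
  gcongr

end Integration

section Integration

open Filter Topology

variable {d : ℕ} {ι : Type*} {F : Pos d → Pos d} {A K : ℝ} {R h : ι → ℝ}
  {g : ι → Pos d → CPos d} {H : ι → Phase d → CPos d}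
  {H' : ι → Phase d → Phase d →L[ℝ] CPos d} {r : ι → Phase d → CPos d} {B : ι → Phase d → ℝ}

/-- An upper bound of the density of the separation. -/
noncomputable def separationBound (K A : ℝ) (F : Pos d → Pos d) (s : Finset ι) (R h : ι → ℝ)
    (g : ι → Pos d → CPos d) (B : ι → Phase d → ℝ) (δ : ℝ) (p : Phase d) : ℝ≥0∞ :=
  8 * ‖lowMajorant K s R h B p‖ₑ ^ 2 + ‖highMajorant K A s R B p‖ₑ +
    ENNReal.ofReal (2 / δ) * ‖unresolved F s g p.1‖ₑ

theorem enorm_separationDensity_le (s : Finset ι) {δ : ℝ} (hδ : 0 ≤ δ) (p : Phase d) :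
    ‖separationDensity K A F s R h g B δ p‖ₑ ≤ separationBound K A F s R h g B δ p := by
  refine (enorm_add_le _ _).trans (add_le_add ((enorm_add_le _ _).trans
    (add_le_add (le_of_eq ?_) le_rfl)) (le_of_eq ?_))
  · rw [enorm_mul, enorm_pow, Real.enorm_eq_ofReal (by norm_num : (0 : ℝ) ≤ 8)]
    simp
  · rw [enorm_mul, Real.enorm_eq_ofReal (by positivity), enorm_norm]

theorem measurable_complexify (hF : Measurable F) : Measurable (complexify F) :=
  (complexL d).continuous.measurable.comp hF

theorem measurable_unresolved (hF : Measurable F) (s : Finset ι) (hg : ∀ j, Continuous (g j)) :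
    Measurable (unresolved F s g) :=
  (measurable_complexify hF).sub (continuous_finsetSum _ fun j _ => hg j).measurable

theorem ofReal_logSeparation_le (hA : ∀ y, ‖F y‖ ≤ A) (hK : 0 ≤ K) (s : Finset ι)
    (hR : ∀ j, 0 ≤ R j)
    (hh : ∀ j, 0 ≤ h j) (hc : ∀ j, IsCorrector K (R j) (h j) (g j) (H j) (H' j) (r j) (B j))
    (hg : ∀ j, Continuous (g j)) {δ : ℝ} (hδ : 0 < δ) {T : ℝ} (hT : 0 ≤ T)
    {S S' : ℝ → Phase d → Phase d} {ξ : Phase d}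
    (hn : IsNewtonTrajectory F (fun t => (S t ξ).1) fun t => (S t ξ).2)
    (hn' : IsNewtonTrajectory F (fun t => (S' t ξ).1) fun t => (S' t ξ).2)
    (hx0 : ‖(S 0 ξ).1 - (S' 0 ξ).1‖ ≤ δ) (hv0 : ‖(S 0 ξ).2 - (S' 0 ξ).2‖ ≤ δ) :
    ENNReal.ofReal (logSeparation T δ S S' ξ) ≤
      ENNReal.ofReal (4 + 4 * T) + 4 * ‖lowMajorant K s R h B (S 0 ξ)‖ₑ ^ 2 +
        4 * ‖lowMajorant K s R h B (S' 0 ξ)‖ₑ ^ 2 +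
        ((∫⁻ t in Ioc 0 T, separationBound K A F s R h g B δ (S t ξ)) +
          ∫⁻ t in Ioc 0 T, separationBound K A F s R h g B δ (S' t ξ)) := by
  have key := log_separation_le hA hK s hR hh hc hg hδ hT hn hn' hx0 hv0
  refine (ENNReal.ofReal_le_ofReal key).trans ?_
  refine ENNReal.ofReal_add_le.trans (add_le_add (ENNReal.ofReal_add_le.trans (add_le_add
    (ENNReal.ofReal_add_le.trans (add_le_add le_rfl ?_)) ?_)) (ENNReal.ofReal_add_le.trans
      (add_le_add ?_ ?_)))
  · rw [ENNReal.ofReal_mul (by norm_num), ← sq_abs, ENNReal.ofReal_pow (abs_nonneg _),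
      ← Real.norm_eq_abs, ofReal_norm]
    simp
  · rw [ENNReal.ofReal_mul (by norm_num), ← sq_abs, ENNReal.ofReal_pow (abs_nonneg _),
      ← Real.norm_eq_abs, ofReal_norm]
    simp
  · rw [intervalIntegral.integral_of_le hT]
    refine (Real.ofReal_le_enorm _).trans ((enorm_integral_le_lintegral_enorm _).trans ?_)
    exact lintegral_mono fun t => enorm_separationDensity_le s hδ.le _
  · rw [intervalIntegral.integral_of_le hT]
    refine (Real.ofReal_le_enorm _).trans ((enorm_integral_le_lintegral_enorm _).trans ?_)
    exact lintegral_mono fun t => enorm_separationDensity_le s hδ.le _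

theorem lintegral_sum_eq {α : Type*} [MeasurableSpace α] {m : Measure α} (c e : ℝ≥0∞)
    {f₁ f₂ f₃ f₄ : α → ℝ≥0∞} (h₁ : Measurable f₁) (h₂ : Measurable f₂) (h₃ : Measurable f₃) :
    ∫⁻ a, (c + e * f₁ a + e * f₂ a + (f₃ a + f₄ a)) ∂m
      = c * m univ + e * (∫⁻ a, f₁ a ∂m) + e * (∫⁻ a, f₂ a ∂m) +
        ((∫⁻ a, f₃ a ∂m) + ∫⁻ a, f₄ a ∂m) := by
  have k₁ : Measurable fun a => c + e * f₁ a := (h₁.const_mul e).const_add c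
  have k₂ : Measurable fun a => c + e * f₁ a + e * f₂ a := k₁.add (h₂.const_mul e)
  rw [lintegral_add_left k₂, lintegral_add_left k₁, lintegral_add_left measurable_const,
    lintegral_add_left h₃, lintegral_const_mul _ h₁, lintegral_const_mul _ h₂, lintegral_const]

/-- Integration of the pointwise estimate over a set of labels. -/
theorem lintegral_logSeparation_le (hFm : Measurable F) (hA : ∀ y, ‖F y‖ ≤ A) (hK : 0 ≤ K)
    (s : Finset ι) (hR : ∀ j, 0 ≤ R j)
    (hh : ∀ j, 0 ≤ h j) (hc : ∀ j, IsCorrector K (R j) (h j) (g j) (H j) (H' j) (r j) (B j))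
    (hg : ∀ j, Continuous (g j)) {δ : ℝ} (hδ : 0 < δ) {T : ℝ} (hT : 0 ≤ T)
    {S S' : ℝ → Phase d → Phase d}
    (hS : SolvesNewton F S) (hH : IsHamiltonianFlow S) (hS' : SolvesNewton F S')
    (hH' : IsHamiltonianFlow S') {Ω Ω' : Set (Phase d)} (hΩ : MeasurableSet Ω)
    (hΩ' : MeasurableSet Ω') (hmem : ∀ᵐ ξ, ξ ∈ Ω → ∀ t ∈ Icc 0 T, S t ξ ∈ Ω')
    (hmem' : ∀ᵐ ξ, ξ ∈ Ω → ∀ t ∈ Icc 0 T, S' t ξ ∈ Ω')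
    (h0 : ∀ ξ, ‖(S 0 ξ).1 - (S' 0 ξ).1‖ ≤ δ ∧ ‖(S 0 ξ).2 - (S' 0 ξ).2‖ ≤ δ) :
    ∫⁻ ξ in Ω, ENNReal.ofReal (logSeparation T δ S S' ξ) ≤
      ENNReal.ofReal (4 + 4 * T) * volume Ω +
        8 * (∫⁻ p in Ω', ‖lowMajorant K s R h B p‖ₑ ^ 2) +
        2 * (ENNReal.ofReal T * ∫⁻ p in Ω', separationBound K A F s R h g B δ p) := by
  obtain ⟨U, mU, -, eU⟩ := exists_measurable_version hS hH
  obtain ⟨U', mU', -, eU'⟩ := exists_measurable_version hS' hH'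
  have hB := fun j => (hc j).continuous_majorant
  have mL : Measurable fun p => ‖lowMajorant K s R h B p‖ₑ ^ 2 :=
    (continuous_lowMajorant s hB).measurable.enorm.pow_const 2
  have mP : Measurable (separationBound K A F s R h g B δ) :=
    ((mL.const_mul 8).add (continuous_highMajorant s hB).measurable.enorm).add
      (((measurable_unresolved hFm s hg).comp measurable_fst).enorm.const_mul _)
  obtain ⟨-, l2⟩ := lintegral_lintegral_flow_le hH mU eU hΩ hΩ' hmem mP
  obtain ⟨-, l2'⟩ := lintegral_lintegral_flow_le hH' mU' eU' hΩ hΩ' hmem' mP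
  -- The initial values of the majorant are also transported into Ω' by the time-0 map, for the
  -- perturbed flow as well; the two coefficients 4 add up to 8.
  have k1 := (lintegral_lintegral_flow_le hH mU eU hΩ hΩ' hmem mL).1 0 (left_mem_Icc.2 hT)
  have k2 := (lintegral_lintegral_flow_le hH' mU' eU' hΩ hΩ' hmem' mL).1 0 (left_mem_Icc.2 hT)
  have m1 : Measurable fun ξ => ‖lowMajorant K s R h B (U 0 ξ)‖ₑ ^ 2 :=
    mL.comp (mU.comp measurable_prodMk_left)
  have m2 : Measurable fun ξ => ‖lowMajorant K s R h B (U' 0 ξ)‖ₑ ^ 2 :=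
    mL.comp (mU'.comp measurable_prodMk_left)
  have m3 : Measurable fun ξ => ∫⁻ t in Ioc 0 T, separationBound K A F s R h g B δ (U t ξ) :=
    (mP.comp (mU.comp measurable_swap)).lintegral_prod_right'
  calc ∫⁻ ξ in Ω, ENNReal.ofReal (logSeparation T δ S S' ξ)
      ≤ ∫⁻ ξ in Ω, (ENNReal.ofReal (4 + 4 * T) + 4 * ‖lowMajorant K s R h B (U 0 ξ)‖ₑ ^ 2 +
        4 * ‖lowMajorant K s R h B (U' 0 ξ)‖ₑ ^ 2 +
        ((∫⁻ t in Ioc 0 T, separationBound K A F s R h g B δ (U t ξ)) +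
          ∫⁻ t in Ioc 0 T, separationBound K A F s R h g B δ (U' t ξ))) := by
        refine lintegral_mono_ae (ae_restrict_of_ae ?_)
        filter_upwards [hS, hS', eU, eU'] with ξ h1 h2 h3 h4
        simp only [h3, h4]
        exact ofReal_logSeparation_le hA hK s hR hh hc hg hδ hT h1 h2 (h0 ξ).1 (h0 ξ).2
    _ = ENNReal.ofReal (4 + 4 * T) * volume Ω +
          4 * (∫⁻ ξ in Ω, ‖lowMajorant K s R h B (U 0 ξ)‖ₑ ^ 2) +
          4 * (∫⁻ ξ in Ω, ‖lowMajorant K s R h B (U' 0 ξ)‖ₑ ^ 2) +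
          ((∫⁻ ξ in Ω, ∫⁻ t in Ioc 0 T, separationBound K A F s R h g B δ (U t ξ)) +
            ∫⁻ ξ in Ω, ∫⁻ t in Ioc 0 T, separationBound K A F s R h g B δ (U' t ξ)) := by
        rw [← Measure.restrict_apply_univ Ω]
        exact lintegral_sum_eq _ _ m1 m2 m3
    _ ≤ ENNReal.ofReal (4 + 4 * T) * volume Ω +
          4 * (∫⁻ p in Ω', ‖lowMajorant K s R h B p‖ₑ ^ 2) +
          4 * (∫⁻ p in Ω', ‖lowMajorant K s R h B p‖ₑ ^ 2) +
          (ENNReal.ofReal T * (∫⁻ p in Ω', separationBound K A F s R h g B δ p) +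
            ENNReal.ofReal T * ∫⁻ p in Ω', separationBound K A F s R h g B δ p) := by
        gcongr
    _ = _ := by ring

end Integration

section Integration

open Filter Topology

variable {d : ℕ}

theorem lintegral_separationBound_eq {ι : Type*} {F : Pos d → Pos d} {A K : ℝ} {R h : ι → ℝ}
    {g : ι → Pos d → CPos d} {B : ι → Phase d → ℝ} (hF : Measurable F) (s : Finset ι)
    (hg : ∀ j, Continuous (g j)) (hB : ∀ j, Continuous (B j)) (δ : ℝ) (Ω : Set (Phase d)) :
    ∫⁻ p in Ω, separationBound K A F s R h g B δ p =
      8 * (∫⁻ p in Ω, ‖lowMajorant K s R h B p‖ₑ ^ 2) +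
        (∫⁻ p in Ω, ‖highMajorant K A s R B p‖ₑ) +
        ENNReal.ofReal (2 / δ) * ∫⁻ p in Ω, ‖unresolved F s g p.1‖ₑ := by
  have m1 : Measurable fun p => ‖lowMajorant K s R h B p‖ₑ ^ 2 :=
    (continuous_lowMajorant s hB).measurable.enorm.pow_const 2
  have m2 : Measurable fun p => ‖highMajorant K A s R B p‖ₑ :=
    (continuous_highMajorant s hB).measurable.enorm
  have m3 : Measurable fun p : Phase d => ‖unresolved F s g p.1‖ₑ :=
    ((measurable_unresolved hF s hg).comp measurable_fst).enorm
  simp only [separationBound]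
  have m4 : Measurable fun p => 8 * ‖lowMajorant K s R h B p‖ₑ ^ 2 + ‖highMajorant K A s R B p‖ₑ :=
    (m1.const_mul 8).add m2
  rw [lintegral_add_left m4, lintegral_add_left (m1.const_mul 8),
    lintegral_const_mul _ m1, lintegral_const_mul _ m3]

/-- The blocks come from the extension G while the trajectories obey F; it suffices that F and G
agree at the positions of the set, and there the remainder is the tail of G. -/
theorem lintegral_unresolved_le {ι : Type*} {F G : Pos d → Pos d}
    {g : ι → Pos d → CPos d} (hG : AEStronglyMeasurable (complexify G) volume) (s : Finset ι)
    (hg : ∀ j, Continuous (g j)) {Ω : Set (Phase d)} (hΩ : MeasurableSet Ω)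
    (hFG : ∀ᵐ p, p ∈ Ω → F p.1 = G p.1) {m : ℝ≥0∞} (hm : volume Ω ≤ m) {v₀ : Pos d} {D : ℝ}
    (hD : ∀ p ∈ Ω, ‖p.2 - v₀‖ ≤ D) :
    ∫⁻ p in Ω, ‖unresolved F s g p.1‖ₑ ≤ m ^ (1 / 2 : ℝ) *
      (volume (Metric.closedBall v₀ D) ^ (1 / 2 : ℝ) * eLpNorm (unresolved G s g) 2 volume) := by
  have hu : AEStronglyMeasurable (unresolved G s g) volume :=
    hG.sub (continuous_finsetSum _ fun j _ => hg j).aestronglyMeasurable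
  have hu' : AEStronglyMeasurable (fun p : Phase d => unresolved G s g p.1)
      (volume.restrict Ω) :=
    (hu.comp_quasiMeasurePreserving Measure.quasiMeasurePreserving_fst).restrict
  calc ∫⁻ p in Ω, ‖unresolved F s g p.1‖ₑ = ∫⁻ p in Ω, ‖unresolved G s g p.1‖ₑ := by
        refine lintegral_congr_ae ?_
        rw [Filter.EventuallyEq, ae_restrict_iff' hΩ]
        filter_upwards [hFG] with p hp hpΩ
        rw [unresolved, unresolved, complexify_eq, complexify_eq, hp hpΩ]
    _ ≤ m ^ (1 / 2 : ℝ) * eLpNorm (fun p : Phase d => unresolved G s g p.1) 2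
          (volume.restrict Ω) := lintegral_enorm_le_eLpNorm_two hu' hm
    _ ≤ _ := mul_le_mul' le_rfl (eLpNorm_comp_fst_le hu hD)

variable (d) in
/-- The quantitative separation estimate, in terms of a Sobolev extension of the force. -/
theorem exists_lintegral_logSeparation_le {T A : ℝ} (hT : 0 ≤ T) (hA0 : 0 ≤ A) (D M : ℝ) :
    ∃ C : ℝ, 0 < C ∧ ∀ Ω Ω' : Set (Phase d), MeasurableSet Ω → MeasurableSet Ω' →
      volume Ω ≤ ENNReal.ofReal M → volume Ω' ≤ ENNReal.ofReal M →
      ∀ v₀ : Pos d, (∀ p ∈ Ω', ‖p.2 - v₀‖ ≤ D) → ∀ a ∈ Ioo (0 : ℝ) (1 / 4),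
      ∀ F G : Pos d → Pos d, Measurable F → (∀ y, ‖F y‖ ≤ A) →
      (∀ᵐ p, p ∈ Ω' → F p.1 = G p.1) → sobolevENorm (3 / 4 + a) G < ∞ → ∀ δ : ℝ, 0 < δ →
      ∀ S S' : ℝ → Phase d → Phase d, SolvesNewton F S → IsHamiltonianFlow S →
      SolvesNewton F S' → IsHamiltonianFlow S' →
      (∀ᵐ ξ, ξ ∈ Ω → ∀ t ∈ Icc 0 T, S t ξ ∈ Ω') →
      (∀ᵐ ξ, ξ ∈ Ω → ∀ t ∈ Icc 0 T, S' t ξ ∈ Ω') →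
      (∀ ξ, ‖(S 0 ξ).1 - (S' 0 ξ).1‖ ≤ δ ∧ ‖(S 0 ξ).2 - (S' 0 ξ).2‖ ≤ δ) →
      ∫⁻ ξ in Ω, ENNReal.ofReal (logSeparation T δ S S' ξ) ≤ ENNReal.ofReal C *
        (1 + sobolevENorm (3 / 4 + a) G ^ 2 +
          ENNReal.ofReal (1 / a) * sobolevENorm (3 / 4 + a) G) := by
  obtain ⟨K, hK, hcor⟩ := exists_isCorrector d
  set cD := (2 + 4 * Real.pi * d) * majorantConst (Pos d) D with hcD
  have hπ := Real.pi_pos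
  have hcD0 : 0 ≤ cD := mul_nonneg (by positivity) (majorantConst_nonneg D)
  set cc := correctionConst d K with hcc
  have hcc0 : 0 ≤ cc := correctionConst_nonneg hK.le
  set c1 := cc * (cD * 6) with hc1
  set c2 := cc * (1 + A) * (cD * 3) with hc2
  have hc10 : 0 ≤ c1 := by positivity
  have hc20 : 0 ≤ c2 := by positivity
  -- `M` may be negative, in which case the volumes vanish; square roots and products need a
  -- nonnegative bound.
  set m := max M 0 with hm
  have hm0 : 0 ≤ m := le_max_right _ _
  have hmM : ENNReal.ofReal M ≤ ENNReal.ofReal m := ENNReal.ofReal_le_ofReal (le_max_left _ _)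
  set k1 := (4 + 4 * T) * m with hk1
  set k2 := (8 + 16 * T) * c1 ^ 2 with hk2
  set k3 := 2 * T * √m * c2 with hk3
  have hk10 : 0 ≤ k1 := by positivity
  have hk20 : 0 ≤ k2 := by positivity
  have hk30 : 0 ≤ k3 := by positivity
  refine ⟨k1 + k2 + k3 + 1, by positivity, ?_⟩
  intro Ω Ω' hΩ hΩ' hM hM' v₀ hD a ha F G hFm hA hFG hG δ hδ S S' hS hH hS' hH' hmem hmem' h0
  obtain ⟨μ, hμ1, hμ2, hμs, hμB, hμN, hlim⟩ := exists_dyadic (d := d) (σ := 3 / 4 + a)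
    (by linarith [ha.1]) hG
  set N := sobolevENorm (3 / 4 + a) G with hN
  have hmemG : MemLp (complexify G) 2 volume := MemH.memLp hG
  set R : ℕ → ℝ := fun j => 2 ^ j with hRdef
  have hRpos : ∀ j, 0 < R j := fun j => by positivity
  set B : ℕ → Phase d → ℝ := fun j => blockMajorant (R j) (dyadicLength j) (μ j) with hBdef
  set g : ℕ → Pos d → CPos d := fun j => 𝓕⁻ (μ j) with hgdef
  have hg : ∀ j, Continuous (g j) := fun j => continuous_fourierInv (hμ1 j)
  choose H H' r hc using fun j => hcor (R j) (dyadicLength j) (μ j) (hRpos j)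
    (dyadicLength_pos j) (pow_mul_dyadicLength_sq j) (hμ1 j) (hμs j)
  have hBc : ∀ j, Continuous (B j) := fun j => (hc j).continuous_majorant
  set b : ℕ → ℝ := fun j => cD * √(2 * dyadicLength j) * ((2 : ℝ) ^ j) ^ (-(3 / 4 + a)) with hb
  have hb0 : ∀ j, 0 ≤ b j := fun j => by positivity
  have hBN : ∀ j, eLpNorm (B j) 2 (volume.restrict Ω') ≤ ENNReal.ofReal (b j) * N := fun j => by
    refine (eLpNorm_blockMajorant_le (hRpos j) (hμ1 j) (hμ2 j) (hμs j)
      (mul_nonneg zero_le_two (dyadicLength_pos j).le) (hμB j) hΩ' v₀ hD).trans ?_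
    have e : ENNReal.ofReal (b j) = ENNReal.ofReal (cD * √(2 * dyadicLength j)) *
        ENNReal.ofReal (((2 : ℝ) ^ j) ^ (-(3 / 4 + a))) := ENNReal.ofReal_mul (by positivity)
    rw [e]
    exact (mul_le_mul' le_rfl (hμN j)).trans (mul_assoc _ _ _).symm.le
  have hL : ∀ n, eLpNorm (lowMajorant K (Finset.range n) R dyadicLength B) 2
      (volume.restrict Ω') ≤ ENNReal.ofReal c1 * N := fun n =>
    eLpNorm_weighted_sum_le hcc0
      (fun j => mul_nonneg (dyadicLength_pos j).le (hRpos j).le) hb0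
      (fun j => (hBc j).aestronglyMeasurable) hBN (sum_low_weight_le ha.1 ha.2 hcD0 n)
  have hHi : ∀ n, eLpNorm (highMajorant K A (Finset.range n) R B) 2
      (volume.restrict Ω') ≤ ENNReal.ofReal (c2 * (1 / a)) * N := fun n => by
    have := eLpNorm_weighted_sum_le (c := cc * (1 + A)) (n := n) (by positivity)
      (fun j => (hRpos j).le) hb0 (fun j => (hBc j).aestronglyMeasurable) hBN
      (sum_high_weight_le ha.1 ha.2 hcD0 n)
    rwa [← mul_assoc] at this
  set I := ∫⁻ ξ in Ω, ENNReal.ofReal (logSeparation T δ S S' ξ) with hI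
  set V := volume (Metric.closedBall v₀ D) ^ (1 / 2 : ℝ) with hV
  set m' := ENNReal.ofReal m with hm'
  set X : ℝ≥0∞ := ENNReal.ofReal (4 + 4 * T) * m' + 8 * (ENNReal.ofReal c1 * N) ^ 2 +
    2 * (ENNReal.ofReal T * (8 * (ENNReal.ofReal c1 * N) ^ 2 +
      m' ^ (1 / 2 : ℝ) * (ENNReal.ofReal (c2 * (1 / a)) * N))) with hX
  -- The whole dependence on δ sits in `Y`, which multiplies only the unresolved tail.
  set Y : ℝ≥0∞ := 2 * (ENNReal.ofReal T * (ENNReal.ofReal (2 / δ) * (m' ^ (1 / 2 : ℝ) * V)))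
    with hY
  have hstep : ∀ J : ℕ, I ≤ X + Y * eLpNorm (fun x => complexify G x -
        ∑ j ∈ Finset.range (J + 1), 𝓕⁻ (μ j) x) 2 volume := by
    intro J
    have h1 := lintegral_logSeparation_le hFm hA hK.le (Finset.range (J + 1))
      (fun j => (hRpos j).le) (fun j => (dyadicLength_pos j).le) hc hg hδ hT hS hH hS' hH' hΩ hΩ'
      hmem hmem' h0
    rw [lintegral_separationBound_eq hFm _ hg hBc, lintegral_enorm_sq_eq] at h1
    have h2 := lintegral_unresolved_le hmemG.1 (Finset.range (J + 1)) hg hΩ' hFG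
      (hM'.trans hmM) hD
    have h3 : ∫⁻ p in Ω', ‖highMajorant K A (Finset.range (J + 1)) R B p‖ₑ
        ≤ m' ^ (1 / 2 : ℝ) * (ENNReal.ofReal (c2 * (1 / a)) * N) :=
      (lintegral_enorm_le_eLpNorm_two
        (continuous_highMajorant _ hBc).aestronglyMeasurable (hM'.trans hmM)).trans
        (mul_le_mul' le_rfl (hHi _))
    have h4 : volume Ω ≤ m' := hM.trans hmM
    have h5 := hL (J + 1)
    refine h1.trans ?_
    calc _ ≤ ENNReal.ofReal (4 + 4 * T) * m' + 8 * (ENNReal.ofReal c1 * N) ^ 2 +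
          2 * (ENNReal.ofReal T * (8 * (ENNReal.ofReal c1 * N) ^ 2 +
            m' ^ (1 / 2 : ℝ) * (ENNReal.ofReal (c2 * (1 / a)) * N) + ENNReal.ofReal (2 / δ) *
            (m' ^ (1 / 2 : ℝ) * (V * eLpNorm (unresolved G (Finset.range (J + 1)) g) 2
              volume)))) := by gcongr
      _ = X + Y * eLpNorm (unresolved G (Finset.range (J + 1)) g) 2 volume := by
          rw [hX, hY]; ring
      _ = _ := rfl
  have hVfin : V ≠ ∞ := ENNReal.rpow_ne_top_of_nonneg (by norm_num)
    (isCompact_closedBall v₀ D).measure_lt_top.ne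
  have hm'fin : m' ^ (1 / 2 : ℝ) ≠ ∞ :=
    ENNReal.rpow_ne_top_of_nonneg (by norm_num) ENNReal.ofReal_ne_top
  have hYfin : Y ≠ ∞ := by
    rw [hY]
    exact ENNReal.mul_ne_top (by simp) (ENNReal.mul_ne_top ENNReal.ofReal_ne_top
      (ENNReal.mul_ne_top ENNReal.ofReal_ne_top (ENNReal.mul_ne_top hm'fin hVfin)))
  -- `I`, `X` and `Y` do not depend on the number of blocks and `Y` is finite, so J → ∞ removes the
  -- tail and leaves a bound uniform in δ.
  have hIX : I ≤ X := by
    have h1 := (ENNReal.Tendsto.const_mul hlim (Or.inr hYfin)).const_add X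
    rw [mul_zero, add_zero] at h1
    exact ge_of_tendsto' h1 hstep
  refine hIX.trans ?_
  have e1 : m' ^ (1 / 2 : ℝ) = ENNReal.ofReal √m := by
    rw [hm', ENNReal.ofReal_rpow_of_nonneg hm0 (by norm_num), Real.sqrt_eq_rpow]
  have e8 : (8 : ℝ≥0∞) = ENNReal.ofReal 8 := by simp
  have e22 : (2 : ℝ≥0∞) = ENNReal.ofReal 2 := by simp
  have hX2 : X = ENNReal.ofReal k1 + ENNReal.ofReal k2 * N ^ 2 +
      ENNReal.ofReal k3 * (ENNReal.ofReal (1 / a) * N) := by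
    have ha0 : 0 ≤ 1 / a := by have := ha.1; positivity
    have q1 : ENNReal.ofReal k1 = ENNReal.ofReal (4 + 4 * T) * m' :=
      ENNReal.ofReal_mul (by positivity)
    have q2 : ENNReal.ofReal k2 = 8 * ENNReal.ofReal c1 ^ 2 +
        2 * ENNReal.ofReal T * 8 * ENNReal.ofReal c1 ^ 2 := by
      rw [e8, e22, ← ENNReal.ofReal_pow hc10, ← ENNReal.ofReal_mul (by positivity),
        ← ENNReal.ofReal_mul (by positivity), ← ENNReal.ofReal_mul (by positivity),
        ← ENNReal.ofReal_mul (by positivity), ← ENNReal.ofReal_add (by positivity) (by positivity)]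
      congr 1
      rw [hk2]; ring
    have q3 : ENNReal.ofReal k3 = 2 * ENNReal.ofReal T * ENNReal.ofReal √m * ENNReal.ofReal c2 := by
      rw [e22, ← ENNReal.ofReal_mul (by positivity), ← ENNReal.ofReal_mul (by positivity),
        ← ENNReal.ofReal_mul (by positivity)]
    rw [hX, q1, q2, q3, e1, ENNReal.ofReal_mul hc20]
    ring
  rw [hX2]
  have hCk : ∀ k, k ≤ k1 + k2 + k3 + 1 → ENNReal.ofReal k ≤ ENNReal.ofReal (k1 + k2 + k3 + 1) :=
    fun k hk => ENNReal.ofReal_le_ofReal hk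
  rw [mul_add, mul_add, mul_one]
  exact add_le_add (add_le_add (hCk _ (by linarith)) (mul_le_mul' (hCk _ (by linarith)) le_rfl))
    (mul_le_mul' (hCk _ (by linarith)) le_rfl)

end Integration

/-! ### Interpolation and infimum over extensions -/

section Conclusion

open Filter Topology

variable {d : ℕ}

theorem isNewtonTrajectory_zero (p : Phase d) :
    IsNewtonTrajectory (fun _ => 0) (fun t : ℝ => p.1 + t • p.2) fun _ => p.2 where
  position t := by simpa using ((hasDerivAt_id t).smul_const p.2).const_add p.1
  force_integrable t := intervalIntegrable_const
  velocity t := by simp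

/-- Zero force is admissible, and the free trajectory through a point of K is at that point at time
0. -/
theorem ContainsTrajectories.subset {A : ℝ} (hA : 0 ≤ A) {I : Set ℝ} (h0 : (0 : ℝ) ∈ I)
    {K K' : Set (Phase d)} (h : ContainsTrajectories A I K K') : K ⊆ K' := fun p hp => by
  have := h (fun _ => 0) measurable_const (fun _ => by simpa using hA) _ _
    (isNewtonTrajectory_zero p) ⟨p, hp, by simp [phaseDist]⟩ 0 h0
  simpa using this

/-- Displacements below 1/2 in position and in velocity keep the perturbed starting point at
Euclidean distance less than 1 from its label. -/
theorem ContainsTrajectories.ae_mem {A δ : ℝ} {F : Pos d → Pos d} {S : ℝ → Phase d → Phase d}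
    {I : Set ℝ} {K K' : Set (Phase d)} (h : ContainsTrajectories A I K K') (hF : Measurable F)
    (hA : ∀ y, ‖F y‖ ≤ A) (hS : SolvesNewton F S) (hδ : δ < 1 / 2)
    (h0 : ∀ ξ, ‖ξ.1 - (S 0 ξ).1‖ ≤ δ ∧ ‖ξ.2 - (S 0 ξ).2‖ ≤ δ) :
    ∀ᵐ ξ, ξ ∈ K → ∀ t ∈ I, S t ξ ∈ K' := by
  filter_upwards [hS] with ξ hξ hK t ht
  refine h F hF hA _ _ hξ ⟨ξ, hK, ?_⟩ t ht
  have h1 := h0 ξ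
  rw [norm_sub_rev, norm_sub_rev ξ.2] at h1
  have h2 := pow_le_pow_left₀ (norm_nonneg _) (h1.1.trans hδ.le) 2
  have h3 := pow_le_pow_left₀ (norm_nonneg _) (h1.2.trans hδ.le) 2
  rw [phaseDist, Real.sqrt_lt' one_pos]
  dsimp only
  linarith

/-- Three regimes, with ρ = √L and P = L^(1-2a) ≥ ρ because a < 1/4. If aρ < 1, then L^(2a) ≤ e⁴ and
L itself is comparable to P. Otherwise 1/a ≤ ρ ≤ P; then the quadratic bound is good for n ≤ ρ and
the linear one for n > ρ. -/
theorem le_mul_of_le_linear_of_le_quadratic {Q κ L a n : ℝ} (hκ : 0 ≤ κ) (hL : 1 ≤ L)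
    (ha0 : 0 < a) (ha1 : a < 1 / 4) (hn : 0 ≤ n) (h1 : Q ≤ κ * L)
    (h2 : Q ≤ κ * (1 + n ^ 2 + 1 / a * n)) :
    Q ≤ κ * (Real.exp 4 + 2) * (1 + L ^ max (1 - 2 * a) (1 / 2)) * (1 + n) := by
  rw [max_eq_left (by linarith)]
  have hL0 : 0 < L := by linarith
  set P := L ^ (1 - 2 * a) with hP
  set ρ := √L with hρ
  have hρL : ρ * ρ = L := Real.mul_self_sqrt hL0.le
  have hρ1 : 1 ≤ ρ := Real.one_le_sqrt.2 hL
  have hρP : ρ ≤ P := by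
    rw [hρ, Real.sqrt_eq_rpow]
    exact Real.rpow_le_rpow_of_exponent_le hL (by linarith)
  have he : 0 < Real.exp 4 := Real.exp_pos 4
  have hP0 : 0 < P := by linarith
  have hPn : 0 ≤ P * n := by positivity
  have hexp : κ * (Real.exp 4 + 2) * (1 + P) * (1 + n)
      = κ * (Real.exp 4 * P + 2 * P * n + 2 + (Real.exp 4 + 2 * P + (Real.exp 4 + 2) * n +
        Real.exp 4 * P * n)) := by ring
  rw [hexp]
  have hrest : 0 ≤ Real.exp 4 + 2 * P + (Real.exp 4 + 2) * n + Real.exp 4 * P * n := by positivity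
  have heP : 0 ≤ Real.exp 4 * P := by positivity
  by_cases hc : a * ρ < 1
  · refine h1.trans (mul_le_mul_of_nonneg_left ?_ hκ)
    have hlog : Real.log L ≤ 2 * ρ := by
      have h3 := Real.log_le_sub_one_of_pos (show 0 < ρ by linarith)
      rw [← hρL, Real.log_mul (by positivity) (by positivity)]
      linarith
    -- From log L ≤ 2ρ the exponent is 2a log L ≤ 4aρ < 4.
    have h4 : L ^ (2 * a) ≤ Real.exp 4 := by
      rw [Real.rpow_def_of_pos hL0, Real.exp_le_exp]
      nlinarith
    have h5 : L = L ^ (2 * a) * P := by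
      rw [hP, ← Real.rpow_add hL0]
      simp
    have h6 : L ≤ Real.exp 4 * P := by
      nth_rewrite 1 [h5]
      gcongr
    linarith
  · have hc' : 1 / a ≤ P := by
      rw [div_le_iff₀ ha0]
      nlinarith
    by_cases hnρ : n ≤ ρ
    · refine h2.trans (mul_le_mul_of_nonneg_left ?_ hκ)
      have h3 : n ^ 2 ≤ P * n := by nlinarith
      have h4 : 1 / a * n ≤ P * n := by gcongr
      linarith
    · refine h1.trans (mul_le_mul_of_nonneg_left ?_ hκ)
      -- L = ρ · ρ, with one factor bounded by P and the other by n.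
      have h3 : L ≤ P * n := by
        rw [← hρL]
        exact mul_le_mul hρP (not_le.1 hnρ).le (by linarith) hP0.le
      linarith

/-- A bound that is affine in the norm passes to the infimum. F is its own extension, so the infimum
is finite and `toReal` loses nothing; extensions of infinite norm do not matter. -/
theorem le_of_forall_extension {s : ℝ} {K : Set (Pos d)} {F : Pos d → Pos d} (hF : MemH s F)
    {Q c : ℝ} (hc : 0 < c)
    (h : ∀ G : Pos d → Pos d, G =ᵐ[volume.restrict K] F → sobolevENorm s G < ∞ →
      Q ≤ c * (1 + (sobolevENorm s G).toReal)) :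
    Q ≤ c * (1 + sobolevNormOn s K F) := by
  have hfin : (⨅ (G : Pos d → Pos d) (_ : G =ᵐ[volume.restrict K] F), sobolevENorm s G) ≠ ∞ :=
    (lt_of_le_of_lt (iInf₂_le (f := fun G (_ : G =ᵐ[volume.restrict K] F) => sobolevENorm s G) F
      (Filter.EventuallyEq.refl _ F)) hF).ne
  have h1 : ENNReal.ofReal (Q / c - 1) ≤
      ⨅ (G : Pos d → Pos d) (_ : G =ᵐ[volume.restrict K] F), sobolevENorm s G := by
    refine le_iInf₂ fun G hG => ?_
    by_cases hGfin : sobolevENorm s G < ∞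
    · rw [ENNReal.ofReal_le_iff_le_toReal hGfin.ne]
      have := h G hG hGfin
      rw [sub_le_iff_le_add', div_le_iff₀' hc]
      exact this
    · rw [not_lt_top_iff.1 hGfin]
      exact le_top
  rw [ENNReal.ofReal_le_iff_le_toReal hfin] at h1
  rw [sub_le_iff_le_add', div_le_iff₀' hc] at h1
  exact h1

end Conclusion

theorem proposition1 (d : ℕ) (T : ℝ) (hT : 0 < T) (A : ℝ) (hA : 0 < A) (D M : ℝ) :
    ∃ C : ℝ, 0 < C ∧
      ∀ Ω Ω' Ω'' : Set (Phase d), IsCompact Ω → IsCompact Ω' → IsCompact Ω'' →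
        ContainsTrajectories A (Icc 0 T) Ω Ω' →
        ContainsTrajectories A (Icc (-T) 0) Ω' Ω'' →
        (∀ p ∈ Ω', ∀ q ∈ Ω', phaseDist p q ≤ D) →
        volume Ω'' ≤ ENNReal.ofReal M →
        ∀ a ∈ Ioo (0 : ℝ) (1 / 4), ∀ F : Pos d → Pos d, MemH (3 / 4 + a) F →
          eLpNorm F ∞ volume ≤ ENNReal.ofReal A →
          ∀ δ : ℝ, 0 < δ → δ < 1 / Real.exp 1 →
            ∀ S Sδ : ℝ → Phase d → Phase d,
              SolvesNewton F S → IsHamiltonianFlow S →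
              SolvesNewton F Sδ → IsHamiltonianFlow Sδ →
              (∀ ξ, S 0 ξ = ξ) →
              (∀ ξ, ‖(S 0 ξ).1 - (Sδ 0 ξ).1‖ ≤ δ ∧ ‖(S 0 ξ).2 - (Sδ 0 ξ).2‖ ≤ δ) →
              IntegrableOn (logSeparation T δ S Sδ) Ω volume ∧
              Qfun Ω T δ S Sδ ≤
                C * (1 + Real.log (1 / δ) ^ max (1 - 2 * a) (1 / 2)) *
                  (1 + sobolevNormOn (3 / 4 + a) (Prod.fst '' Ω'') F) := by
  obtain ⟨C₁, hC₁, hest⟩ := exists_lintegral_logSeparation_le d hT.le hA.le D M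
  set c := 2 + (1 + T) * ((1 + T) * (1 + 2 * A * T)) ^ 2 with hc
  set m := max M 0 with hm
  have hm0 : 0 ≤ m := le_max_right _ _
  have hc0 : 0 < c := by positivity
  -- One constant for both estimates: C₁ for the quadratic bound, and c times the volume bound for
  -- the logarithmic one.
  set κ := C₁ + c * m with hκ
  have hκ0 : 0 < κ := by positivity
  refine ⟨κ * (Real.exp 4 + 2), by positivity, ?_⟩
  intro Ω Ω' Ω'' hΩ hΩ' hΩ'' hcon hcon' hD hM a ha F hF hFA δ hδ hδe S S' hS hH hS' hH' hid h0
  have hexp : (2 : ℝ) < Real.exp 1 := by have := Real.exp_one_gt_d9; linarith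
  have hδ2 : δ < 1 / 2 := hδe.trans (one_div_lt_one_div_of_lt two_pos hexp)
  have hL : 1 ≤ Real.log (1 / δ) := by
    rw [Real.le_log_iff_exp_le (by positivity), le_div_iff₀ hδ, ← le_div_iff₀' (Real.exp_pos 1)]
    exact hδe.le
  obtain ⟨F₀, hF₀m, hF₀A, hFF₀⟩ := exists_bounded_version
    (aestronglyMeasurable_of_complexify hF.memLp.1) hA.le hFA
  -- The containment assumptions concern everywhere bounded measurable forces, while F is bounded
  -- only almost everywhere; both flows also solve the equations for the bounded version.
  have hS₀ := hS.congr hH hFF₀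
  have hS₀' := hS'.congr hH' hFF₀
  have hsub : Ω ⊆ Ω' := hcon.subset hA.le (left_mem_Icc.2 hT.le)
  have hsub' : Ω' ⊆ Ω'' := hcon'.subset hA.le (right_mem_Icc.2 (by linarith))
  have hM' : volume Ω' ≤ ENNReal.ofReal M := (measure_mono hsub').trans hM
  have hM0 : volume Ω ≤ ENNReal.ofReal M := (measure_mono hsub).trans hM'
  have hmem : ∀ᵐ ξ, ξ ∈ Ω → ∀ t ∈ Icc 0 T, S t ξ ∈ Ω' :=
    hcon.ae_mem hF₀m hF₀A hS₀ hδ2 fun ξ => by simpa [hid ξ] using hδ.le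
  have hmem' : ∀ᵐ ξ, ξ ∈ Ω → ∀ t ∈ Icc 0 T, S' t ξ ∈ Ω' :=
    hcon.ae_mem hF₀m hF₀A hS₀' hδ2 fun ξ => by simpa only [hid ξ] using h0 ξ
  -- The Gaussian is centred at the velocity of an arbitrary point of Ω', so that only the diameter
  -- of Ω', and not its location, enters the constant.
  obtain ⟨v₀, hv₀⟩ : ∃ v₀ : Pos d, ∀ p ∈ Ω', ‖p.2 - v₀‖ ≤ D := by
    rcases Ω'.eq_empty_or_nonempty with h | ⟨q, hq⟩
    · exact ⟨0, by simp [h]⟩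
    · refine ⟨q.2, fun p hp => le_trans ?_ (hD p hp q hq)⟩
      exact Real.le_sqrt_of_sq_le (le_add_of_nonneg_left (sq_nonneg _))
  have hnonneg : ∀ ξ, 0 ≤ logSeparation T δ S S' ξ := fun ξ => by
    refine Real.log_nonneg (le_add_of_nonneg_right (mul_nonneg (by positivity) (add_nonneg ?_ ?_)))
    · exact Real.sSup_nonneg (by rintro _ ⟨t, -, rfl⟩; positivity)
    · exact intervalIntegral.integral_nonneg hT.le fun t _ => by positivity
  have hcrude : ∀ᵐ ξ, logSeparation T δ S S' ξ ≤ c * Real.log (1 / δ) := by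
    filter_upwards [hS₀, hS₀'] with ξ h1 h2
    exact log_separation_le_log hF₀A hδ hL hT.le h1 h2 (h0 ξ).1 (h0 ξ).2
  have hmeas := aestronglyMeasurable_logSeparation hS₀ hH hS₀' hH' hT.le δ
  have hint : IntegrableOn (logSeparation T δ S S') Ω volume := by
    refine Measure.integrableOn_of_bounded hΩ.measure_lt_top.ne hmeas
      (M := c * Real.log (1 / δ)) (ae_restrict_of_ae (hcrude.mono fun ξ hξ => ?_))
    rwa [Real.norm_of_nonneg (hnonneg ξ)]
  refine ⟨hint, ?_⟩
  have hvol : volume.real Ω ≤ m := by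
    refine ENNReal.toReal_le_of_le_ofReal hm0 (hM0.trans (ENNReal.ofReal_le_ofReal ?_))
    exact le_max_left _ _
  have hQ1 : Qfun Ω T δ S S' ≤ κ * Real.log (1 / δ) := by
    have hfin : IsFiniteMeasure (volume.restrict Ω) :=
      isFiniteMeasure_restrict.2 hΩ.measure_lt_top.ne
    calc Qfun Ω T δ S S' ≤ ∫ _ξ in Ω, c * Real.log (1 / δ) :=
          integral_mono_ae hint (integrable_const _) (ae_restrict_of_ae hcrude)
      _ = volume.real Ω * (c * Real.log (1 / δ)) := by simp
      _ ≤ m * (c * Real.log (1 / δ)) := by gcongr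
      _ ≤ _ := by
          rw [hκ]
          have : 0 ≤ C₁ * Real.log (1 / δ) := by positivity
          linarith
  have hofQ : ENNReal.ofReal (Qfun Ω T δ S S')
      = ∫⁻ ξ in Ω, ENNReal.ofReal (logSeparation T δ S S' ξ) :=
    ofReal_integral_eq_lintegral_ofReal hint (ae_of_all _ hnonneg)
  have hP0 : 0 ≤ Real.log (1 / δ) ^ max (1 - 2 * a) (1 / 2) := by positivity
  -- The interpolation is carried out for each extension G separately, before taking the infimum; G
  -- itself need not be bounded.
  refine le_of_forall_extension hF (by positivity) fun G hG hGfin => ?_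
  refine le_mul_of_le_linear_of_le_quadratic hκ0.le hL ha.1 ha.2 ENNReal.toReal_nonneg hQ1 ?_
  have hFG : ∀ᵐ p, p ∈ Ω' → F₀ p.1 = G p.1 := by
    rw [Filter.EventuallyEq, ae_restrict_iff' (hΩ''.image continuous_fst).measurableSet] at hG
    filter_upwards [ae_fst hFF₀, ae_fst hG] with p h1 h2 hp
    rw [h2 (mem_image_of_mem _ (hsub' hp)), h1]
  have key := hest Ω Ω' hΩ.measurableSet hΩ'.measurableSet hM0 hM' v₀ hv₀ a ha F₀ G hF₀m hF₀A hFG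
    hGfin δ hδ S S' hS₀ hH hS₀' hH' hmem hmem' h0
  rw [← hofQ] at key
  set n := (sobolevENorm (3 / 4 + a) G).toReal with hn
  have hn0 : 0 ≤ n := ENNReal.toReal_nonneg
  have hGn : sobolevENorm (3 / 4 + a) G = ENNReal.ofReal n := (ENNReal.ofReal_toReal hGfin.ne).symm
  have ha0 := ha.1
  rw [hGn, ← ENNReal.ofReal_one, ← ENNReal.ofReal_pow hn0, ← ENNReal.ofReal_mul (by positivity),
    ← ENNReal.ofReal_add (by positivity) (by positivity),
    ← ENNReal.ofReal_add (by positivity) (by positivity), ← ENNReal.ofReal_mul hC₁.le,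
    ENNReal.ofReal_le_ofReal_iff (by positivity)] at key
  refine key.trans (mul_le_mul_of_nonneg_right ?_ (by positivity))
  rw [hκ]
  exact le_add_of_nonneg_right (by positivity)
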